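/- Let $(Z_t)_{t\in\mathbb Z}$ be independent, identically distributed random variables with $\mathbb E Z_t=0$, $\mathbb E Z_t^2=1$, and let $p\ge 0$. Let $a_0,\dots,a_p:(0,1]\to\mathbb R$ be functions for which there are constants $0<\rho,Q,M<\infty$, $0<\nu<1$ and a positive sequence $(\ell(j))_{j\ge 0}$ with $Q\sum_{j\ge1}1/\ell(j)\le 1-\nu$ and $\sum_{j\ge1}j/\ell(j)<\infty$ such that $a_0(u)>\rho$, $a_j(u)\le Q/\ell(j)$ and $|a_j(u)-a_j(v)|\le M|u-v|/\ell(j)$ for all $u,v\in(0,1]$ and $j=0,\dots,p$. For $0<\rho_1\le\rho_2<\infty$ let $$\Omega=\Big\{\boldsymbol\alpha=(\alpha_0,\dots,\alpha_p):\ \sum_{j=1}^p\alpha_j\le1,\ \rho_1\le\alpha_0\le\rho_2,\ \rho_1\le\alpha_i\ (i=1,\dots,p)\Big\},$$ and suppose that $\mathbf a_u=(a_0(u),\dots,a_p(u))$ lies in the interior of $\Omega$ for every $u\in(0,1]$. For each $N$ let $X_{t,N}$ satisfy $X_{t,N}=\sigma_{t,N}Z_t$, $\sigma_{t,N}^2=a_0(t/N)+\sum_{j=1}^pa_j(t/N)X_{t-j,N}^2$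 almost surely for $t=1,\dots,N$, where $X_{t,N}$ is a.s. equal to a function measurable with respect to $\sigma(Z_s:s\le t)$ (causality) for $1-p\le t\le N$, and the initial values satisfy $\sup_{N}\mathbb E X_{t,N}^2<\infty$ for $1-p\le t\le 0$. Let $u_0\in(0,1)$ and let $(\tilde X_t(u_0))_{t\in\mathbb Z}$ be a strictly stationary process with $\tilde X_t(u_0)=\sigma_t(u_0)Z_t$, $\sigma_t(u_0)^2=a_0(u_0)+\sum_{j=1}^pa_j(u_0)\tilde X_{t-j}(u_0)^2$ almost surely for all $t\in\mathbb Z$. Let $t_0=t_0(N)\in\mathbb N$ satisfy $|u_0-t_0/N|<1/N$ for all large $N$, let $W:[-1/2,1/2]\to\mathbb R$ (extended by $0$) be of bounded variation with $\int_{-1/2}^{1/2}W(x)\,dx=1$, and let $b=b(N)$ satisfy $b\to0$ and $bN\to\infty$ as $N\to\infty$. Put $$\ell_{k,N}(\boldsymbol\alpha)=\tfrac12\Big(\log w_{k,N}(\boldsymbol\alpha)+\frac{X_{k,N}^2}{w_{k,N}(\boldsymbol\alpha)}\Big),\quad w_{k,N}(\boldsymbol\alpha)=\alpha_0+\sum_{j=1}^p\alpha_jX_{k-j,N}^2,\qquad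 \mathcal L_{t_0,N}(\boldsymbol\alpha)=\sum_{k=p+1}^N\frac1{bN}W\Big(\frac{t_0-k}{bN}\Big)\ell_{k,N}(\boldsymbol\alpha),$$ let $\tilde\ell_k(u_0,\boldsymbol\alpha)$ and $\tilde{\mathcal L}_N(u_0,\boldsymbol\alpha)$ be defined in the same way with $X_{k,N}$ replaced by $\tilde X_k(u_0)$, and let $\mathcal B_{t_0,N}=\mathcal L_{t_0,N}-\tilde{\mathcal L}_N(u_0,\cdot)$ and $\mathcal L(u_0,\boldsymbol\alpha)=\mathbb E\,\tilde\ell_0(u_0,\boldsymbol\alpha)$. Then for every $\boldsymbol\alpha\in\Omega$ the variable $\tilde\ell_0(u_0,\boldsymbol\alpha)$ is integrable and $\mathcal L(u_0,\cdot)$ is twice continuously differentiable near $\boldsymbol\alpha$, and, as $N\to\infty$, in probability, $$\sup_{\boldsymbol\alpha\in\Omega}|\tilde{\mathcal L}_N(u_0,\boldsymbol\alpha)-\mathcal L(u_0,\boldsymbol\alpha)|\to0,\qquad \sup_{\boldsymbol\alpha\in\Omega}|\mathcal B_{t_0,N}(\boldsymbol\alpha)|\to0,$$ $$\sup_{\boldsymbol\alpha\in\Omega}|\nabla^2\tilde{\mathcal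 L}_N(u_0,\boldsymbol\alpha)-\nabla^2\mathcal L(u_0,\boldsymbol\alpha)|\to0,\qquad \sup_{\boldsymbol\alpha\in\Omega}|\nabla^2\mathcal B_{t_0,N}(\boldsymbol\alpha)|\to0,$$ and consequently $$\sup_{\boldsymbol\alpha\in\Omega}|\mathcal L_{t_0,N}(\boldsymbol\alpha)-\mathcal L(u_0,\boldsymbol\alpha)|\to0,\qquad \sup_{\boldsymbol\alpha\in\Omega}|\nabla^2\mathcal L_{t_0,N}(\boldsymbol\alpha)-\nabla^2\mathcal L(u_0,\boldsymbol\alpha)|\to0,$$ where $\nabla^2$ is the Hessian matrix in $\boldsymbol\alpha$ and $|\cdot|$ of a matrix is the largest absolute value of its entries. -/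

import Mathlib

open MeasureTheory ProbabilityTheory Filter Topology Set

namespace TVARCH

noncomputable section

/-- Parameter vectors `(α₀, α₁, …, α_p)`. -/
abbrev Param (p : ℕ) : Type := Fin (p + 1) → ℝ

/-- `α₀ + ∑_{j=1}^p α_j x_{k-j}²` for a path `x`. -/
def condVar {p : ℕ} (α : Param p) (x : ℤ → ℝ) (k : ℤ) : ℝ :=
  α 0 + ∑ j : Fin p, α j.succ * x (k - ((j : ℕ) + 1 : ℤ)) ^ 2

/-- The Gaussian conditional quasi-log-likelihood of the observation at time `k`:
`½ (log w_k(α) + x_k² / w_k(α))`, with `w_k(α) = α₀ + ∑_{j=1}^p α_j x_{k-j}²`. -/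
def quasiLik {p : ℕ} (α : Param p) (x : ℤ → ℝ) (k : ℤ) : ℝ :=
  (1 / 2) * (Real.log (condVar α x k) + x k ^ 2 / condVar α x k)

/-- The kernel-weighted quasi-likelihood of a path `x` around the time point `t₀`:
`∑_{k=p+1}^N (1/(bN)) W((t₀-k)/(bN)) ℓ_k(α)`. -/
def kernelLik {p : ℕ} (W : ℝ → ℝ) (b : ℝ) (N t₀ : ℕ) (x : ℤ → ℝ) (α : Param p) : ℝ :=
  ∑ k ∈ Finset.Icc (p + 1) N,
    1 / (b * N) * W (((t₀ : ℝ) - k) / (b * N)) * quasiLik α x (k : ℤ)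

/-- The compact parameter set: `∑_{j=1}^p α_j ≤ 1`, `ρ₁ ≤ α₀ ≤ ρ₂` and `ρ₁ ≤ α_j` for
`j = 1, …, p`. -/
def paramSet (p : ℕ) (ρ₁ ρ₂ : ℝ) : Set (Param p) :=
  {α | ∑ j : Fin p, α j.succ ≤ 1 ∧ ρ₁ ≤ α 0 ∧ α 0 ≤ ρ₂ ∧ ∀ j : Fin p, ρ₁ ≤ α j.succ}

/-- The innovations: independent, identically distributed, with mean zero and variance one. -/
structure IsInnovation {S : Type*} [MeasurableSpace S] (μ : Measure S) (Z : ℤ → S → ℝ) :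
    Prop where
  measurable : ∀ t, Measurable (Z t)
  indep : iIndepFun Z μ
  identDistrib : ∀ t, IdentDistrib (Z t) (Z 0) μ μ
  mean : ∫ ω, Z 0 ω ∂μ = 0
  second_moment : ∫ ω, Z 0 ω ^ 2 ∂μ = 1

/-- The conditions on the parameter functions `a_j : (0,1] → ℝ`: `a₀` is bounded away from zero,
the `a_j` are bounded by `Q / ℓ(j)` and Lipschitz with constant `M / ℓ(j)`, where the positive
sequence `ℓ` satisfies `Q ∑_{j ≥ 1} 1/ℓ(j) ≤ 1 - ν` and `∑_{j ≥ 1} j/ℓ(j) < ∞`. -/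
def ParamCond {p : ℕ} (a : Fin (p + 1) → ℝ → ℝ) : Prop :=
  ∃ (ρ Q M ν : ℝ) (l : ℕ → ℝ), 0 < ρ ∧ 0 < Q ∧ 0 < M ∧ 0 < ν ∧ ν < 1 ∧ (∀ j, 0 < l j) ∧
    (∀ u ∈ Ioc (0 : ℝ) 1, ρ < a 0 u) ∧
    (∀ j : Fin (p + 1), ∀ u ∈ Ioc (0 : ℝ) 1, a j u ≤ Q / l j) ∧
    Summable (fun j : ℕ => 1 / l (j + 1)) ∧
    Q * ∑' j : ℕ, 1 / l (j + 1) ≤ 1 - ν ∧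
    (∀ j : Fin (p + 1), ∀ u ∈ Ioc (0 : ℝ) 1, ∀ v ∈ Ioc (0 : ℝ) 1,
      |a j u - a j v| ≤ M * (|u - v| / l j)) ∧
    Summable (fun j : ℕ => ((j : ℝ) + 1) / l (j + 1))

/-- The σ-algebra generated by `Z_s`, `s ≤ t`. -/
abbrev past {S : Type*} (Z : ℤ → S → ℝ) (t : ℤ) : MeasurableSpace S :=
  ⨆ s ≤ t, MeasurableSpace.comap (Z s) inferInstance

/-- `X N t` is a (causal) tvARCH(p) process `X_{t,N}` with innovations `Z` and parameter functions
`a_j`: for `t = 1, …, N`, `X_{t,N} = σ_{t,N} Z_t` where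
`σ_{t,N}² = a₀(t/N) + ∑_{j=1}^p a_j(t/N) X_{t-j,N}²`. The values at the times `1-p, …, 0`, from
which the recursion starts, are any causal random variables whose second moments are bounded
in `N`. -/
structure IsTVARCH {S : Type*} [MeasurableSpace S] (μ : Measure S) (Z : ℤ → S → ℝ) {p : ℕ}
    (a : Fin (p + 1) → ℝ → ℝ) (X : ℕ → ℤ → S → ℝ) : Prop where
  equation : ∀ (N : ℕ) (t : ℤ), 1 ≤ t → t ≤ N → ∃ σ : S → ℝ, ∀ᵐ ω ∂μ,
    X N t ω = σ ω * Z t ω ∧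
      σ ω ^ 2 = condVar (fun j => a j ((t : ℝ) / N)) (fun s => X N s ω) t
  causal : ∀ (N : ℕ) (t : ℤ), 1 - (p : ℤ) ≤ t → t ≤ N →
    ∃ Y : S → ℝ, Measurable[past Z t] Y ∧ X N t =ᵐ[μ] Y
  initial_bound : ∃ C : NNReal, ∀ (N : ℕ) (t : ℤ), 1 - (p : ℤ) ≤ t → t ≤ 0 →
    ∫⁻ ω, ENNReal.ofReal (X N t ω ^ 2) ∂μ ≤ C

/-- `Y` is a stationary ARCH(p) process with innovations `Z` and parameters `α`: a strictly
stationary process with `Y_t = σ_t Z_t`, `σ_t² = α₀ + ∑_{j=1}^p α_j Y_{t-j}²` for all `t ∈ ℤ`. -/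
structure IsStationaryARCH {S : Type*} [MeasurableSpace S] (μ : Measure S) (Z : ℤ → S → ℝ)
    {p : ℕ} (α : Param p) (Y : ℤ → S → ℝ) : Prop where
  equation : ∀ t : ℤ, ∃ σ : S → ℝ, ∀ᵐ ω ∂μ,
    Y t ω = σ ω * Z t ω ∧ σ ω ^ 2 = condVar α (fun s => Y s ω) t
  stationary : ∀ h : ℤ,
    IdentDistrib (fun ω (t : ℤ) => Y (t + h) ω) (fun ω (t : ℤ) => Y t ω) μ μ

/-- A kernel on `[-1/2, 1/2]`, extended by zero: of bounded variation on `[-1/2, 1/2]` and with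
integral one. -/
structure IsKernel (W : ℝ → ℝ) : Prop where
  zero_outside : ∀ x, x ∉ Icc (-(1 / 2) : ℝ) (1 / 2) → W x = 0
  boundedVariation : BoundedVariationOn W (Icc (-(1 / 2) : ℝ) (1 / 2))
  integral_eq_one : ∫ x in (-(1 / 2) : ℝ)..(1 / 2), W x = 1

/-- The local quasi-likelihood `𝓛_{t₀,N}(α)` of the tvARCH process. -/
def localLik {S : Type*} {p : ℕ} (W : ℝ → ℝ) (b : ℕ → ℝ) (t₀ : ℕ → ℕ) (X : ℕ → ℤ → S → ℝ)
    (N : ℕ) (ω : S) (α : Param p) : ℝ :=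
  kernelLik W (b N) N (t₀ N) (fun t => X N t ω) α

/-- The weighted quasi-likelihood of the stationary process `Y` (which is `X̃(u₀)`). -/
def statLik {S : Type*} {p : ℕ} (W : ℝ → ℝ) (b : ℕ → ℝ) (t₀ : ℕ → ℕ) (Y : ℤ → S → ℝ)
    (N : ℕ) (ω : S) (α : Param p) : ℝ :=
  kernelLik W (b N) N (t₀ N) (fun t => Y t ω) α

/-- The bias term: the local likelihood minus its stationary counterpart. -/
def bias {S : Type*} {p : ℕ} (W : ℝ → ℝ) (b : ℕ → ℝ) (t₀ : ℕ → ℕ) (X : ℕ → ℤ → S → ℝ)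
    (Y : ℤ → S → ℝ) (N : ℕ) (ω : S) (α : Param p) : ℝ :=
  localLik W b t₀ X N ω α - statLik W b t₀ Y N ω α

/-- The limit `𝓛(u₀, α)`: the expectation of the quasi-log-likelihood of the stationary process
at time zero. -/
def limitLik {S : Type*} [MeasurableSpace S] (μ : Measure S) {p : ℕ} (Y : ℤ → S → ℝ)
    (α : Param p) : ℝ :=
  ∫ ω, quasiLik α (fun t => Y t ω) 0 ∂μ

/-- The Hessian matrix `(∂² f / ∂α_i ∂α_j)_{i,j}`, indexed by `i, j = 0, …, p`. -/
def hessian {p : ℕ} (f : Param p → ℝ) (α : Param p) : Matrix (Fin (p + 1)) (Fin (p + 1)) ℝ :=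
  Matrix.of fun i j => fderiv ℝ (fderiv ℝ f) α (Pi.single i 1) (Pi.single j 1)

/-- `sup_{α ∈ K} ‖F_N(α) - G(α)‖ → 0` in probability as `N → ∞`; the supremum is taken
in `[0, ∞]`. -/
def UnifTendstoInProb {S V E : Type*} [MeasurableSpace S] (μ : Measure S) [NormedAddCommGroup E]
    (K : Set V) (F : ℕ → S → V → E) (G : V → E) : Prop :=
  TendstoInMeasure μ (fun N ω => ⨆ α ∈ K, ‖F N ω α - G α‖ₑ) atTop 0

end

end TVARCH

/- The norm of a matrix is the largest absolute value of its entries. -/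
attribute [local instance] Matrix.normedAddCommGroup

/-! Each likelihood term and each entry of its Hessian is a function g(α, y) = A(α, y) + y₀ B(α, y)
of the squared lags y = (x_k², …, x_{k-p}²). On a box where all α_i ≥ δ > 0, every regressor is at
most 1/δ times the conditional variance w. Hence log w is Lipschitz and the quotients `ratio` are
bounded and Lipschitz, in the lags and in α, so A is Lipschitz and B is bounded and Lipschitz.
`TameFamily` records what follows: linear growth, and a Lipschitz bound in the lags up to an error
of order y₀ 1{y₀ > T}. First moments of the squared processes therefore suffice throughout.

The stationary process comes with no moments and no causality. Its square V solves V_t = Z_t² (α₀ +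
∑ α_j V_{t-j}). Iterating this from zero gives increasing approximations `archApprox`, each
depending on finitely many innovations. Unless one of p starting values exceeds T, the error is at
most T times the homogeneous recursion `archPropagator`. The mean of that recursion decays
geometrically because ∑ α_j ≤ 1 - ν, while stationarity makes the exceptional event unlikely
uniformly in time. So V is the a.s. limit of the approximations; this makes it causal, and monotone
convergence makes it integrable.

Bias: X_{t,N}² and V_t are causal and Z_t² has mean one, so E|X_{t,N}² - V_t| obeys a contractive
recursion driven by |a_j(t/N) - a_j(u₀)|. Its solution is of order |t/N - u₀| + 1/N + r^t
(`IsTVARCH.exists_driftBound`), which vanishes uniformly over the kernel window.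

Law of large numbers: replacing the lags by `archApprox` and truncating gives bounded m-dependent
variables. Their weighted sums have vanishing variance because the weights are at most C/(bN) and
absolutely summable uniformly in N. The weights sum to 1 in the limit by a Riemann sum argument, and
a finite net of parameters with the Lipschitz bound in α gives uniformity. Differentiation under the
expectation identifies the Hessian of the limit. All suprema are controlled by integrable majorants
with small mean, and Markov's inequality yields convergence in probability. -/

namespace TVARCH

/-! ### The quasi-likelihood as a function of squared lags -/

/-- The squared observations `x_k², x_{k-1}², …, x_{k-p}²`. -/
noncomputable def lagSq {p : ℕ} (x : ℤ → ℝ) (k : ℤ) : Fin (p + 1) → ℝ := fun j => x (k - (j : ℕ)) ^ 2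

/-- The regressors `(1, y₁, …, y_p)`. -/
noncomputable def regress {p : ℕ} (y : Fin (p + 1) → ℝ) : Fin (p + 1) → ℝ := Fin.cons 1 (fun j => y j.succ)

/-- The linear form `α ↦ α₀ + ∑ α_j y_j`. -/
noncomputable def lagForm {p : ℕ} (y : Fin (p + 1) → ℝ) : Param p →L[ℝ] ℝ :=
  ∑ i, regress y i • ContinuousLinearMap.proj (R := ℝ) (φ := fun _ : Fin (p + 1) => ℝ) i

/-- The quasi-likelihood as a function of the squared lags. -/
noncomputable def lagLik {p : ℕ} (α : Param p) (y : Fin (p + 1) → ℝ) : ℝ :=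
  (1 / 2) * (Real.log (lagForm y α) + y 0 / lagForm y α)

/-- The normalized regressors. -/
noncomputable def ratio {p : ℕ} (i : Fin (p + 1)) (α : Param p) (y : Fin (p + 1) → ℝ) : ℝ :=
  regress y i / lagForm y α

/-- The entries of the Hessian of `lagLik`. -/
noncomputable def lagHess {p : ℕ} (i j : Fin (p + 1)) (α : Param p) (y : Fin (p + 1) → ℝ) : ℝ :=
  -(1 / 2) * (ratio i α y * ratio j α y) + y 0 * (ratio 0 α y * (ratio i α y * ratio j α y))

variable {p : ℕ}

lemma lagForm_apply (y : Fin (p + 1) → ℝ) (α : Param p) :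
    lagForm y α = ∑ i, regress y i * α i := by
  simp [lagForm]

lemma regress_zero (y : Fin (p + 1) → ℝ) : regress y 0 = 1 := rfl

lemma regress_succ (y : Fin (p + 1) → ℝ) (j : Fin p) : regress y j.succ = y j.succ := rfl

lemma condVar_eq (α : Param p) (x : ℤ → ℝ) (k : ℤ) : condVar α x k = lagForm (lagSq x k) α := by
  rw [lagForm_apply, Fin.sum_univ_succ, condVar]
  simp [regress_zero, regress_succ, lagSq, mul_comm]

lemma quasiLik_eq (α : Param p) (x : ℤ → ℝ) (k : ℤ) : quasiLik α x k = lagLik α (lagSq x k) := by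
  simp [quasiLik, lagLik, condVar_eq, lagSq]

lemma lagSq_nonneg (x : ℤ → ℝ) (k : ℤ) : 0 ≤ (lagSq x k : Fin (p + 1) → ℝ) :=
  fun _ => sq_nonneg _

lemma regress_nonneg {y : Fin (p + 1) → ℝ} (hy : 0 ≤ y) (i) : 0 ≤ regress y i := by
  refine Fin.cases ?_ (fun j => ?_) i
  · simp [regress_zero]
  · exact hy _

lemma abs_regress_sub_le (x y : Fin (p + 1) → ℝ) (i) : |regress x i - regress y i| ≤ ‖x - y‖ := by
  refine Fin.cases ?_ (fun j => ?_) i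
  · simp [regress_zero]
  · exact norm_le_pi_norm (x - y) j.succ

/-- All summands of the linear form are nonnegative, so one of them is at most the whole. This is
where the lower bound on every coefficient enters: the conditional variance dominates each
regressor, however large the lags are. -/
lemma mul_regress_le {δ : ℝ} {α : Param p} (hδ : 0 ≤ δ) (hα : ∀ i, δ ≤ α i) {y : Fin (p + 1) → ℝ}
    (hy : 0 ≤ y) (i) : δ * regress y i ≤ lagForm y α := by
  rw [lagForm_apply]
  have h : regress y i * α i ≤ ∑ i, regress y i * α i :=
    Finset.single_le_sum (f := fun i => regress y i * α i)
      (fun j _ => mul_nonneg (regress_nonneg hy j) (hδ.trans (hα j))) (Finset.mem_univ i)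
  have := mul_le_mul_of_nonneg_left (hα i) (regress_nonneg hy i)
  linarith

lemma le_lagForm {δ : ℝ} {α : Param p} (hδ : 0 ≤ δ) (hα : ∀ i, δ ≤ α i) {y : Fin (p + 1) → ℝ}
    (hy : 0 ≤ y) : δ ≤ lagForm y α := by
  simpa [regress_zero] using mul_regress_le hδ hα hy 0

lemma lagForm_pos {α : Param p} (hα : ∀ i, 0 < α i) {y : Fin (p + 1) → ℝ}
    (hy : 0 ≤ y) : 0 < lagForm y α := by
  rw [lagForm_apply]
  refine (hα 0).trans_le ?_
  have := Finset.single_le_sum (f := fun i => regress y i * α i)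
      (fun j _ => mul_nonneg (regress_nonneg hy j) (hα j).le) (Finset.mem_univ 0)
  simpa [regress_zero] using this

lemma ratio_nonneg {α : Param p} (hα : ∀ i, 0 < α i) {y : Fin (p + 1) → ℝ}
    (hy : 0 ≤ y) (i) : 0 ≤ ratio i α y :=
  div_nonneg (regress_nonneg hy i) (lagForm_pos hα hy).le

lemma ratio_le {δ : ℝ} {α : Param p} (hδ : 0 < δ) (hα : ∀ i, δ ≤ α i) {y : Fin (p + 1) → ℝ}
    (hy : 0 ≤ y) (i) : ratio i α y ≤ 1 / δ := by
  have h := le_lagForm hδ.le hα hy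
  rw [ratio, div_le_div_iff₀ (by linarith) hδ]
  linarith [mul_regress_le hδ.le hα hy i]

@[fun_prop]
lemma measurable_regress (i : Fin (p + 1)) :
    Measurable (fun y : Fin (p + 1) → ℝ => regress y i) := by
  refine Fin.cases ?_ (fun j => ?_) i
  · simp [regress_zero]
  · exact measurable_pi_apply _

@[fun_prop]
lemma measurable_lagForm (α : Param p) :
    Measurable (fun y : Fin (p + 1) → ℝ => lagForm y α) := by
  simp only [lagForm_apply]; fun_prop

@[fun_prop]
lemma measurable_ratio (i : Fin (p + 1)) (α : Param p) : Measurable (ratio i α) := by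
  unfold ratio; fun_prop

lemma measurable_lagLik (α : Param p) : Measurable (lagLik α) := by
  unfold lagLik; fun_prop

/-! ### Families with Lipschitz bounds -/

/-- Families of functions of the lags that are Lipschitz in the lags and in the parameter. -/
structure LipFamily (K : Set (Param p)) (C : ℝ) (f : Param p → (Fin (p + 1) → ℝ) → ℝ) : Prop where
  nonneg : 0 ≤ C
  lag : ∀ α ∈ K, ∀ x y, 0 ≤ x → 0 ≤ y → |f α x - f α y| ≤ C * ‖x - y‖
  param : ∀ α ∈ K, ∀ β ∈ K, ∀ y, 0 ≤ y → |f α y - f β y| ≤ C * ‖α - β‖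
  zero : ∀ α ∈ K, |f α 0| ≤ C

/-- Families bounded by `C`. -/
def BddFamily (K : Set (Param p)) (C : ℝ) (f : Param p → (Fin (p + 1) → ℝ) → ℝ) : Prop :=
  ∀ α ∈ K, ∀ y, 0 ≤ y → |f α y| ≤ C

/-- The regularity of a family of functions of the lags on which the limit theorems rest. -/
structure TameFamily (K : Set (Param p)) (C : ℝ) (g : Param p → (Fin (p + 1) → ℝ) → ℝ) : Prop where
  nonneg : 0 ≤ C
  measurable : ∀ α, Measurable (g α)
  growth : ∀ α ∈ K, ∀ y, 0 ≤ y → |g α y| ≤ C * (1 + ‖y‖)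
  param : ∀ α ∈ K, ∀ β ∈ K, ∀ y, 0 ≤ y → |g α y - g β y| ≤ C * ‖α - β‖ * (1 + ‖y‖)
  lag : ∀ T, 0 ≤ T → ∀ α ∈ K, ∀ x y, 0 ≤ x → 0 ≤ y →
    |g α x - g α y| ≤ C * (1 + T) * ‖x - y‖ + C * (if T < y 0 then y 0 else 0)

lemma abs_mul_sub_mul_le {a b c d : ℝ} {C D e : ℝ} (hC : 0 ≤ C)
    (ha : |a| ≤ C) (hd : |d| ≤ C) (h₁ : |b - d| ≤ D * e) (h₂ : |a - c| ≤ D * e) :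
    |a * b - c * d| ≤ 2 * C * D * e := by
  have : a * b - c * d = a * (b - d) + d * (a - c) := by ring
  rw [this]
  refine (abs_add_le _ _).trans ?_
  rw [abs_mul, abs_mul]
  have h3 := mul_le_mul ha h₁ (abs_nonneg _) hC
  have h4 := mul_le_mul hd h₂ (abs_nonneg _) hC
  linarith

lemma BddFamily.mul {K : Set (Param p)} {C D : ℝ} {f g : Param p → (Fin (p + 1) → ℝ) → ℝ}
    (hC : 0 ≤ C) (hf : BddFamily K C f) (hg : BddFamily K D g) :
    BddFamily K (C * D) (fun α y => f α y * g α y) := fun α hα y hy => by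
  rw [abs_mul]
  exact mul_le_mul (hf α hα y hy) (hg α hα y hy) (abs_nonneg _) hC

lemma LipFamily.mono {K : Set (Param p)} {C D : ℝ} {f : Param p → (Fin (p + 1) → ℝ) → ℝ}
    (hf : LipFamily K C f) (h : C ≤ D) : LipFamily K D f where
  nonneg := hf.nonneg.trans h
  lag α hα x y hx hy := (hf.lag α hα x y hx hy).trans (by gcongr)
  param α hα β hβ y hy := (hf.param α hα β hβ y hy).trans (by gcongr)
  zero α hα := (hf.zero α hα).trans h

lemma LipFamily.mul {K : Set (Param p)} {C D : ℝ} {f g : Param p → (Fin (p + 1) → ℝ) → ℝ}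
    (hf : LipFamily K D f) (hg : LipFamily K D g) (hC : 0 ≤ C) (hfb : BddFamily K C f)
    (hgb : BddFamily K C g) :
    LipFamily K (2 * C * D + C * C) (fun α y => f α y * g α y) := by
  have hD := hf.nonneg
  have hCD : 0 ≤ C * D := mul_nonneg hC hD
  refine ⟨by positivity, fun α hα x y hx hy => ?_, fun α hα β hβ y hy => ?_, fun α hα => ?_⟩
  · refine (abs_mul_sub_mul_le hC (hfb α hα x hx) (hgb α hα y hy) (hg.lag α hα x y hx hy)
      (hf.lag α hα x y hx hy)).trans ?_
    gcongr; nlinarith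
  · refine (abs_mul_sub_mul_le hC (hfb α hα y hy) (hgb β hβ y hy) (hg.param α hα β hβ y hy)
      (hf.param α hα β hβ y hy)).trans ?_
    gcongr; nlinarith
  · refine (hfb.mul hC hgb α hα 0 le_rfl).trans ?_
    linarith

lemma LipFamily.const_mul {K : Set (Param p)} {D : ℝ} {f : Param p → (Fin (p + 1) → ℝ) → ℝ}
    (hf : LipFamily K D f) (c : ℝ) : LipFamily K (|c| * D) (fun α y => c * f α y) := by
  refine ⟨mul_nonneg (abs_nonneg _) hf.nonneg, fun α hα x y hx hy => ?_,
    fun α hα β hβ y hy => ?_, fun α hα => ?_⟩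
  · rw [← mul_sub, abs_mul, mul_assoc]
    gcongr; exact hf.lag α hα x y hx hy
  · rw [← mul_sub, abs_mul, mul_assoc]
    gcongr; exact hf.param α hα β hβ y hy
  · rw [abs_mul]
    gcongr; exact hf.zero α hα

lemma BddFamily.const_mul {K : Set (Param p)} {D : ℝ} {f : Param p → (Fin (p + 1) → ℝ) → ℝ}
    (hf : BddFamily K D f) (c : ℝ) : BddFamily K (|c| * D) (fun α y => c * f α y) :=
  fun α hα y hy => by
    rw [abs_mul]
    gcongr; exact hf α hα y hy

/-- A Lipschitz family plus the current squared observation times a bounded Lipschitz family. -/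
lemma TameFamily.of_add_mul {K : Set (Param p)} {C D : ℝ}
    {A B : Param p → (Fin (p + 1) → ℝ) → ℝ} (hA : LipFamily K C A) (hB : LipFamily K C B)
    (hBb : BddFamily K D B) (hD : 0 ≤ D) (hAm : ∀ α, Measurable (A α))
    (hBm : ∀ α, Measurable (B α)) :
    TameFamily K (C + 2 * D) (fun α y => A α y + y 0 * B α y) := by
  have hC := hA.nonneg
  have hle : ∀ y : Fin (p + 1) → ℝ, y 0 ≤ ‖y‖ := fun y => (le_abs_self _).trans (norm_le_pi_norm y 0)
  refine ⟨by positivity, fun α => by have := hAm α; have := hBm α; fun_prop, ?_, ?_, ?_⟩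
  · intro α hα y hy
    have h1 := hA.lag α hα y 0 hy le_rfl
    have h2 := hA.zero α hα
    have h3 := hBb α hα y hy
    rw [sub_zero] at h1
    have h4 : |A α y| ≤ C * ‖y‖ + C := by
      calc |A α y| = |(A α y - A α 0) + A α 0| := by ring_nf
        _ ≤ _ := (abs_add_le _ _).trans (by linarith)
    have h5 : |y 0 * B α y| ≤ ‖y‖ * D := by
      rw [abs_mul]; gcongr; exact norm_le_pi_norm y 0
    refine (abs_add_le _ _).trans ?_
    nlinarith [norm_nonneg y]
  · intro α hα β hβ y hy
    have h1 := hA.param α hα β hβ y hy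
    have h2 := hB.param α hα β hβ y hy
    have : A α y + y 0 * B α y - (A β y + y 0 * B β y) = (A α y - A β y) + y 0 * (B α y - B β y) := by
      ring
    rw [this]
    refine (abs_add_le _ _).trans ?_
    rw [abs_mul]
    have h3 : |y 0| * |B α y - B β y| ≤ ‖y‖ * (C * ‖α - β‖) := by
      gcongr; exact norm_le_pi_norm y 0
    have h4 : 0 ≤ D * ‖α - β‖ * (1 + ‖y‖) := by positivity
    nlinarith
  · intro T hT α hα x y hx hy
    have h1 := hA.lag α hα x y hx hy
    have h2 := hB.lag α hα x y hx hy
    have h3 := hBb α hα x hx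
    have h4 := hBb α hα y hy
    -- The product is split so that `y 0`, not `x 0`, multiplies the difference of `B`. For `y 0 ≤
    -- T` this is Lipschitz with factor `T`; otherwise `|B α x - B α y| ≤ 2 * D` leaves a tail of
    -- `y` alone. Later `y` is the stationary process, so no tail of the other one is needed.
    have e : A α x + x 0 * B α x - (A α y + y 0 * B α y) =
      (A α x - A α y) + (x 0 - y 0) * B α x + y 0 * (B α x - B α y) := by ring
    rw [e]
    have h5 : |(x 0 - y 0) * B α x| ≤ ‖x - y‖ * D := by
      rw [abs_mul]; gcongr; exact norm_le_pi_norm (x - y) 0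
    have hy0 : 0 ≤ y 0 := hy 0
    have h6 : |y 0 * (B α x - B α y)| ≤
        T * (C * ‖x - y‖) + (if T < y 0 then y 0 else 0) * (2 * D) := by
      rw [abs_mul, abs_of_nonneg hy0]
      split_ifs with h
      · have : |B α x - B α y| ≤ 2 * D := (abs_sub _ _).trans (by linarith)
        have h7 : 0 ≤ T * (C * ‖x - y‖) := by positivity
        have := mul_le_mul_of_nonneg_left this hy0
        linarith
      · rw [zero_mul, add_zero]
        have := not_lt.1 h
        gcongr
    refine (abs_add_three _ _ _).trans ?_
    have h8 : 0 ≤ D * T * ‖x - y‖ := by positivity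
    have h9 : 0 ≤ (if T < y 0 then y 0 else 0) := by split_ifs <;> simp [hy0]
    have h10 : 0 ≤ C * (if T < y 0 then y 0 else 0) := by positivity
    have h11 : 0 ≤ D * ‖x - y‖ := by positivity
    nlinarith

/-! ### Regularity of the quasi-likelihood and its Hessian on boxes -/

/-- The box `[δ, R]^{p+1}`. -/
def box (p : ℕ) (δ R : ℝ) : Set (Param p) := {α | ∀ i, δ ≤ α i ∧ α i ≤ R}

lemma abs_lagForm_sub_lag_le {δ R : ℝ} (hδ : 0 ≤ δ) {α : Param p} (hα : α ∈ box p δ R)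
    (x y : Fin (p + 1) → ℝ) : |lagForm x α - lagForm y α| ≤ (p + 1) * R * ‖x - y‖ := by
  rw [lagForm_apply, lagForm_apply, ← Finset.sum_sub_distrib]
  refine (Finset.abs_sum_le_sum_abs _ _).trans ?_
  refine (Finset.sum_le_card_nsmul _ _ (R * ‖x - y‖) fun i _ => ?_).trans ?_
  · rw [← sub_mul, abs_mul, mul_comm]
    refine mul_le_mul ?_ (abs_regress_sub_le x y i) (abs_nonneg _) ?_
    · rw [abs_of_nonneg (hδ.trans (hα i).1)]; exact (hα i).2
    · exact (hδ.trans (hα i).1).trans (hα i).2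
  · simp; ring_nf; rfl

/-- The bound is relative to the size of the form itself, since each regressor is at most `lagForm y
γ / δ`. Dividing by the form then gives Lipschitz constants in the parameter that do not depend on
the lags. -/
lemma abs_lagForm_sub_param_le {δ : ℝ} (hδ : 0 < δ) {α β γ : Param p} (hγ : ∀ i, δ ≤ γ i)
    {y : Fin (p + 1) → ℝ} (hy : 0 ≤ y) :
    |lagForm y α - lagForm y β| ≤ (p + 1) / δ * ‖α - β‖ * lagForm y γ := by
  rw [lagForm_apply, lagForm_apply, ← Finset.sum_sub_distrib]
  refine (Finset.abs_sum_le_sum_abs _ _).trans ?_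
  refine (Finset.sum_le_card_nsmul _ _ (1 / δ * lagForm y γ * ‖α - β‖) fun i _ => ?_).trans ?_
  · rw [← mul_sub, abs_mul, abs_of_nonneg (regress_nonneg hy i)]
    have h0 := le_lagForm hδ.le hγ hy
    refine mul_le_mul ?_ (norm_le_pi_norm (α - β) i) (abs_nonneg _)
      (mul_nonneg (by positivity) (hδ.le.trans h0))
    rw [one_div, inv_mul_eq_div, le_div_iff₀ hδ, mul_comm]
    exact mul_regress_le hδ.le hγ hy i
  · simp; ring_nf; rfl

lemma abs_log_sub_log_le {a b : ℝ} (ha : 0 < a) (hb : 0 < b) :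
    |Real.log a - Real.log b| ≤ |a - b| / min a b := by
  wlog h : b ≤ a generalizing a b
  · rw [abs_sub_comm, abs_sub_comm a, min_comm]
    exact this hb ha (le_of_not_ge h)
  rw [min_eq_right h, abs_of_nonneg (sub_nonneg.2 h),
    abs_of_nonneg (sub_nonneg.2 (Real.log_le_log hb h)), ← Real.log_div ha.ne' hb.ne', sub_div,
    div_self hb.ne']
  exact Real.log_le_sub_one_of_pos (by positivity)

lemma lipFamily_log {δ R : ℝ} (hδ : 0 < δ) : ∃ C, LipFamily (box p δ R)
    C (fun α y => Real.log (lagForm y α)) := by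
  refine ⟨max (max ((p + 1) * R / δ) ((p + 1) / δ)) (|Real.log δ| + |Real.log R|),
    le_max_of_le_right (by positivity), ?_, ?_, ?_⟩
  · intro α hα x y hx hy
    have h1 := le_lagForm hδ.le (fun i => (hα i).1) hx
    have h2 := le_lagForm hδ.le (fun i => (hα i).1) hy
    have h3 : δ ≤ min (lagForm x α) (lagForm y α) := le_min h1 h2
    refine (abs_log_sub_log_le (by linarith) (by linarith)).trans ?_
    calc _ ≤ ((p + 1) * R * ‖x - y‖) / δ := by
            gcongr
            · exact (abs_nonneg _).trans (abs_lagForm_sub_lag_le hδ.le hα x y)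
            · exact abs_lagForm_sub_lag_le hδ.le hα x y
      _ = ((p + 1) * R / δ) * ‖x - y‖ := by ring
      _ ≤ _ := by gcongr; exact (le_max_left _ _).trans (le_max_left _ _)
  · intro α hα β hβ y hy
    have h1 := le_lagForm hδ.le (fun i => (hα i).1) hy
    have h2 := le_lagForm hδ.le (fun i => (hβ i).1) hy
    refine (abs_log_sub_log_le (by linarith) (by linarith)).trans ?_
    have h3 : |lagForm y α - lagForm y β| ≤
        (p + 1) / δ * ‖α - β‖ * min (lagForm y α) (lagForm y β) := by
      -- The reference parameter `γ` is free, so it is taken to be whichever of `α`, `β` attains the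
      -- minimum in the denominator.
      rcases min_choice (lagForm y α) (lagForm y β) with h | h <;> rw [h]
      · exact abs_lagForm_sub_param_le hδ (fun i => (hα i).1) hy
      · exact abs_lagForm_sub_param_le hδ (fun i => (hβ i).1) hy
    rw [div_le_iff₀ (lt_min (by linarith) (by linarith))]
    refine h3.trans ?_
    have : 0 ≤ min (lagForm y α) (lagForm y β) := le_min (by linarith) (by linarith)
    gcongr
    exact (le_max_right _ _).trans (le_max_left _ _)
  · intro α hα
    refine le_trans ?_ (le_max_right _ _)
    have h0 : lagForm (0 : Fin (p + 1) → ℝ) α = α 0 := by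
      rw [lagForm_apply, Fin.sum_univ_succ]; simp [regress_zero, regress_succ]
    rw [h0]
    have h1 := Real.log_le_log hδ (hα 0).1
    have h2 := Real.log_le_log (hδ.trans_le (hα 0).1) (hα 0).2
    rw [abs_le]
    constructor <;> linarith [neg_abs_le (Real.log δ), le_abs_self (Real.log R),
      abs_nonneg (Real.log δ), abs_nonneg (Real.log R)]

lemma bddFamily_ratio {δ R : ℝ} (hδ : 0 < δ) (i) : BddFamily (box p δ R) (1 / δ) (ratio i) := by
  intro α hα y hy
  rw [abs_of_nonneg (ratio_nonneg (fun i => hδ.trans_le (hα i).1) hy i)]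
  exact ratio_le hδ (fun i => (hα i).1) hy i

lemma lipFamily_ratio {δ R : ℝ} (hδ : 0 < δ) (hR : 0 ≤ R) (i) : LipFamily (box p δ R)
    (1 / δ + (p + 1) * R / δ ^ 2 + (p + 1) / δ ^ 2) (ratio i) := by
  refine ⟨by positivity, ?_, ?_, ?_⟩
  · intro α hα x y hx hy
    have h1 := le_lagForm hδ.le (fun i => (hα i).1) hx
    have h2 := le_lagForm hδ.le (fun i => (hα i).1) hy
    have hr := bddFamily_ratio hδ i α hα y hy
    have hl := abs_lagForm_sub_lag_le hδ.le hα y x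
    rw [norm_sub_rev] at hl
    -- The increment of the denominator is multiplied by the bounded `ratio i α y` instead of a raw
    -- regressor, which keeps the constant independent of the lags.
    have e : ratio i α x - ratio i α y = (regress x i - regress y i) / lagForm x α
        + ratio i α y * ((lagForm y α - lagForm x α) / lagForm x α) := by
      have h3 := (hδ.trans_le h1).ne'
      have h4 := (hδ.trans_le h2).ne'
      unfold ratio; field_simp; ring
    rw [e]
    refine (abs_add_le _ _).trans ?_
    have ha : |(regress x i - regress y i) / lagForm x α| ≤ ‖x - y‖ / δ := by
      rw [abs_div, abs_of_pos (hδ.trans_le h1)]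
      gcongr; exact abs_regress_sub_le x y i
    have hb : |(lagForm y α - lagForm x α) / lagForm x α| ≤ ((p + 1) * R * ‖x - y‖) / δ := by
      rw [abs_div, abs_of_pos (hδ.trans_le h1)]
      gcongr
    have hc : |ratio i α y * ((lagForm y α - lagForm x α) / lagForm x α)| ≤
      1 / δ * (((p + 1) * R * ‖x - y‖) / δ) := by
      rw [abs_mul]; gcongr
    calc _ ≤ ‖x - y‖ / δ + 1 / δ * (((p + 1) * R * ‖x - y‖) / δ) := by linarith
      _ = (1 / δ + (p + 1) * R / δ ^ 2) * ‖x - y‖ := by field_simp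
      _ ≤ _ := mul_le_mul_of_nonneg_right
        (le_add_of_nonneg_right (by positivity)) (norm_nonneg _)
  · intro α hα β hβ y hy
    have h1 := le_lagForm hδ.le (fun i => (hα i).1) hy
    have h2 := le_lagForm hδ.le (fun i => (hβ i).1) hy
    have hr := bddFamily_ratio hδ i α hα y hy
    have hl := abs_lagForm_sub_param_le (α := β) (β := α) hδ (fun i => (hβ i).1) hy
    rw [norm_sub_rev] at hl
    have e : ratio i α y - ratio i β y =
        ratio i α y * ((lagForm y β - lagForm y α) / lagForm y β) := by
      have h3 := (hδ.trans_le h1).ne'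
      have h4 := (hδ.trans_le h2).ne'
      unfold ratio; field_simp
    have hb : |(lagForm y β - lagForm y α) / lagForm y β| ≤ (p + 1) / δ * ‖α - β‖ := by
      rw [abs_div, abs_of_pos (hδ.trans_le h2), div_le_iff₀ (hδ.trans_le h2)]
      exact hl
    rw [e, abs_mul]
    calc _ ≤ 1 / δ * ((p + 1) / δ * ‖α - β‖) := by gcongr
      _ = ((p + 1) / δ ^ 2) * ‖α - β‖ := by field_simp
      _ ≤ _ := mul_le_mul_of_nonneg_right
        (le_add_of_nonneg_left (by positivity)) (norm_nonneg _)
  · intro α hα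
    refine (bddFamily_ratio hδ i α hα 0 le_rfl).trans ?_
    linarith [show 0 ≤ (p + 1) * R / δ ^ 2 + (p + 1 : ℝ) / δ ^ 2 by positivity]

lemma lipFamily_ratio_mul {δ R : ℝ} (hδ : 0 < δ) (hR : 0 ≤ R) (i j) : ∃ C, LipFamily (box p δ R) C
    (fun α y => ratio i α y * ratio j α y) :=
  ⟨_, (lipFamily_ratio hδ hR i).mul (lipFamily_ratio hδ hR j) (by positivity)
    (bddFamily_ratio hδ i) (bddFamily_ratio hδ j)⟩

lemma tameFamily_lagLik {δ R : ℝ} (hδ : 0 < δ) (hR : 0 ≤ R) :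
    ∃ C, TameFamily (box p δ R) C lagLik := by
  obtain ⟨C₁, hC₁⟩ := lipFamily_log (p := p) (R := R) hδ
  have h1 := hC₁.const_mul (1 / 2)
  have h2 := (lipFamily_ratio (p := p) hδ hR 0).const_mul (1 / 2)
  have h3 := (bddFamily_ratio (p := p) (R := R) hδ 0).const_mul (1 / 2)
  have := TameFamily.of_add_mul (h1.mono (le_max_left _ _)) (h2.mono (le_max_right _ _)) h3
    (by positivity) (fun α => by fun_prop) (fun α => by fun_prop)
  have e : lagLik = fun (α : Param p) y =>
      1 / 2 * Real.log (lagForm y α) + y 0 * (1 / 2 * ratio 0 α y) := by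
    funext α y
    simp only [lagLik, ratio, regress_zero]; ring
  exact ⟨_, e ▸ this⟩

lemma tameFamily_lagHess {δ R : ℝ} (hδ : 0 < δ) (hR : 0 ≤ R) (i j : Fin (p + 1)) :
    ∃ C, TameFamily (box p δ R) C (lagHess i j) := by
  obtain ⟨C₁, hC₁⟩ := lipFamily_ratio_mul (p := p) hδ hR i j
  have hb := (bddFamily_ratio (p := p) (R := R) hδ i).mul (by positivity) (bddFamily_ratio hδ j)
  have h1 := hC₁.const_mul (-(1 / 2))
  -- `LipFamily.mul` asks for one common bound on both factors; the sum of the two individual bounds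
  -- serves.
  have hb' : BddFamily (box p δ R) (1 / δ + 1 / δ * (1 / δ))
      (fun α y => ratio i α y * ratio j α y) := fun α hα y hy =>
    (hb α hα y hy).trans (by linarith [show 0 ≤ 1 / δ by positivity])
  have hb0 : BddFamily (box p δ R) (1 / δ + 1 / δ * (1 / δ)) (ratio 0) := fun α hα y hy =>
    (bddFamily_ratio hδ 0 α hα y hy).trans (by linarith [show 0 ≤ 1 / δ * (1 / δ) by positivity])
  have h2 := ((lipFamily_ratio (p := p) hδ hR 0).mono (le_max_left _ C₁)).mul
    (hC₁.mono (le_max_right _ _)) (by positivity) hb0 hb'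
  have h3 := (bddFamily_ratio (p := p) (R := R) hδ 0).mul (by positivity) hb
  exact ⟨_, TameFamily.of_add_mul (h1.mono (le_max_left _ _)) (h2.mono (le_max_right _ _)) h3
    (by positivity) (fun α => by fun_prop) (fun α => by fun_prop)⟩

end TVARCH

namespace TVARCH

variable {p : ℕ}

/-! ### Derivatives of the quasi-likelihood in the parameter -/

/-- The derivative of `α ↦ lagLik α y`. -/
noncomputable def lagGrad (α : Param p) (y : Fin (p + 1) → ℝ) : Param p →L[ℝ] ℝ :=
  ((1 / 2) * ((lagForm y α)⁻¹ - y 0 * ((lagForm y α)⁻¹) ^ 2)) • lagForm y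

/-- The second derivative of `α ↦ lagLik α y`. -/
noncomputable def lagHessMap (α : Param p) (y : Fin (p + 1) → ℝ) : Param p →L[ℝ] Param p →L[ℝ] ℝ :=
  (((1 / 2) * (-((lagForm y α)⁻¹) ^ 2 + 2 * y 0 * ((lagForm y α)⁻¹) ^ 3)) •
    lagForm y).smulRight (lagForm y)

lemma hasFDerivAt_lagLik {y : Fin (p + 1) → ℝ} {α : Param p} (h : lagForm y α ≠ 0) :
    HasFDerivAt (fun β => lagLik β y) (lagGrad α y) α := by
  have h1 : HasDerivAt (fun s : ℝ => (1 / 2) * (Real.log s + y 0 / s))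
      ((1 / 2) * ((lagForm y α)⁻¹ - y 0 * ((lagForm y α)⁻¹) ^ 2)) (lagForm y α) := by
    have := ((Real.hasDerivAt_log h).add ((hasDerivAt_inv h).const_mul (y 0))).const_mul (1 / 2)
    refine HasDerivAt.congr_deriv this ?_
    field_simp
    ring
  exact h1.comp_hasFDerivAt α (lagForm y).hasFDerivAt

lemma hasFDerivAt_lagGrad {y : Fin (p + 1) → ℝ} {α : Param p} (h : lagForm y α ≠ 0) :
    HasFDerivAt (fun β => lagGrad β y) (lagHessMap α y) α := by
  have h1 : HasDerivAt (fun s : ℝ => (1 / 2) * (s⁻¹ - y 0 * (s⁻¹) ^ 2))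
      ((1 / 2) * (-((lagForm y α)⁻¹) ^ 2 + 2 * y 0 * ((lagForm y α)⁻¹) ^ 3)) (lagForm y α) := by
    have := ((hasDerivAt_inv h).sub (((hasDerivAt_inv h).pow 2).const_mul (y 0))).const_mul (1 / 2)
    refine HasDerivAt.congr_deriv this ?_
    rw [inv_pow, inv_pow, Nat.cast_ofNat, show 2 - 1 = 1 from rfl, pow_one]
    field_simp
    ring
  exact (h1.comp_hasFDerivAt α (lagForm y).hasFDerivAt).smul_const (lagForm y)

lemma lagForm_single (y : Fin (p + 1) → ℝ) (i : Fin (p + 1)) :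
    lagForm y (Pi.single i 1) = regress y i := by
  rw [lagForm_apply]; simp [Pi.single_apply]

lemma lagHessMap_single (α : Param p) (y : Fin (p + 1) → ℝ) (i j : Fin (p + 1)) :
    lagHessMap α y (Pi.single i 1) (Pi.single j 1) = lagHess i j α y := by
  simp [lagHessMap, lagForm_single, lagHess, ratio, regress_zero]
  ring

lemma hessian_apply_of_hasFDerivAt {f : Param p → ℝ} {f' : Param p → Param p →L[ℝ] ℝ}
    {f'' : Param p →L[ℝ] Param p →L[ℝ] ℝ} {α : Param p}
    (h₁ : ∀ᶠ β in 𝓝 α, HasFDerivAt f (f' β) β) (h₂ : HasFDerivAt f' f'' α) (i j : Fin (p + 1)) :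
    hessian f α i j = f'' (Pi.single i 1) (Pi.single j 1) := by
  have e : fderiv ℝ f =ᶠ[𝓝 α] f' := h₁.mono fun β hβ => hβ.fderiv
  simp only [hessian, Matrix.of_apply]
  rw [(h₂.congr_of_eventuallyEq e).fderiv]

/-- The likelihoods are differentiated on the open positive orthant. It is a neighbourhood of every
parameter with positive coordinates, so boundary points of `paramSet` need no special treatment. -/
lemma isOpen_posParam : IsOpen {α : Param p | ∀ i, 0 < α i} := by
  simp only [ofPred_forall]
  exact isOpen_iInter_of_finite fun i => isOpen_lt continuous_const (continuous_apply i)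

/-- The Hessian of a weighted sum of quasi-likelihoods. -/
lemma hessian_sum_lagLik {ι : Type*} (s : Finset ι) (c : ι → ℝ) (y : ι → Fin (p + 1) → ℝ)
    (hy : ∀ k, 0 ≤ y k) {α : Param p} (hα : ∀ i, 0 < α i) (i j : Fin (p + 1)) :
    hessian (fun β => ∑ k ∈ s, c k * lagLik β (y k)) α i j =
      ∑ k ∈ s, c k * lagHess i j α (y k) := by
  rw [hessian_apply_of_hasFDerivAt (f' := fun β => ∑ k ∈ s, c k • lagGrad β (y k))
    (f'' := ∑ k ∈ s, c k • lagHessMap α (y k))]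
  · simp [lagHessMap_single]
  · filter_upwards [isOpen_posParam.mem_nhds hα] with β hβ
    exact HasFDerivAt.fun_sum fun k _ =>
      (hasFDerivAt_lagLik (lagForm_pos hβ (hy k)).ne').const_mul (c k)
  · exact HasFDerivAt.fun_sum fun k _ =>
      (hasFDerivAt_lagGrad (lagForm_pos hα (hy k)).ne').const_smul (c k)

lemma kernelLik_eq (W : ℝ → ℝ) (b : ℝ) (N t₀ : ℕ) (x : ℤ → ℝ) (α : Param p) :
    kernelLik W b N t₀ x α = ∑ k ∈ Finset.Icc (p + 1) N,
      1 / (b * N) * W (((t₀ : ℝ) - k) / (b * N)) * lagLik α (lagSq x k) := by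
  simp [kernelLik, quasiLik_eq]

lemma hessian_kernelLik (W : ℝ → ℝ) (b : ℝ) (N t₀ : ℕ) (x : ℤ → ℝ) {α : Param p}
    (hα : ∀ i, 0 < α i) (i j : Fin (p + 1)) :
    hessian (kernelLik W b N t₀ x) α i j = ∑ k ∈ Finset.Icc (p + 1) N,
      1 / (b * N) * W (((t₀ : ℝ) - k) / (b * N)) * lagHess i j α (lagSq x k) := by
  have e : (kernelLik W b N t₀ x : Param p → ℝ) = fun β => ∑ k ∈ Finset.Icc (p + 1) N,
      1 / (b * N) * W (((t₀ : ℝ) - k) / (b * N)) * lagLik β (lagSq x k) :=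
    funext fun β => kernelLik_eq W b N t₀ x β
  rw [e, hessian_sum_lagLik _ _ (fun k : ℕ => lagSq x k) (fun k => lagSq_nonneg x k) hα]

/-- The difference is a single weighted sum of likelihoods, indexed by time and a sign in `Bool`, so
the formula for such sums applies directly. -/
lemma hessian_kernelLik_sub (W : ℝ → ℝ) (b : ℝ) (N t₀ : ℕ) (x y : ℤ → ℝ) {α : Param p}
    (hα : ∀ i, 0 < α i) (i j : Fin (p + 1)) :
    hessian (fun β => kernelLik W b N t₀ x β - kernelLik W b N t₀ y β) α i j =
      ∑ k ∈ Finset.Icc (p + 1) N, 1 / (b * N) * W (((t₀ : ℝ) - k) / (b * N)) *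
        (lagHess i j α (lagSq x k) - lagHess i j α (lagSq y k)) := by
  have e : (fun β : Param p => kernelLik W b N t₀ x β - kernelLik W b N t₀ y β) =
      fun β => ∑ k ∈ Finset.Icc (p + 1) N ×ˢ (Finset.univ : Finset Bool),
        1 / (b * N) * W (((t₀ : ℝ) - k.1) / (b * N)) * (cond k.2 1 (-1)) *
          lagLik β (cond k.2 (lagSq x k.1) (lagSq y k.1)) := by
    funext β
    rw [kernelLik_eq, kernelLik_eq, Finset.sum_product, ← Finset.sum_sub_distrib]
    refine Finset.sum_congr rfl fun k _ => ?_
    simp; ring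
  rw [e, hessian_sum_lagLik (Finset.Icc (p + 1) N ×ˢ (Finset.univ : Finset Bool)) _
    (fun k : ℕ × Bool => cond k.2 (lagSq x k.1) (lagSq y k.1)) _ hα, Finset.sum_product]
  · refine Finset.sum_congr rfl fun k _ => ?_
    simp; ring
  · rintro ⟨k, _ | _⟩
    exacts [lagSq_nonneg y k, lagSq_nonneg x k]

/-! ### Differentiation of the expected quasi-likelihood -/

/-- This is the relative parameter bound with `β = 0`. It lets every factor `lagForm y` in a
derivative cancel a factor `(lagForm y α)⁻¹`, leaving bounds linear in `y 0`: a first moment is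
enough to dominate both derivatives. -/
lemma norm_lagForm_le {δ : ℝ} (hδ : 0 < δ) {α : Param p} (hα : ∀ i, δ ≤ α i)
    {y : Fin (p + 1) → ℝ} (hy : 0 ≤ y) : ‖lagForm y‖ ≤ (p + 1) / δ * lagForm y α := by
  have h0 : 0 ≤ lagForm y α := hδ.le.trans (le_lagForm hδ.le hα hy)
  refine ContinuousLinearMap.opNorm_le_bound _ (by positivity) fun γ => ?_
  have := abs_lagForm_sub_param_le (α := γ) (β := 0) hδ hα hy
  simp only [map_zero, sub_zero] at this
  rw [Real.norm_eq_abs]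
  linarith

lemma norm_lagGrad_le {δ : ℝ} (hδ : 0 < δ) {α : Param p} (hα : ∀ i, δ ≤ α i)
    {y : Fin (p + 1) → ℝ} (hy : 0 ≤ y) :
    ‖lagGrad α y‖ ≤ (p + 1) / δ * (1 + y 0 / δ) := by
  have hw := le_lagForm hδ.le hα hy
  have hw0 := hδ.trans_le hw
  have hn := norm_lagForm_le hδ hα hy
  have hy0 : 0 ≤ y 0 := hy 0
  rw [lagGrad, norm_smul, Real.norm_eq_abs]
  set w := lagForm y α
  have h1 : |1 / 2 * (w⁻¹ - y 0 * w⁻¹ ^ 2)| ≤ w⁻¹ * (1 + y 0 / δ) := by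
    have e : 1 / 2 * (w⁻¹ - y 0 * w⁻¹ ^ 2) = w⁻¹ * ((1 / 2) * (1 - y 0 / w)) := by
      field_simp
    have h2 : y 0 / w ≤ y 0 / δ := by gcongr
    have h3 : 0 ≤ y 0 / w := by positivity
    rw [e, abs_mul, abs_of_nonneg (by positivity)]
    gcongr
    rw [abs_le]; constructor <;> linarith
  calc _ ≤ (w⁻¹ * (1 + y 0 / δ)) * ((p + 1) / δ * w) := by gcongr
    _ = _ := by field_simp

lemma norm_lagHessMap_le {δ : ℝ} (hδ : 0 < δ) {α : Param p} (hα : ∀ i, δ ≤ α i)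
    {y : Fin (p + 1) → ℝ} (hy : 0 ≤ y) :
    ‖lagHessMap α y‖ ≤ ((p + 1) / δ) ^ 2 * (1 + y 0 / δ) := by
  have hw := le_lagForm hδ.le hα hy
  have hw0 := hδ.trans_le hw
  have hn := norm_lagForm_le hδ hα hy
  have hy0 : 0 ≤ y 0 := hy 0
  rw [lagHessMap, ContinuousLinearMap.norm_smulRight_apply, norm_smul, Real.norm_eq_abs]
  set w := lagForm y α
  have h1 : |1 / 2 * (-w⁻¹ ^ 2 + 2 * y 0 * w⁻¹ ^ 3)| ≤ w⁻¹ ^ 2 * (1 + y 0 / δ) := by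
    have e : 1 / 2 * (-w⁻¹ ^ 2 + 2 * y 0 * w⁻¹ ^ 3) = w⁻¹ ^ 2 * (-(1 / 2) + y 0 / w) := by
      field_simp
    have h2 : y 0 / w ≤ y 0 / δ := by gcongr
    have h3 : 0 ≤ y 0 / w := by positivity
    rw [e, abs_mul, abs_of_nonneg (by positivity)]
    gcongr
    rw [abs_le]; constructor <;> linarith
  calc _ ≤ (w⁻¹ ^ 2 * (1 + y 0 / δ)) * ((p + 1) / δ * w) * ((p + 1) / δ * w) := by gcongr
    _ = _ := by field_simp

lemma continuous_regress (i : Fin (p + 1)) :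
    Continuous (fun y : Fin (p + 1) → ℝ => regress y i) := by
  refine Fin.cases ?_ (fun j => ?_) i
  · exact continuous_const
  · exact continuous_apply _

lemma continuous_lagForm : Continuous (lagForm : (Fin (p + 1) → ℝ) → Param p →L[ℝ] ℝ) :=
  continuous_finsetSum _ fun i _ => (continuous_regress i).smul continuous_const

lemma stronglyMeasurable_lagGrad (α : Param p) : StronglyMeasurable (lagGrad α) := by
  have : Measurable fun y : Fin (p + 1) → ℝ =>
    (1 / 2) * ((lagForm y α)⁻¹ - y 0 * ((lagForm y α)⁻¹) ^ 2) := by fun_prop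
  exact this.stronglyMeasurable.smul continuous_lagForm.stronglyMeasurable

lemma stronglyMeasurable_lagHessMap (α : Param p) : StronglyMeasurable (lagHessMap α) := by
  have : Measurable fun y : Fin (p + 1) → ℝ =>
    (1 / 2) * (-((lagForm y α)⁻¹) ^ 2 + 2 * y 0 * ((lagForm y α)⁻¹) ^ 3) := by fun_prop
  have h2 : Continuous fun y : Fin (p + 1) → ℝ => (lagForm y).smulRight (lagForm y) :=
    isBoundedBilinearMap_smulRight.continuous.comp (continuous_lagForm.prodMk continuous_lagForm)
  have e : lagHessMap α = fun y : Fin (p + 1) → ℝ =>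
    ((1 / 2) * (-((lagForm y α)⁻¹) ^ 2 + 2 * y 0 * ((lagForm y α)⁻¹) ^ 3)) •
      (lagForm y).smulRight (lagForm y) := by
    funext y; ext; simp [lagHessMap, mul_assoc]
  rw [e]
  exact this.stronglyMeasurable.smul h2.stronglyMeasurable

variable {S : Type*} [MeasurableSpace S] {μ : Measure S}

lemma integrable_tame [IsProbabilityMeasure μ] {K : Set (Param p)} {C : ℝ}
    {g : Param p → (Fin (p + 1) → ℝ) → ℝ}
    (hg : TameFamily K C g) {v : S → Fin (p + 1) → ℝ} (hv : Integrable v μ)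
    (hv0 : ∀ ω, 0 ≤ v ω) {α : Param p} (hα : α ∈ K) : Integrable (fun ω => g α (v ω)) μ := by
  refine Integrable.mono' (g := fun ω => C * (1 + ‖v ω‖))
    (((integrable_const 1).add hv.norm).const_mul C)
    ((hg.measurable α).comp_aemeasurable hv.aemeasurable).aestronglyMeasurable
    (Eventually.of_forall fun ω => hg.growth α hα _ (hv0 ω))

lemma integrable_lagLik [IsProbabilityMeasure μ] {v : S → Fin (p + 1) → ℝ} (hv : Integrable v μ)
    (hv0 : ∀ ω, 0 ≤ v ω) {α : Param p} (hα : ∀ i, 0 < α i) :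
    Integrable (fun ω => lagLik α (v ω)) μ := by
  obtain ⟨δ, hδ, hδα⟩ : ∃ δ > 0, ∀ i, δ ≤ α i := by
    obtain ⟨i, hi⟩ := Finite.exists_min α
    exact ⟨α i, hα i, hi⟩
  have hR : 0 ≤ ‖α‖ := norm_nonneg α
  obtain ⟨C, hC⟩ := tameFamily_lagLik (p := p) hδ hR
  exact integrable_tame hC hv hv0 fun i => ⟨hδα i, (le_abs_self _).trans (norm_le_pi_norm α i)⟩

lemma aestronglyMeasurable_lagGrad {v : S → Fin (p + 1) → ℝ} (hv : Integrable v μ) (α : Param p) :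
    AEStronglyMeasurable (fun ω => lagGrad α (v ω)) μ :=
  ((stronglyMeasurable_lagGrad α).aestronglyMeasurable (μ := μ.map v)).comp_aemeasurable
    hv.aemeasurable

lemma aestronglyMeasurable_lagHessMap {v : S → Fin (p + 1) → ℝ} (hv : Integrable v μ)
    (α : Param p) : AEStronglyMeasurable (fun ω => lagHessMap α (v ω)) μ :=
  ((stronglyMeasurable_lagHessMap α).aestronglyMeasurable (μ := μ.map v)).comp_aemeasurable
    hv.aemeasurable

/-- Half the least coordinate of `α` bounds all coordinates from below near `α`, so one integrable
function dominates the derivatives on a whole neighbourhood. -/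
lemma exists_lower_nhds {α : Param p} (hα : ∀ i, 0 < α i) :
    ∃ δ > 0, {β : Param p | ∀ i, δ < β i} ∈ 𝓝 α := by
  obtain ⟨i, hi⟩ := Finite.exists_min α
  refine ⟨α i / 2, by linarith [hα i], ?_⟩
  simp only [ofPred_forall]
  exact (isOpen_iInter_of_finite fun i => isOpen_lt continuous_const (continuous_apply i)).mem_nhds
    (mem_iInter.2 fun j => show α i / 2 < α j by linarith [hi j, hα i])

lemma integrable_grad_bound [IsProbabilityMeasure μ] {v : S → Fin (p + 1) → ℝ}
    (hv : Integrable v μ) (C δ : ℝ) :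
    Integrable (fun ω => C * (1 + v ω 0 / δ)) μ :=
  ((integrable_const 1).add ((hv.eval 0).div_const δ)).const_mul C

lemma hasFDerivAt_integral_lagLik [IsProbabilityMeasure μ] {v : S → Fin (p + 1) → ℝ}
    (hv : Integrable v μ) (hv0 : ∀ ω, 0 ≤ v ω) {α : Param p} (hα : ∀ i, 0 < α i) :
    HasFDerivAt (fun β => ∫ ω, lagLik β (v ω) ∂μ) (∫ ω, lagGrad α (v ω) ∂μ) α := by
  obtain ⟨δ, hδ, hs⟩ := exists_lower_nhds hα
  refine hasFDerivAt_integral_of_dominated_of_fderiv_le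
    (bound := fun ω => (p + 1) / δ * (1 + v ω 0 / δ)) hs
    (Eventually.of_forall fun β =>
      ((measurable_lagLik β).comp_aemeasurable hv.aemeasurable).aestronglyMeasurable)
    (integrable_lagLik hv hv0 hα) (aestronglyMeasurable_lagGrad hv α)
    (Eventually.of_forall fun ω β hβ => norm_lagGrad_le hδ (fun i => (hβ i).le) (hv0 ω))
    (integrable_grad_bound hv _ _)
    (Eventually.of_forall fun ω β hβ =>
      hasFDerivAt_lagLik (lagForm_pos (fun i => hδ.trans (hβ i)) (hv0 ω)).ne')

lemma hasFDerivAt_integral_lagGrad [IsProbabilityMeasure μ] {v : S → Fin (p + 1) → ℝ}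
    (hv : Integrable v μ) (hv0 : ∀ ω, 0 ≤ v ω) {α : Param p} (hα : ∀ i, 0 < α i) :
    HasFDerivAt (fun β => ∫ ω, lagGrad β (v ω) ∂μ) (∫ ω, lagHessMap α (v ω) ∂μ) α := by
  obtain ⟨δ, hδ, hs⟩ := exists_lower_nhds hα
  refine hasFDerivAt_integral_of_dominated_of_fderiv_le
    (bound := fun ω => ((p + 1) / δ) ^ 2 * (1 + v ω 0 / δ)) hs
    (Eventually.of_forall fun β => aestronglyMeasurable_lagGrad hv β)
    ((integrable_grad_bound hv _ _).mono' (aestronglyMeasurable_lagGrad hv α)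
      (Eventually.of_forall fun ω =>
        norm_lagGrad_le hδ (fun i => (mem_of_mem_nhds hs i).le) (hv0 ω)))
    (aestronglyMeasurable_lagHessMap hv α)
    (Eventually.of_forall fun ω β hβ => norm_lagHessMap_le hδ (fun i => (hβ i).le) (hv0 ω))
    (integrable_grad_bound hv _ _)
    (Eventually.of_forall fun ω β hβ =>
      hasFDerivAt_lagGrad (lagForm_pos (fun i => hδ.trans (hβ i)) (hv0 ω)).ne')

set_option maxSynthPendingDepth 3 in
lemma integrable_lagHessMap [IsProbabilityMeasure μ] {v : S → Fin (p + 1) → ℝ}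
    (hv : Integrable v μ) (hv0 : ∀ ω, 0 ≤ v ω) {α : Param p} (hα : ∀ i, 0 < α i) :
    Integrable (fun ω => lagHessMap α (v ω)) μ := by
  obtain ⟨δ, hδ, hs⟩ := exists_lower_nhds hα
  exact (integrable_grad_bound hv _ _).mono' (aestronglyMeasurable_lagHessMap hv α)
      (Eventually.of_forall fun ω =>
        norm_lagHessMap_le hδ (fun i => (mem_of_mem_nhds hs i).le) (hv0 ω))

-- Differentiation under the integral is applied twice on the positive orthant. What remains is
-- continuity of the integrated second derivative, which is dominated convergence.
set_option maxSynthPendingDepth 3 in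
lemma contDiffAt_integral_lagLik [IsProbabilityMeasure μ] {v : S → Fin (p + 1) → ℝ}
    (hv : Integrable v μ) (hv0 : ∀ ω, 0 ≤ v ω) {α : Param p} (hα : ∀ i, 0 < α i) :
    ContDiffAt ℝ 2 (fun β => ∫ ω, lagLik β (v ω) ∂μ) α := by
  have h2 : (2 : WithTop ℕ∞) = ((1 : ℕ) : WithTop ℕ∞) + 1 := by norm_num
  have h1 : ((1 : ℕ) : WithTop ℕ∞) = ((0 : ℕ) : WithTop ℕ∞) + 1 := by norm_num
  have hO := isOpen_posParam.mem_nhds hα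
  rw [h2, contDiffAt_succ_iff_hasFDerivAt]
  refine ⟨_, ⟨_, hO, fun β hβ => hasFDerivAt_integral_lagLik hv hv0 hβ⟩, ?_⟩
  rw [h1, contDiffAt_succ_iff_hasFDerivAt]
  refine ⟨_, ⟨_, hO, fun β hβ => hasFDerivAt_integral_lagGrad hv hv0 hβ⟩, ?_⟩
  rw [Nat.cast_zero, contDiffAt_zero]
  refine ⟨_, hO, fun β hβ => ContinuousAt.continuousWithinAt ?_⟩
  obtain ⟨δ, hδ, hs⟩ := exists_lower_nhds hβ
  refine continuousAt_of_dominated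
    (bound := fun ω => ((p + 1) / δ) ^ 2 * (1 + v ω 0 / δ))
    (Eventually.of_forall fun β => aestronglyMeasurable_lagHessMap hv β)
    (by
      filter_upwards [hs] with γ hγ
      exact Eventually.of_forall fun ω => norm_lagHessMap_le hδ (fun i => (hγ i).le) (hv0 ω))
    (integrable_grad_bound hv _ _)
    (Eventually.of_forall fun ω => ?_)
  have hw := (lagForm_pos hβ (hv0 ω)).ne'
  have hc : ContinuousAt (fun γ => (lagForm (v ω) γ)⁻¹) β :=
    (lagForm (v ω)).continuous.continuousAt.inv₀ hw
  have e : (fun γ => lagHessMap γ (v ω)) = fun γ =>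
      ((1 / 2) * (-((lagForm (v ω) γ)⁻¹) ^ 2 + 2 * v ω 0 * ((lagForm (v ω) γ)⁻¹) ^ 3)) •
        (lagForm (v ω)).smulRight (lagForm (v ω)) := by
    funext γ; ext; simp [lagHessMap, mul_assoc]
  rw [e]
  exact (continuousAt_const.mul ((hc.pow 2).neg.add (continuousAt_const.mul (hc.pow 3)))).smul
    continuousAt_const

set_option maxSynthPendingDepth 3 in
lemma hessian_integral_lagLik [IsProbabilityMeasure μ] {v : S → Fin (p + 1) → ℝ}
    (hv : Integrable v μ) (hv0 : ∀ ω, 0 ≤ v ω) {α : Param p} (hα : ∀ i, 0 < α i)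
    (i j : Fin (p + 1)) :
    hessian (fun β => ∫ ω, lagLik β (v ω) ∂μ) α i j = ∫ ω, lagHess i j α (v ω) ∂μ := by
  rw [hessian_apply_of_hasFDerivAt
    (mem_of_superset (isOpen_posParam.mem_nhds hα) fun β hβ =>
      hasFDerivAt_integral_lagLik hv hv0 hβ) (hasFDerivAt_integral_lagGrad hv hv0 hα)]
  have hi := integrable_lagHessMap hv hv0 hα
  rw [ContinuousLinearMap.integral_apply hi, ContinuousLinearMap.integral_apply
    (hi.apply_continuousLinearMap _)]
  simp [lagHessMap_single]

end TVARCH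

namespace TVARCH

/-! ### Kernel weights -/

/-- The weight `(1/B) W((t-k)/B)` of the observation at time `k`. -/
noncomputable def kernelWeight (W : ℝ → ℝ) (B : ℝ) (t : ℝ) (k : ℕ) : ℝ := 1 / B * W ((t - k) / B)

lemma IsKernel.exists_bound {W : ℝ → ℝ} (hW : IsKernel W) : ∃ C, 0 < C ∧ ∀ x, |W x| ≤ C := by
  refine ⟨|W 0| + (eVariationOn W (Icc (-(1 / 2) : ℝ) (1 / 2))).toReal + 1, by positivity,
    fun x => ?_⟩
  by_cases hx : x ∈ Icc (-(1 / 2) : ℝ) (1 / 2)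
  · have h0 : (0 : ℝ) ∈ Icc (-(1 / 2) : ℝ) (1 / 2) := by constructor <;> norm_num
    have := hW.boundedVariation.dist_le hx h0
    rw [Real.dist_eq] at this
    have h2 := abs_sub_abs_le_abs_sub (W x) (W 0)
    linarith
  · rw [hW.zero_outside x hx, abs_zero]; positivity

lemma kernelWeight_ne_zero {W : ℝ → ℝ} (hW : IsKernel W) {B t : ℝ} (hB : 0 < B) {k : ℕ}
    (h : kernelWeight W B t k ≠ 0) : |t - k| ≤ B / 2 := by
  by_contra hlt
  refine h ?_
  rw [kernelWeight, hW.zero_outside, mul_zero]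
  rintro ⟨h1, h2⟩
  rw [le_div_iff₀ hB] at h1
  rw [div_le_iff₀ hB] at h2
  exact hlt (abs_le.2 ⟨by linarith, by linarith⟩)

lemma abs_kernelWeight_le {W : ℝ → ℝ} {C : ℝ} (hC : ∀ x, |W x| ≤ C) {B : ℝ} (hB : 0 < B)
    (t : ℝ) (k : ℕ) : |kernelWeight W B t k| ≤ C / B := by
  rw [kernelWeight, abs_mul, abs_of_pos (by positivity), one_div, inv_mul_eq_div]
  gcongr; exact hC _

lemma card_filter_abs_sub_le (s : Finset ℕ) (t : ℝ) {B : ℝ} (hB : 0 ≤ B) :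
    ((s.filter fun k : ℕ => |t - k| ≤ B / 2).card : ℝ) ≤ B + 1 := by
  have h1 : (s.filter fun k : ℕ => |t - k| ≤ B / 2).card ≤
      (Finset.Icc ⌈t - B / 2⌉ ⌊t + B / 2⌋).card := by
    refine Finset.card_le_card_of_injOn (fun k : ℕ => (k : ℤ)) (fun k hk => ?_)
      (fun a _ b _ h => Nat.cast_injective h)
    have := abs_le.1 (Finset.mem_filter.1 hk).2
    simp only [Finset.coe_Icc, mem_Icc, Int.ceil_le, Int.le_floor, Int.cast_natCast]
    constructor <;> linarith [this.1, this.2]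
  have h2 : ((s.filter fun k : ℕ => |t - k| ≤ B / 2).card : ℝ) ≤
      ((⌊t + B / 2⌋ + 1 - ⌈t - B / 2⌉).toNat : ℝ) := by
    rw [Int.card_Icc] at h1; exact_mod_cast h1
  refine h2.trans ?_
  rw [← Int.cast_natCast (R := ℝ), Int.toNat_eq_max, Int.cast_max]
  refine max_le ?_ (by simp; linarith)
  push_cast
  linarith [Int.floor_le (t + B / 2), Int.le_ceil (t - B / 2)]

/-- At most `B + 1 ≤ 2 * B` indices lie in the support, and each weight is at most `C / B`. -/
lemma sum_abs_kernelWeight_le {W : ℝ → ℝ} (hW : IsKernel W) {C : ℝ} (hC0 : 0 ≤ C)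
    (hC : ∀ x, |W x| ≤ C) {B : ℝ} (hB : 1 ≤ B) (t : ℝ) (s : Finset ℕ) :
    ∑ k ∈ s, |kernelWeight W B t k| ≤ 2 * C := by
  have hB0 : 0 < B := by linarith
  rw [← Finset.sum_filter_of_ne (p := fun k : ℕ => |t - k| ≤ B / 2)]
  · refine (Finset.sum_le_card_nsmul _ _ (C / B) fun k _ => abs_kernelWeight_le hC hB0 t k).trans ?_
    rw [nsmul_eq_mul]
    calc _ ≤ (B + 1) * (C / B) := by
            gcongr; exact card_filter_abs_sub_le s t hB0.le
      _ ≤ (2 * B) * (C / B) := by gcongr; linarith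
      _ = _ := by field_simp
  · intro k _ hk
    exact kernelWeight_ne_zero hW hB0 (abs_ne_zero.1 hk)

/-- Functions of bounded variation are differentiable almost everywhere. The endpoints ±1/2 are
discarded because the extension by zero may jump there. -/
lemma IsKernel.ae_continuousAt {W : ℝ → ℝ} (hW : IsKernel W) : ∀ᵐ x, ContinuousAt W x := by
  have h1 := hW.boundedVariation.locallyBoundedVariationOn.ae_differentiableWithinAt_of_mem
  have h2 : ∀ᵐ x : ℝ, x ∉ ({-(1 / 2), 1 / 2} : Set ℝ) :=
    measure_eq_zero_iff_ae_notMem.1 ((Set.toFinite _).measure_zero volume)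
  filter_upwards [h1, h2] with x hx hx2
  simp only [mem_insert_iff, mem_singleton_iff, not_or] at hx2
  by_cases h : x ∈ Icc (-(1 / 2) : ℝ) (1 / 2)
  · exact (hx h).continuousWithinAt.continuousAt (Icc_mem_nhds
      (lt_of_le_of_ne h.1 (Ne.symm hx2.1)) (lt_of_le_of_ne h.2 hx2.2))
  · have : W =ᶠ[𝓝 x] fun _ => 0 := by
      filter_upwards [isClosed_Icc.isOpen_compl.mem_nhds h] with y hy
      exact hW.zero_outside y hy
    exact this.continuousAt

/-- The step function whose integral is the sum of the kernel weights over `s`. -/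
noncomputable def kernelStep (W : ℝ → ℝ) (B : ℝ) (t : ℕ) (s : Finset ℕ) (x : ℝ) : ℝ :=
  ∑ k ∈ s, (Ico (((t : ℝ) - k) / B) (((t : ℝ) - k + 1) / B)).indicator
    (fun _ => W (((t : ℝ) - k) / B)) x

/-- The intervals are disjoint: at a point `x` only the index with `t - k = ⌊x * B⌋` can contribute.
Hence `kernelStep` is `W` evaluated at `x` rounded down to the grid of mesh `1 / B`, or zero. -/
lemma mem_Ico_div_iff {B : ℝ} (hB : 0 < B) (t k : ℕ) (x : ℝ) :
    x ∈ Ico (((t : ℝ) - k) / B) (((t : ℝ) - k + 1) / B) ↔ ⌊x * B⌋ = (t : ℤ) - k := by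
  rw [mem_Ico, div_le_iff₀ hB, lt_div_iff₀ hB, Int.floor_eq_iff]
  push_cast
  rfl

lemma integral_kernelStep (W : ℝ → ℝ) {B : ℝ} (hB : 0 < B) (t : ℕ) (s : Finset ℕ) :
    ∫ x, kernelStep W B t s x = ∑ k ∈ s, kernelWeight W B t k := by
  unfold kernelStep
  rw [integral_finsetSum]
  · refine Finset.sum_congr rfl fun k _ => ?_
    rw [integral_indicator measurableSet_Ico, setIntegral_const, Real.volume_real_Ico_of_le]
    · rw [kernelWeight, smul_eq_mul]; ring
    · gcongr; linarith
  · intro k _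
    exact (integrable_indicator_iff measurableSet_Ico).2 (integrableOn_const (by simp))

lemma kernelStep_eq_of_mem (W : ℝ → ℝ) {B : ℝ} (hB : 0 < B) {t k : ℕ} {s : Finset ℕ} {x : ℝ}
    (hk : ⌊x * B⌋ = (t : ℤ) - k) (hks : k ∈ s) :
    kernelStep W B t s x = W (⌊x * B⌋ / B) := by
  rw [kernelStep, Finset.sum_eq_single_of_mem k hks]
  · rw [indicator_of_mem ((mem_Ico_div_iff hB t k x).2 hk), hk]; push_cast; rfl
  · intro j _ hj
    refine indicator_of_notMem (fun h => hj ?_) _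
    have := (mem_Ico_div_iff hB t j x).1 h
    omega

lemma kernelStep_eq_zero (W : ℝ → ℝ) {B : ℝ} (hB : 0 < B) {t : ℕ} {s : Finset ℕ} {x : ℝ}
    (hk : ∀ k ∈ s, ⌊x * B⌋ ≠ (t : ℤ) - k) : kernelStep W B t s x = 0 :=
  Finset.sum_eq_zero fun k hks =>
    indicator_of_notMem (fun h => hk k hks ((mem_Ico_div_iff hB t k x).1 h)) _

lemma abs_kernelStep_le {W : ℝ → ℝ} (hW : IsKernel W) {C : ℝ} (hC0 : 0 ≤ C)
    (hC : ∀ x, |W x| ≤ C) {B : ℝ} (hB : 1 ≤ B) (t : ℕ) (s : Finset ℕ) (x : ℝ) :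
    |kernelStep W B t s x| ≤ (Icc (-2 : ℝ) 2).indicator (fun _ => C) x := by
  have hB0 : 0 < B := by linarith
  by_cases h : ∃ k ∈ s, ⌊x * B⌋ = (t : ℤ) - k
  · obtain ⟨k, hks, hk⟩ := h
    rw [kernelStep_eq_of_mem W hB0 hk hks]
    -- Rounding moves `x` down by less than `1 / B ≤ 1`, so the step function vanishes off [-1/2,
    -- 3/2]; the interval [-2, 2] leaves room.
    by_cases hx : x ∈ Icc (-2 : ℝ) 2
    · rw [indicator_of_mem hx]; exact hC _
    · rw [indicator_of_notMem hx, hW.zero_outside, abs_zero]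
      rintro ⟨h1, h2⟩
      rw [le_div_iff₀ hB0] at h1
      rw [div_le_iff₀ hB0] at h2
      have h3 := Int.floor_le (x * B)
      have h4 := Int.lt_floor_add_one (x * B)
      refine hx ⟨?_, ?_⟩
      · nlinarith
      · nlinarith
  · push Not at h
    rw [kernelStep_eq_zero W hB0 h, abs_zero]
    exact indicator_nonneg (fun _ _ => hC0) x

lemma tendsto_kernelStep {W : ℝ → ℝ} (hW : IsKernel W) {B : ℕ → ℝ}
    (hB : Tendsto B atTop atTop) {t : ℕ → ℕ} {s : ℕ → Finset ℕ}
    (hs : ∀ᶠ N in atTop, ∀ k : ℤ, |(t N : ℤ) - k| ≤ B N → ∃ j ∈ s N, (j : ℤ) = k)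
    {x : ℝ} (hx : ContinuousAt W x) :
    Tendsto (fun N => kernelStep W (B N) (t N) (s N) x) atTop (𝓝 (W x)) := by
  have hlim : Tendsto (fun N => (⌊x * B N⌋ : ℝ) / B N) atTop (𝓝 x) := by
    have h0 : Tendsto (fun N => x - 1 / B N) atTop (𝓝 x) := by
      simpa using tendsto_const_nhds.sub (hB.inv_tendsto_atTop)
    refine tendsto_of_tendsto_of_tendsto_of_le_of_le' h0 tendsto_const_nhds ?_ ?_
    · filter_upwards [hB.eventually_gt_atTop 0] with N hN
      have h4 := Int.lt_floor_add_one (x * B N)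
      rw [le_div_iff₀ hN, sub_mul, one_div, inv_mul_cancel₀ hN.ne']
      linarith
    · filter_upwards [hB.eventually_gt_atTop 0] with N hN
      rw [div_le_iff₀ hN]
      exact Int.floor_le _
  by_cases hx1 : |x| ≤ 1 / 2
  · refine (hx.tendsto.comp hlim).congr' ?_
    filter_upwards [hs, hB.eventually_ge_atTop 2] with N hN hB1
    have hB0 : 0 < B N := by linarith
    -- For `B N ≥ 2` and `|x| ≤ 1/2` the offset satisfies `|⌊x * B N⌋| ≤ B N / 2 + 1 ≤ B N`, so the
    -- required index belongs to `s N`.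
    obtain ⟨j, hj, hjk⟩ := hN ((t N : ℤ) - ⌊x * B N⌋) (by
      rw [sub_sub_cancel]
      push_cast
      have h3 := Int.floor_le (x * B N)
      have h4 := Int.lt_floor_add_one (x * B N)
      rw [abs_le] at hx1 ⊢
      constructor <;> nlinarith)
    rw [Function.comp, kernelStep_eq_of_mem W hB0 (k := j) (by omega) hj]
  -- The index may now be missing from `s N`, but `W` vanishes near `x`, so the value is zero either
  -- way.
  · have h0 : W =ᶠ[𝓝 x] fun _ => 0 := by
      have : {y : ℝ | 1 / 2 < |y|} ∈ 𝓝 x :=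
        (isOpen_lt continuous_const continuous_abs).mem_nhds (not_le.1 hx1)
      filter_upwards [this] with y hy
      exact hW.zero_outside y fun h => absurd (abs_le.2 h) (not_le.2 hy)
    rw [h0.eq_of_nhds]
    refine tendsto_const_nhds.congr' ?_
    filter_upwards [hlim.eventually h0, hB.eventually_ge_atTop 2] with N hN hB1
    have hB0 : 0 < B N := by linarith
    by_cases h : ∃ k ∈ s N, ⌊x * B N⌋ = (t N : ℤ) - k
    · obtain ⟨k, hks, hk⟩ := h
      rw [kernelStep_eq_of_mem W hB0 hk hks, hN]
    · push Not at h
      rw [kernelStep_eq_zero W hB0 h]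

/-- Riemann sums of the kernel converge to its integral. -/
lemma tendsto_sum_kernelWeight {W : ℝ → ℝ} (hW : IsKernel W) {B : ℕ → ℝ}
    (hB : Tendsto B atTop atTop) {t : ℕ → ℕ} {s : ℕ → Finset ℕ}
    (hs : ∀ᶠ N in atTop, ∀ k : ℤ, |(t N : ℤ) - k| ≤ B N → ∃ j ∈ s N, (j : ℤ) = k) :
    Tendsto (fun N => ∑ k ∈ s N, kernelWeight W (B N) (t N) k) atTop (𝓝 1) := by
  obtain ⟨C, hC0, hC⟩ := hW.exists_bound
  have hI : ∫ x, W x = 1 := by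
    rw [← hW.integral_eq_one, intervalIntegral.integral_of_le (by norm_num),
      ← integral_Icc_eq_integral_Ioc, setIntegral_eq_integral_of_forall_compl_eq_zero]
    exact fun x hx => hW.zero_outside x hx
  rw [← hI]
  -- The sum is exactly the integral of the step function, so dominated convergence and a.e.
  -- continuity of `W` give the limit.
  refine Tendsto.congr' (f₁ := fun N => ∫ x, kernelStep W (B N) (t N) (s N) x) ?_ ?_
  · filter_upwards [hB.eventually_gt_atTop 0] with N hN
    exact integral_kernelStep W hN _ _
  · refine tendsto_integral_filter_of_dominated_convergence
      ((Icc (-2 : ℝ) 2).indicator (fun _ => C)) ?_ ?_ ?_ ?_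
    · refine Eventually.of_forall fun N => Measurable.aestronglyMeasurable ?_
      exact Finset.measurable_fun_sum _ fun k _ => measurable_const.indicator measurableSet_Ico
    · filter_upwards [hB.eventually_ge_atTop 1] with N hN
      exact Eventually.of_forall fun x => abs_kernelStep_le hW hC0.le hC hN _ _ _
    · exact (integrable_indicator_iff measurableSet_Icc).2 (integrableOn_const (by simp))
    · filter_upwards [hW.ae_continuousAt] with x hx
      exact tendsto_kernelStep hW hB hs hx

end TVARCH

namespace TVARCH

variable {p : ℕ} {S : Type*} [MeasurableSpace S] {μ : Measure S}

/-! ### Innovations -/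

/-- The σ-algebra generated by the innovations at the times in `T`. -/
abbrev sigmaOf (Z : ℤ → S → ℝ) (T : Set ℤ) : MeasurableSpace S :=
  ⨆ s ∈ T, MeasurableSpace.comap (Z s) inferInstance

omit [MeasurableSpace S] in
lemma sigmaOf_mono (Z : ℤ → S → ℝ) {T U : Set ℤ} (h : T ⊆ U) : sigmaOf Z T ≤ sigmaOf Z U :=
  biSup_mono h

omit [MeasurableSpace S] in
lemma measurable_sigmaOf (Z : ℤ → S → ℝ) {T : Set ℤ} {t : ℤ} (ht : t ∈ T) :
    Measurable[sigmaOf Z T] (Z t) :=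
  (comap_measurable (Z t)).mono (le_biSup (fun s => MeasurableSpace.comap (Z s) inferInstance) ht)
    le_rfl

lemma IsInnovation.sigmaOf_le {Z : ℤ → S → ℝ} (hZ : IsInnovation μ Z) (T : Set ℤ) :
    sigmaOf Z T ≤ (inferInstance : MeasurableSpace S) :=
  iSup₂_le fun t _ => (hZ.measurable t).comap_le

lemma IsInnovation.indep_sigmaOf {Z : ℤ → S → ℝ} (hZ : IsInnovation μ Z) {T U : Set ℤ}
    (h : Disjoint T U) : Indep (sigmaOf Z T) (sigmaOf Z U) μ :=
  indep_iSup_of_disjoint (fun t => (hZ.measurable t).comap_le) hZ.indep h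

lemma IsInnovation.lintegral_sq {Z : ℤ → S → ℝ} (hZ : IsInnovation μ Z) (t : ℤ) :
    ∫⁻ ω, ENNReal.ofReal (Z t ω ^ 2) ∂μ = 1 := by
  have h0 : ∫⁻ ω, ENNReal.ofReal (Z 0 ω ^ 2) ∂μ = 1 := by
    have hi : Integrable (fun ω => Z 0 ω ^ 2) μ := by
      -- A non-integrable function has Bochner integral 0, which would contradict the second moment
      -- being 1.
      by_contra h
      have := integral_undef h
      rw [hZ.second_moment] at this
      exact one_ne_zero this
    rw [← ofReal_integral_eq_lintegral_ofReal hi (Eventually.of_forall fun ω => sq_nonneg _),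
      hZ.second_moment, ENNReal.ofReal_one]
  rw [← h0]
  exact ((hZ.identDistrib t).comp (u := fun x : ℝ => ENNReal.ofReal (x ^ 2))
    (by fun_prop)).lintegral_eq

/-- `Z t` is independent of the innovations indexed by `T`, so the expectation factors and the
second moment 1 drops out. In [0, ∞] no integrability has to be known beforehand. -/
lemma IsInnovation.lintegral_sq_mul {Z : ℤ → S → ℝ} (hZ : IsInnovation μ Z) {t : ℤ} {T : Set ℤ}
    (ht : t ∉ T) {f : S → ℝ} (hf : AEStronglyMeasurable[sigmaOf Z T] f μ) :
    ∫⁻ ω, ENNReal.ofReal (Z t ω ^ 2 * f ω) ∂μ = ∫⁻ ω, ENNReal.ofReal (f ω) ∂μ := by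
  obtain ⟨g, hg, hfg⟩ := hf
  have e1 : ∫⁻ ω, ENNReal.ofReal (Z t ω ^ 2 * f ω) ∂μ =
      ∫⁻ ω, ENNReal.ofReal (Z t ω ^ 2) * ENNReal.ofReal (g ω) ∂μ := by
    refine lintegral_congr_ae ?_
    filter_upwards [hfg] with ω hω
    rw [hω, ENNReal.ofReal_mul (sq_nonneg _)]
  have e2 : ∫⁻ ω, ENNReal.ofReal (f ω) ∂μ = ∫⁻ ω, ENNReal.ofReal (g ω) ∂μ := by
    refine lintegral_congr_ae ?_
    filter_upwards [hfg] with ω hω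
    rw [hω]
  have hm : Measurable[sigmaOf Z {t}] (fun ω => ENNReal.ofReal (Z t ω ^ 2)) :=
    (((measurable_sigmaOf Z (mem_singleton t)).pow_const 2)).ennreal_ofReal
  have hm2 : Measurable[sigmaOf Z T] (fun ω => ENNReal.ofReal (g ω)) :=
    hg.measurable.ennreal_ofReal
  rw [e1, e2, lintegral_mul_eq_lintegral_mul_lintegral_of_independent_measurableSpace
    (hZ.sigmaOf_le _) (hZ.sigmaOf_le _)
    (hZ.indep_sigmaOf (T := {t}) (U := T) (by simpa using ht)) hm hm2, hZ.lintegral_sq, one_mul]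

/-- All expectation recursions rest on this identity: those of the approximations, of the propagator
(with `c₀ = 0`) and of the distance between the time-varying and the stationary process. -/
lemma IsInnovation.lintegral_sq_mul_sum [IsProbabilityMeasure μ] {Z : ℤ → S → ℝ}
    (hZ : IsInnovation μ Z) {t : ℤ}
    {T : Set ℤ} (ht : t ∉ T) {c₀ : ℝ} (hc₀ : 0 ≤ c₀) {c : Fin p → ℝ} (hc : ∀ j, 0 ≤ c j)
    {f : Fin p → S → ℝ} (hf : ∀ j, AEStronglyMeasurable[sigmaOf Z T] (f j) μ)
    (hf0 : ∀ j ω, 0 ≤ f j ω) :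
    ∫⁻ ω, ENNReal.ofReal (Z t ω ^ 2 * (c₀ + ∑ j, c j * f j ω)) ∂μ =
      ENNReal.ofReal c₀ + ∑ j, ENNReal.ofReal (c j) * ∫⁻ ω, ENNReal.ofReal (f j ω) ∂μ := by
  have hle := hZ.sigmaOf_le T
  have hs : AEStronglyMeasurable[sigmaOf Z T] (fun ω => c₀ + ∑ j, c j * f j ω) μ := by
    choose g hg hfg using hf
    refine ⟨fun ω => c₀ + ∑ j, c j * g j ω, stronglyMeasurable_const.add
      (Finset.stronglyMeasurable_fun_sum _ fun j _ => (hg j).const_mul (c j)), ?_⟩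
    filter_upwards [ae_all_iff.2 hfg] with ω hω
    simp only [hω]
  rw [hZ.lintegral_sq_mul ht hs]
  have hm : ∀ j, AEMeasurable (fun ω => ENNReal.ofReal (f j ω)) μ := fun j =>
    ((hf j).mono hle).aemeasurable.ennreal_ofReal
  calc _ = ∫⁻ ω, (ENNReal.ofReal c₀ + ∑ j, ENNReal.ofReal (c j) * ENNReal.ofReal (f j ω)) ∂μ := by
        refine lintegral_congr fun ω => ?_
        rw [ENNReal.ofReal_add hc₀ (Finset.sum_nonneg fun j _ => mul_nonneg (hc j) (hf0 j ω)),
          ENNReal.ofReal_sum_of_nonneg fun j _ => mul_nonneg (hc j) (hf0 j ω)]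
        simp only [ENNReal.ofReal_mul (hc _)]
    _ = _ := by
        rw [lintegral_add_left measurable_const, lintegral_const, measure_univ, mul_one,
          lintegral_finsetSum' _ fun j _ => (hm j).const_mul _]
        simp only [lintegral_const_mul'' _ (hm _)]

/-! ### Approximation of the stationary ARCH process by finite-range processes -/

/-- The squared ARCH recursion, iterated `m` times from the zero process. -/
noncomputable def archApprox (α : Param p) (Z : ℤ → S → ℝ) : ℕ → ℤ → S → ℝ
  | 0, _, _ => 0
  | m + 1, t, ω => Z t ω ^ 2 *
      (α 0 + ∑ j : Fin p, α j.succ * archApprox α Z m (t - ((j : ℕ) + 1 : ℤ)) ω)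

/-- The homogeneous squared ARCH recursion started with the value one up to time `s`,
iterated `m` times. -/
noncomputable def archPropagator (α : Param p) (Z : ℤ → S → ℝ) (s : ℤ) : ℕ → ℤ → S → ℝ
  | 0, _, _ => 1
  | m + 1, t, ω => if t ≤ s then 1 else Z t ω ^ 2 *
      (0 + ∑ j : Fin p, α j.succ * archPropagator α Z s m (t - ((j : ℕ) + 1 : ℤ)) ω)

omit [MeasurableSpace S] in
lemma measurable_archApprox (α : Param p) (Z : ℤ → S → ℝ) (m : ℕ) (t : ℤ) :
    Measurable[sigmaOf Z (Icc (t - p * m) t)] (archApprox α Z m t) := by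
  induction m generalizing t with
  | zero => exact measurable_const
  | succ m ih =>
    have h1 : Measurable[sigmaOf Z (Icc (t - p * (m + 1 : ℕ)) t)] (Z t) :=
      measurable_sigmaOf Z ⟨by have : (0 : ℤ) ≤ p * (m + 1 : ℕ) := by positivity
                               linarith, le_rfl⟩
    have h2 : ∀ j : Fin p, Measurable[sigmaOf Z (Icc (t - p * (m + 1 : ℕ)) t)]
        (archApprox α Z m (t - ((j : ℕ) + 1 : ℤ))) := fun j =>
      (ih _).mono (sigmaOf_mono Z (Icc_subset_Icc (by
        have : ((j : ℕ) : ℤ) + 1 ≤ p := by exact_mod_cast j.2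
        push_cast; linarith) (by linarith [Int.natCast_nonneg (j : ℕ)]))) le_rfl
    exact (h1.pow_const 2).mul (measurable_const.add
      (Finset.measurable_fun_sum _ fun j _ => (h2 j).const_mul _))

omit [MeasurableSpace S] in
lemma measurable_archPropagator (α : Param p) (Z : ℤ → S → ℝ) (s : ℤ) (m : ℕ) (t : ℤ) :
    Measurable[sigmaOf Z (Iic t)] (archPropagator α Z s m t) := by
  induction m generalizing t with
  | zero => exact measurable_const
  | succ m ih =>
    by_cases h : t ≤ s
    · simp only [archPropagator, h, if_true]; exact measurable_const
    · simp only [archPropagator, h, if_false]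
      have h2 : ∀ j : Fin p, Measurable[sigmaOf Z (Iic t)]
          (archPropagator α Z s m (t - ((j : ℕ) + 1 : ℤ))) := fun j =>
        (ih _).mono (sigmaOf_mono Z (Iic_subset_Iic.2 (by
          linarith [Int.natCast_nonneg (j : ℕ)]))) le_rfl
      exact ((measurable_sigmaOf Z (mem_Iic.2 le_rfl)).pow_const 2).mul (measurable_const.add
        (Finset.measurable_fun_sum _ fun j _ => (h2 j).const_mul _))

omit [MeasurableSpace S] in
lemma archApprox_nonneg {α : Param p} (hα : ∀ i, 0 ≤ α i) (Z : ℤ → S → ℝ) (m : ℕ) (t : ℤ) (ω : S) :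
    0 ≤ archApprox α Z m t ω := by
  induction m generalizing t with
  | zero => exact le_rfl
  | succ m ih =>
    exact mul_nonneg (sq_nonneg _) (add_nonneg (hα 0)
      (Finset.sum_nonneg fun j _ => mul_nonneg (hα _) (ih _)))

omit [MeasurableSpace S] in
lemma archPropagator_nonneg {α : Param p} (hα : ∀ i, 0 ≤ α i) (Z : ℤ → S → ℝ) (s : ℤ) (m : ℕ)
    (t : ℤ) (ω : S) : 0 ≤ archPropagator α Z s m t ω := by
  induction m generalizing t with
  | zero => exact zero_le_one
  | succ m ih =>
    simp only [archPropagator]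
    split_ifs
    · exact zero_le_one
    · exact mul_nonneg (sq_nonneg _) (add_nonneg le_rfl
        (Finset.sum_nonneg fun j _ => mul_nonneg (hα _) (ih _)))

omit [MeasurableSpace S] in
lemma archApprox_le_succ {α : Param p} (hα : ∀ i, 0 ≤ α i) (Z : ℤ → S → ℝ) (m : ℕ) (t : ℤ) (ω : S) :
    archApprox α Z m t ω ≤ archApprox α Z (m + 1) t ω := by
  induction m generalizing t with
  | zero => exact archApprox_nonneg hα Z 1 t ω
  | succ m ih =>
    exact mul_le_mul_of_nonneg_left (add_le_add le_rfl
      (Finset.sum_le_sum fun j _ => mul_le_mul_of_nonneg_left (ih _) (hα _))) (sq_nonneg _)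

omit [MeasurableSpace S] in
lemma archApprox_le {α : Param p} (hα : ∀ i, 0 ≤ α i) {Z : ℤ → S → ℝ} {V : ℤ → ℝ} {ω : S}
    (hV0 : ∀ t, 0 ≤ V t)
    (hV : ∀ t, V t = Z t ω ^ 2 * (α 0 + ∑ j : Fin p, α j.succ * V (t - ((j : ℕ) + 1 : ℤ))))
    (m : ℕ) (t : ℤ) : archApprox α Z m t ω ≤ V t := by
  induction m generalizing t with
  | zero => exact hV0 t
  | succ m ih =>
    rw [hV t]
    exact mul_le_mul_of_nonneg_left (add_le_add le_rfl
      (Finset.sum_le_sum fun j _ => mul_le_mul_of_nonneg_left (ih _) (hα _))) (sq_nonneg _)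

omit [MeasurableSpace S] in
-- The constant term cancels in the difference of two solutions, so the error obeys the homogeneous
-- recursion. It starts from at most `T` on the `p` times up to `s`, and the approximation itself is
-- nonnegative there.
lemma sub_archApprox_le {α : Param p} (hα : ∀ i, 0 ≤ α i) {Z : ℤ → S → ℝ} {V : ℤ → ℝ} {ω : S}
    (hV : ∀ t, V t = Z t ω ^ 2 * (α 0 + ∑ j : Fin p, α j.succ * V (t - ((j : ℕ) + 1 : ℤ))))
    {T : ℝ} {s : ℤ} (hT : ∀ t, s - p < t → t ≤ s → V t ≤ T)
    (m : ℕ) (t : ℤ) (h1 : s - p < t) (h2 : t ≤ s + m) :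
    V t - archApprox α Z m t ω ≤ T * archPropagator α Z s m t ω := by
  induction m generalizing t with
  | zero => simpa [archApprox, archPropagator] using hT t h1 (by simpa using h2)
  | succ m ih =>
    by_cases h : t ≤ s
    · simp only [archPropagator, h, if_true, mul_one]
      exact (sub_le_self _ (archApprox_nonneg hα Z _ _ _)).trans (hT t h1 h)
    · simp only [archPropagator, h, if_false, archApprox]
      rw [hV t, ← mul_sub, mul_left_comm, add_sub_add_left_eq_sub, zero_add]
      refine mul_le_mul_of_nonneg_left ?_ (sq_nonneg _)
      rw [Finset.mul_sum, ← Finset.sum_sub_distrib]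
      refine Finset.sum_le_sum fun j _ => ?_
      rw [← mul_sub, mul_left_comm]
      have hj : ((j : ℕ) : ℤ) + 1 ≤ p := by exact_mod_cast j.2
      have hj0 := Int.natCast_nonneg (j : ℕ)
      push_cast at h2
      exact mul_le_mul_of_nonneg_left (ih _ (by linarith [not_le.1 h]) (by linarith)) (hα _)

/-- With r = 1 - ν/(p+1), Bernoulli's inequality gives r^p ≥ 1 - pν/(p+1) ≥ 1 - ν. Using p + 1 also
covers p = 0. -/
lemma exists_rate (p : ℕ) {ν : ℝ} (h0 : 0 < ν) (h1 : ν < 1) :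
    ∃ r : ℝ, 0 < r ∧ r < 1 ∧ 1 - ν ≤ r ^ p := by
  have hp : (0 : ℝ) < p + 1 := by positivity
  have h2 : ν / (p + 1) ≤ ν := div_le_self h0.le (by linarith [Nat.cast_nonneg (α := ℝ) p])
  refine ⟨1 - ν / (p + 1), by linarith, by linarith [div_pos h0 hp], ?_⟩
  have := one_add_mul_le_pow (a := -(ν / (p + 1))) (by linarith) p
  rw [← sub_eq_add_neg] at this
  refine le_trans ?_ this
  have h3 : (p : ℝ) * (ν / (p + 1)) ≤ ν := by
    rw [mul_div_assoc', div_le_iff₀ hp]; nlinarith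
  linarith

/-- One step of a linear recursion with geometric bounds. -/
lemma sum_mul_zpow_le {c : Fin p → ℝ} (hc : ∀ j, 0 ≤ c j) {ν r : ℝ} (hsum : ∑ j, c j ≤ 1 - ν)
    (hr0 : 0 < r) (hr1 : r < 1) (hr : 1 - ν ≤ r ^ p) (t : ℤ) :
    ∑ j : Fin p, c j * r ^ (t - ((j : ℕ) + 1 : ℤ)) ≤ r ^ t := by
  calc _ ≤ ∑ j : Fin p, c j * r ^ (t - p) := by
        refine Finset.sum_le_sum fun j _ => mul_le_mul_of_nonneg_left ?_ (hc j)
        have hj : ((j : ℕ) : ℤ) + 1 ≤ p := by exact_mod_cast j.2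
        exact zpow_le_zpow_right_of_le_one₀ hr0 hr1.le (by linarith)
    _ = (∑ j, c j) * r ^ (t - p) := by rw [Finset.sum_mul]
    _ ≤ r ^ p * r ^ (t - p) := by
        have : 0 ≤ r ^ (t - p) := (zpow_pos hr0 _).le
        gcongr; linarith
    _ = r ^ t := by
        rw [← zpow_natCast, ← zpow_add₀ hr0.ne']; congr 1; ring

/-- The means satisfy a linear recursion for which `r ^ (t - s)` is a supersolution, and this power
is at least 1 up to time `s`. The restriction `t ≤ s + m` ensures that the value 1 at iteration zero
is met only at times up to `s`. -/
lemma lintegral_archPropagator_le [IsProbabilityMeasure μ] {Z : ℤ → S → ℝ} (hZ : IsInnovation μ Z)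
    {α : Param p} (hα : ∀ i, 0 ≤ α i) {ν r : ℝ} (hsum : ∑ j : Fin p, α j.succ ≤ 1 - ν)
    (hr0 : 0 < r) (hr1 : r < 1) (hr : 1 - ν ≤ r ^ p) (s : ℤ) (m : ℕ) (t : ℤ) (ht : t ≤ s + m) :
    ∫⁻ ω, ENNReal.ofReal (archPropagator α Z s m t ω) ∂μ ≤ ENNReal.ofReal (r ^ (t - s)) := by
  have hbase : ∀ t ≤ s, (1 : ENNReal) ≤ ENNReal.ofReal (r ^ (t - s)) := fun t ht => by
    rw [ENNReal.one_le_ofReal]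
    have := zpow_le_zpow_right_of_le_one₀ hr0 hr1.le (show t - s ≤ 0 by linarith)
    simpa using this
  induction m generalizing t with
  | zero => simpa [archPropagator] using hbase t (by simpa using ht)
  | succ m ih =>
    by_cases h : t ≤ s
    · simpa [archPropagator, h] using hbase t h
    · simp only [archPropagator, h, if_false]
      rw [hZ.lintegral_sq_mul_sum (T := Iio t) (by simp) le_rfl (fun j => hα _)
        (fun j => Measurable.aestronglyMeasurable ((measurable_archPropagator α Z s m _).mono
          (sigmaOf_mono Z (Iic_subset_Iio.2 (by linarith [Int.natCast_nonneg (j : ℕ)]))) le_rfl))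
        (fun j ω => archPropagator_nonneg hα Z s m _ ω), ENNReal.ofReal_zero, zero_add]
      push_cast at ht
      calc _ ≤ ∑ j : Fin p, ENNReal.ofReal (α j.succ) *
              ENNReal.ofReal (r ^ (t - s - ((j : ℕ) + 1 : ℤ))) := by
            refine Finset.sum_le_sum fun j _ => ?_
            gcongr
            rw [sub_right_comm]
            exact ih _ (by linarith [Int.natCast_nonneg (j : ℕ)])
        _ = ENNReal.ofReal (∑ j : Fin p, α j.succ * r ^ (t - s - ((j : ℕ) + 1 : ℤ))) := by
            rw [ENNReal.ofReal_sum_of_nonneg fun j _ => mul_nonneg (hα _) (zpow_pos hr0 _).le]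
            simp only [ENNReal.ofReal_mul (hα _)]
        _ ≤ _ := ENNReal.ofReal_le_ofReal
            (sum_mul_zpow_le (fun j => hα _) hsum hr0 hr1 hr _)

end TVARCH

namespace TVARCH

variable {p : ℕ} {S : Type*} [MeasurableSpace S] {μ : Measure S}

/-! ### The squared stationary ARCH process -/

/-- `V` satisfies the squared ARCH recursion with a.s. finite, identically distributed values. -/
structure IsSquaredARCH (μ : Measure S) (Z : ℤ → S → ℝ) (α : Param p) (V : ℤ → S → ℝ) :
    Prop where
  aemeasurable : ∀ t, AEMeasurable (V t) μ
  nonneg : ∀ t ω, 0 ≤ V t ω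
  equation : ∀ᵐ ω ∂μ, ∀ t,
    V t ω = Z t ω ^ 2 * (α 0 + ∑ j : Fin p, α j.succ * V (t - ((j : ℕ) + 1 : ℤ)) ω)
  identDistrib : ∀ t, IdentDistrib (V t) (V 0) μ μ

lemma IsStationaryARCH.identDistrib_eval {Z : ℤ → S → ℝ} {α : Param p} {Y : ℤ → S → ℝ}
    (hY : IsStationaryARCH μ Z α Y) (t : ℤ) : IdentDistrib (Y t) (Y 0) μ μ := by
  have := (hY.stationary t).comp (u := fun x : ℤ → ℝ => x 0) (measurable_pi_apply 0)
  simpa [Function.comp_def] using this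

lemma IsStationaryARCH.isSquaredARCH {Z : ℤ → S → ℝ} {α : Param p} {Y : ℤ → S → ℝ}
    (hY : IsStationaryARCH μ Z α Y) : IsSquaredARCH μ Z α (fun t ω => Y t ω ^ 2) where
  aemeasurable t := (hY.identDistrib_eval t).aemeasurable_fst.pow_const 2
  nonneg t ω := sq_nonneg _
  equation := by
    rw [ae_all_iff]
    intro t
    obtain ⟨σ, hσ⟩ := hY.equation t
    filter_upwards [hσ] with ω hω
    rw [hω.1, mul_pow, hω.2, mul_comm]
    rfl
  identDistrib t := (hY.identDistrib_eval t).comp (measurable_id.pow_const 2)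

namespace IsSquaredARCH

variable {Z : ℤ → S → ℝ} {α : Param p} {V : ℤ → S → ℝ}

/-- Finiteness of `V 0` alone gives this, by continuity of the measure from above; no moment is
available yet. -/
lemma tendsto_tail [IsProbabilityMeasure μ] (hV : IsSquaredARCH μ Z α V) :
    Tendsto (fun n : ℕ => μ {ω | (n : ℝ) < V 0 ω}) atTop (𝓝 0) := by
  have h := tendsto_measure_iInter_atTop (μ := μ) (s := fun n : ℕ => {ω | (n : ℝ) < V 0 ω})
    (fun n => nullMeasurableSet_lt aemeasurable_const (hV.aemeasurable 0))
    (fun a b hab ω (hω : (b : ℝ) < V 0 ω) =>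
      show (a : ℝ) < V 0 ω from lt_of_le_of_lt (by exact_mod_cast hab) hω)
    ⟨0, measure_ne_top _ _⟩
  have e : ⋂ n : ℕ, {ω | (n : ℝ) < V 0 ω} = ∅ := by
    refine eq_empty_iff_forall_notMem.2 fun ω hω => ?_
    obtain ⟨n, hn⟩ := exists_nat_ge (V 0 ω)
    exact absurd (mem_iInter.1 hω n) (not_lt.2 hn)
  rwa [e, measure_empty] at h

/-- Either one of the `p` starting values exceeds `T`, and all these events have the same
probability, or the error is at most `T` times the propagator, to which Markov's inequality applies.
The starting block ends `m` steps before `t`, so `m` iterations just reach it. -/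
lemma measure_sub_archApprox_le [IsProbabilityMeasure μ] (hZ : IsInnovation μ Z)
    (hV : IsSquaredARCH μ Z α V)
    (hα : ∀ i, 0 ≤ α i) {ν r : ℝ} (hsum : ∑ j : Fin p, α j.succ ≤ 1 - ν)
    (hr0 : 0 < r) (hr1 : r < 1) (hr : 1 - ν ≤ r ^ p) {ε T : ℝ} (hε : 0 < ε) (hT : 0 < T)
    {m : ℕ} (hm : 1 ≤ m) (t : ℤ) :
    μ {ω | ε ≤ V t ω - archApprox α Z m t ω} ≤
      p * μ {ω | T < V 0 ω} + ENNReal.ofReal (r ^ m) / ENNReal.ofReal (ε / T) := by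
  set s : ℤ := t - m with hs
  have hsub : {ω | ε ≤ V t ω - archApprox α Z m t ω} ≤ᵐ[μ]
      ((⋃ i ∈ Finset.range p, {ω | T < V (s - i) ω}) ∪
        {ω | ENNReal.ofReal (ε / T) ≤ ENNReal.ofReal (archPropagator α Z s m t ω)} : Set S) := by
    filter_upwards [hV.equation] with ω hω hlt
    by_contra hn
    have hn' : ω ∉ ((⋃ i ∈ Finset.range p, {ω | T < V (s - i) ω}) ∪
        {ω | ENNReal.ofReal (ε / T) ≤ ENNReal.ofReal (archPropagator α Z s m t ω)} : Set S) := hn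
    rw [mem_union, not_or] at hn'
    have h1 : ∀ t', s - p < t' → t' ≤ s → V t' ω ≤ T := by
      intro t' h1 h2
      by_contra h3
      refine hn'.1 (mem_biUnion (x := (s - t').toNat) ?_ ?_)
      · simp only [Finset.coe_range, mem_Iio]; omega
      · have : s - ((s - t').toNat : ℤ) = t' := by omega
        show T < V (s - ((s - t').toNat : ℤ)) ω
        rw [this]; exact not_le.1 h3
    have hlt' : ε ≤ V t ω - archApprox α Z m t ω := hlt
    refine hn'.2 (ENNReal.ofReal_le_ofReal ?_)
    rw [div_le_iff₀' hT]
    -- The condition `s - p < t` holds for `p = 0` as well because `1 ≤ m`.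
    exact hlt'.trans (sub_archApprox_le hα hω h1 m t (by omega) (by omega))
  refine (measure_mono_ae hsub).trans ((measure_union_le _ _).trans (add_le_add ?_ ?_))
  · refine (measure_biUnion_finset_le _ _).trans ?_
    have : ∀ i ∈ Finset.range p, μ {ω | T < V (s - i) ω} = μ {ω | T < V 0 ω} := fun i _ =>
      (hV.identDistrib (s - i)).measure_mem_eq measurableSet_Ioi
    rw [Finset.sum_congr rfl this]
    simp
  · refine (meas_ge_le_lintegral_div ?_ ?_ ENNReal.ofReal_ne_top).trans ?_
    · exact (((measurable_archPropagator α Z s m t).mono (hZ.sigmaOf_le _)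
        le_rfl).ennreal_ofReal).aemeasurable
    · exact (ENNReal.ofReal_pos.2 (div_pos hε hT)).ne'
    · gcongr
      have := lintegral_archPropagator_le hZ hα hsum hr0 hr1 hr s m t (by omega)
      rwa [show t - s = (m : ℤ) by omega, zpow_natCast] at this

lemma tendstoInMeasure_archApprox [IsProbabilityMeasure μ] (hZ : IsInnovation μ Z)
    (hV : IsSquaredARCH μ Z α V) (hα : ∀ i, 0 ≤ α i) {ν : ℝ} (hν0 : 0 < ν) (hν1 : ν < 1)
    (hsum : ∑ j : Fin p, α j.succ ≤ 1 - ν) (t : ℤ) :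
    TendstoInMeasure μ (fun m => archApprox α Z m t) atTop (V t) := by
  obtain ⟨r, hr0, hr1, hr⟩ := exists_rate p hν0 hν1
  rw [tendstoInMeasure_iff_dist]
  intro ε hε
  rw [ENNReal.tendsto_nhds_zero]
  intro δ hδ
  have h1 : Tendsto (fun n : ℕ => (p : ENNReal) * μ {ω | (n : ℝ) < V 0 ω}) atTop (𝓝 0) := by
    simpa using ENNReal.Tendsto.const_mul (a := (p : ENNReal)) hV.tendsto_tail
      (Or.inr (ENNReal.natCast_ne_top p))
  have hδ2 : 0 < δ / 2 := ENNReal.half_pos hδ.ne'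
  -- The truncation level `n` is fixed from the tail of `V 0` before the number of iterations is
  -- sent to infinity.
  obtain ⟨n, hn, hn0⟩ :=
    (((ENNReal.tendsto_nhds_zero.1 h1) _ hδ2).and (eventually_gt_atTop 0)).exists
  have hn0' : (0 : ℝ) < n := by exact_mod_cast hn0
  have h2 : Tendsto (fun m : ℕ => ENNReal.ofReal (r ^ m) / ENNReal.ofReal (ε / n)) atTop
      (𝓝 0) := by
    have h3 := ENNReal.tendsto_ofReal (tendsto_pow_atTop_nhds_zero_of_lt_one hr0.le hr1)
    simpa using ENNReal.Tendsto.div_const h3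
      (Or.inr (ENNReal.ofReal_pos.2 (div_pos hε hn0')).ne')
  filter_upwards [(ENNReal.tendsto_nhds_zero.1 h2) _ hδ2, eventually_ge_atTop 1] with m hm hm1
  have h4 := hV.measure_sub_archApprox_le hZ hα hsum hr0 hr1 hr hε hn0' hm1 t
  refine le_trans (measure_mono_ae ?_) (h4.trans ((add_le_add hn hm).trans
    (ENNReal.add_halves δ).le))
  filter_upwards [hV.equation] with ω hω (hlt : ε ≤ dist _ _)
  have := archApprox_le hα (fun t => hV.nonneg t ω) hω m t
  rw [dist_comm, Real.dist_eq, abs_of_nonneg (sub_nonneg.2 this)] at hlt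
  exact hlt

/-- Convergence in measure gives an a.s. convergent subsequence, and monotonicity in `m` extends the
limit to the full sequence. -/
lemma ae_tendsto_archApprox [IsProbabilityMeasure μ] (hZ : IsInnovation μ Z)
    (hV : IsSquaredARCH μ Z α V) (hα : ∀ i, 0 ≤ α i) {ν : ℝ} (hν0 : 0 < ν) (hν1 : ν < 1)
    (hsum : ∑ j : Fin p, α j.succ ≤ 1 - ν) (t : ℤ) :
    ∀ᵐ ω ∂μ, Tendsto (fun m => archApprox α Z m t ω) atTop (𝓝 (V t ω)) := by
  obtain ⟨ns, hns, h⟩ := (hV.tendstoInMeasure_archApprox hZ hα hν0 hν1 hsum t).exists_seq_tendsto_ae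
  filter_upwards [h] with ω hω
  exact (tendsto_iff_tendsto_subseq_of_monotone
    (monotone_nat_of_le_succ fun m => archApprox_le_succ hα Z m t ω) hns.tendsto_atTop).2 hω

end IsSquaredARCH

/-- The value α₀/ν is a supersolution of the mean recursion, as α₀ + (1 - ν) α₀/ν = α₀/ν.
Independence of `t` is proved in the same induction because it lets all lagged means be replaced by
the one at time 0. -/
lemma lintegral_archApprox_le [IsProbabilityMeasure μ] {Z : ℤ → S → ℝ} (hZ : IsInnovation μ Z)
    {α : Param p} (hα : ∀ i, 0 ≤ α i) {ν : ℝ} (hν0 : 0 < ν)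
    (hsum : ∑ j : Fin p, α j.succ ≤ 1 - ν) (m : ℕ) (t : ℤ) :
    ∫⁻ ω, ENNReal.ofReal (archApprox α Z m t ω) ∂μ ≤ ENNReal.ofReal (α 0 / ν) ∧
      ∫⁻ ω, ENNReal.ofReal (archApprox α Z m t ω) ∂μ =
        ∫⁻ ω, ENNReal.ofReal (archApprox α Z m 0 ω) ∂μ := by
  induction m generalizing t with
  | zero => simp [archApprox]
  | succ m ih =>
    have key : ∀ t, ∫⁻ ω, ENNReal.ofReal (archApprox α Z (m + 1) t ω) ∂μ = ENNReal.ofReal (α 0) +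
        ∑ j : Fin p, ENNReal.ofReal (α j.succ) *
          ∫⁻ ω, ENNReal.ofReal (archApprox α Z m 0 ω) ∂μ := fun t => by
      simp only [archApprox]
      rw [hZ.lintegral_sq_mul_sum (T := Iio t) (by simp) (hα 0) (fun j => hα _)
        (fun j => Measurable.aestronglyMeasurable ((measurable_archApprox α Z m _).mono
          (sigmaOf_mono Z (Icc_subset_Iic_self.trans
            (Iic_subset_Iio.2 (by linarith [Int.natCast_nonneg (j : ℕ)])))) le_rfl))
        (fun j ω => archApprox_nonneg hα Z m _ ω)]
      simp only [(ih _).2]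
    refine ⟨?_, by rw [key, key]⟩
    rw [key t]
    have h0 : 0 ≤ α 0 / ν := div_nonneg (hα 0) hν0.le
    calc _ ≤ ENNReal.ofReal (α 0) + ∑ j : Fin p, ENNReal.ofReal (α j.succ) *
            ENNReal.ofReal (α 0 / ν) := by gcongr; exact (ih 0).1
      _ = ENNReal.ofReal (α 0 + (∑ j : Fin p, α j.succ) * (α 0 / ν)) := by
          rw [ENNReal.ofReal_add (hα 0) (mul_nonneg (Finset.sum_nonneg fun j _ => hα _) h0),
            ENNReal.ofReal_mul (Finset.sum_nonneg fun j _ => hα _),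
            ENNReal.ofReal_sum_of_nonneg (fun j _ => hα _), Finset.sum_mul]
      _ ≤ _ := by
          refine ENNReal.ofReal_le_ofReal ?_
          have : (∑ j : Fin p, α j.succ) * (α 0 / ν) ≤ (1 - ν) * (α 0 / ν) := by gcongr
          have e : (1 - ν) * (α 0 / ν) = α 0 / ν - α 0 := by field_simp
          linarith

lemma integrable_archApprox [IsProbabilityMeasure μ] {Z : ℤ → S → ℝ} (hZ : IsInnovation μ Z)
    {α : Param p} (hα : ∀ i, 0 ≤ α i) {ν : ℝ} (hν0 : 0 < ν)
    (hsum : ∑ j : Fin p, α j.succ ≤ 1 - ν) (m : ℕ) (t : ℤ) :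
    Integrable (archApprox α Z m t) μ := by
  refine ⟨((measurable_archApprox α Z m t).mono (hZ.sigmaOf_le _) le_rfl).aestronglyMeasurable, ?_⟩
  rw [hasFiniteIntegral_iff_ofReal (Eventually.of_forall fun ω => archApprox_nonneg hα Z m t ω)]
  exact (lintegral_archApprox_le hZ hα hν0 hsum m t).1.trans_lt ENNReal.ofReal_lt_top

namespace IsSquaredARCH

variable {Z : ℤ → S → ℝ} {α : Param p} {V : ℤ → S → ℝ}

/-- Monotone convergence carries the bound α₀/ν from the approximations to the limit, so strict
stationarity already forces a finite second moment of the ARCH process. -/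
lemma integrable [IsProbabilityMeasure μ] (hZ : IsInnovation μ Z)
    (hV : IsSquaredARCH μ Z α V) (hα : ∀ i, 0 ≤ α i) {ν : ℝ} (hν0 : 0 < ν) (hν1 : ν < 1)
    (hsum : ∑ j : Fin p, α j.succ ≤ 1 - ν) (t : ℤ) : Integrable (V t) μ := by
  refine ⟨(hV.aemeasurable t).aestronglyMeasurable, ?_⟩
  rw [hasFiniteIntegral_iff_ofReal (Eventually.of_forall fun ω => hV.nonneg t ω)]
  have h := lintegral_tendsto_of_tendsto_of_monotone (μ := μ)
    (f := fun m ω => ENNReal.ofReal (archApprox α Z m t ω))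
    (F := fun ω => ENNReal.ofReal (V t ω))
    (fun m => ((measurable_archApprox α Z m t).mono (hZ.sigmaOf_le _)
      le_rfl).ennreal_ofReal.aemeasurable)
    (Eventually.of_forall fun ω => monotone_nat_of_le_succ fun m =>
      ENNReal.ofReal_le_ofReal (archApprox_le_succ hα Z m t ω))
    (by
      filter_upwards [hV.ae_tendsto_archApprox hZ hα hν0 hν1 hsum t] with ω hω
      exact ENNReal.tendsto_ofReal hω)
  exact (le_of_tendsto' h fun m => (lintegral_archApprox_le hZ hα hν0 hsum m t).1).trans_lt
    ENNReal.ofReal_lt_top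

lemma integral_eq (hV : IsSquaredARCH μ Z α V) (t : ℤ) : ∫ ω, V t ω ∂μ = ∫ ω, V 0 ω ∂μ :=
  (hV.identDistrib t).integral_eq

/-- The finite-range approximation in mean, uniformly in time. -/
lemma exists_archApprox_close [IsProbabilityMeasure μ] (hZ : IsInnovation μ Z)
    (hV : IsSquaredARCH μ Z α V) (hα : ∀ i, 0 ≤ α i) {ν : ℝ} (hν0 : 0 < ν) (hν1 : ν < 1)
    (hsum : ∑ j : Fin p, α j.succ ≤ 1 - ν) {ε : ℝ} (hε : 0 < ε) :
    ∃ m : ℕ, ∀ t, ∫ ω, |V t ω - archApprox α Z m t ω| ∂μ ≤ ε := by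
  have hle : ∀ m t, ∀ᵐ ω ∂μ, archApprox α Z m t ω ≤ V t ω := fun m t => by
    filter_upwards [hV.equation] with ω hω
    exact archApprox_le hα (fun t => hV.nonneg t ω) hω m t
  have h1 : Tendsto (fun m => ∫ ω, archApprox α Z m 0 ω ∂μ) atTop (𝓝 (∫ ω, V 0 ω ∂μ)) := by
    refine tendsto_integral_of_dominated_convergence (V 0)
      (fun m => (integrable_archApprox hZ hα hν0 hsum m 0).aestronglyMeasurable)
      (hV.integrable hZ hα hν0 hν1 hsum 0) (fun m => ?_)
      (hV.ae_tendsto_archApprox hZ hα hν0 hν1 hsum 0)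
    filter_upwards [hle m 0] with ω hω
    rwa [Real.norm_of_nonneg (archApprox_nonneg hα Z m 0 ω)]
  obtain ⟨m, hm⟩ := (h1.eventually (lt_mem_nhds (sub_lt_self _ hε))).exists
  refine ⟨m, fun t => ?_⟩
  -- The approximations lie below `V`, so the absolute value can be dropped; both means are free of
  -- `t`, and the `m` found at time 0 works at all times.
  have e1 : ∫ ω, |V t ω - archApprox α Z m t ω| ∂μ = ∫ ω, (V t ω - archApprox α Z m t ω) ∂μ := by
    refine integral_congr_ae ?_
    filter_upwards [hle m t] with ω hω
    exact abs_of_nonneg (sub_nonneg.2 hω)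
  have e2 : ∫ ω, archApprox α Z m t ω ∂μ = ∫ ω, archApprox α Z m 0 ω ∂μ := by
    have hm : ∀ s, AEStronglyMeasurable (archApprox α Z m s) μ := fun s =>
      (integrable_archApprox hZ hα hν0 hsum m s).aestronglyMeasurable
    rw [integral_eq_lintegral_of_nonneg_ae
        (Eventually.of_forall fun ω => archApprox_nonneg hα Z m t ω) (hm t),
      integral_eq_lintegral_of_nonneg_ae
        (Eventually.of_forall fun ω => archApprox_nonneg hα Z m 0 ω) (hm 0),
      (lintegral_archApprox_le hZ hα hν0 hsum m t).2]
  rw [e1, integral_sub (hV.integrable hZ hα hν0 hν1 hsum t)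
    (integrable_archApprox hZ hα hν0 hsum m t), hV.integral_eq, e2]
  linarith

/-- The stationary squared ARCH process is causal. -/
lemma aestronglyMeasurable_past [IsProbabilityMeasure μ] (hZ : IsInnovation μ Z)
    (hV : IsSquaredARCH μ Z α V) (hα : ∀ i, 0 ≤ α i) {ν : ℝ} (hν0 : 0 < ν) (hν1 : ν < 1)
    (hsum : ∑ j : Fin p, α j.succ ≤ 1 - ν) (t : ℤ) :
    AEStronglyMeasurable[sigmaOf Z (Iic t)] (V t) μ := by
  -- The limsup of the approximations is measurable with respect to the past everywhere and equals
  -- `V t` almost surely.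
  refine ⟨fun ω => limsup (fun m => archApprox α Z m t ω) atTop,
    Measurable.stronglyMeasurable (Measurable.limsup fun m =>
      (measurable_archApprox α Z m t).mono (sigmaOf_mono Z Icc_subset_Iic_self) le_rfl), ?_⟩
  filter_upwards [hV.ae_tendsto_archApprox hZ hα hν0 hν1 hsum t] with ω hω
  exact hω.limsup_eq.symm

end IsSquaredARCH

end TVARCH

namespace TVARCH

variable {p : ℕ} {S : Type*} [MeasurableSpace S] {μ : Measure S}

/-! ### Comparison of the time-varying process with the stationary process -/

/-- Regularity of the parameter functions on `(0,1]`: nonnegative, contractive and Lipschitz. -/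
structure RegularParam (a : Fin (p + 1) → ℝ → ℝ) (ν L : ℝ) : Prop where
  pos : 0 < ν
  lt_one : ν < 1
  lip_nonneg : 0 ≤ L
  nonneg : ∀ u ∈ Ioc (0 : ℝ) 1, ∀ i, 0 ≤ a i u
  sum_le : ∀ u ∈ Ioc (0 : ℝ) 1, ∑ j : Fin p, a j.succ u ≤ 1 - ν
  lip : ∀ u ∈ Ioc (0 : ℝ) 1, ∀ v ∈ Ioc (0 : ℝ) 1, ∀ i, |a i u - a i v| ≤ L * |u - v|

lemma ParamCond.exists_regularParam {a : Fin (p + 1) → ℝ → ℝ} (ha : ParamCond a)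
    (h0 : ∀ u ∈ Ioc (0 : ℝ) 1, ∀ i, 0 ≤ a i u) : ∃ ν L, RegularParam a ν L := by
  obtain ⟨ρ, Q, M, ν, l, -, hQ, hM, hν0, hν1, hl, -, hle, hs, hsum, hlip, -⟩ := ha
  refine ⟨ν, ∑ i : Fin (p + 1), M / l i, hν0, hν1,
    Finset.sum_nonneg fun i _ => (div_pos hM (hl i)).le, h0, fun u hu => ?_,
    fun u hu v hv i => ?_⟩
  · calc ∑ j : Fin p, a j.succ u ≤ ∑ j : Fin p, Q * (1 / l ((j : ℕ) + 1)) := by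
          refine Finset.sum_le_sum fun j _ => ?_
          have := hle j.succ u hu
          simpa [div_eq_mul_inv] using this
      _ = Q * ∑ j ∈ Finset.range p, 1 / l (j + 1) := by
          rw [← Finset.mul_sum, Fin.sum_univ_eq_sum_range (fun j => 1 / l (j + 1))]
      _ ≤ Q * ∑' j : ℕ, 1 / l (j + 1) := by
          gcongr
          exact hs.sum_le_tsum _ fun j _ => (one_div_pos.2 (hl _)).le
      _ ≤ 1 - ν := hsum
  · refine (hlip i u hu v hv).trans ?_
    have h1 : M / l i ≤ ∑ i : Fin (p + 1), M / l i :=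
      Finset.single_le_sum (f := fun i : Fin (p + 1) => M / l i)
        (fun i _ => (div_pos hM (hl i)).le) (Finset.mem_univ i)
    calc M * (|u - v| / l i) = M / l i * |u - v| := by ring
      _ ≤ _ := by gcongr

namespace IsTVARCH

variable {Z : ℤ → S → ℝ} {a : Fin (p + 1) → ℝ → ℝ} {X : ℕ → ℤ → S → ℝ}

lemma sq_eq (hX : IsTVARCH μ Z a X) {N : ℕ} {t : ℤ} (h1 : 1 ≤ t) (h2 : t ≤ N) :
    ∀ᵐ ω ∂μ, X N t ω ^ 2 = Z t ω ^ 2 * (a 0 ((t : ℝ) / N) +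
      ∑ j : Fin p, a j.succ ((t : ℝ) / N) * X N (t - ((j : ℕ) + 1 : ℤ)) ω ^ 2) := by
  obtain ⟨σ, hσ⟩ := hX.equation N t h1 h2
  filter_upwards [hσ] with ω hω
  rw [hω.1, mul_pow, hω.2, mul_comm]
  rfl

lemma aestronglyMeasurable_sq (hX : IsTVARCH μ Z a X) {N : ℕ} {t : ℤ} (h1 : 1 - (p : ℤ) ≤ t)
    (h2 : t ≤ N) : AEStronglyMeasurable[sigmaOf Z (Iic t)] (fun ω => X N t ω ^ 2) μ := by
  obtain ⟨Y, hY, hXY⟩ := hX.causal N t h1 h2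
  refine ⟨fun ω => Y ω ^ 2, (hY.pow_const 2).stronglyMeasurable, ?_⟩
  filter_upwards [hXY] with ω hω
  rw [hω]

end IsTVARCH

lemma mem_Ioc_div {N : ℕ} {t : ℤ} (h1 : 1 ≤ t) (h2 : t ≤ N) : (t : ℝ) / N ∈ Ioc (0 : ℝ) 1 := by
  have h3 : (0 : ℝ) < t := by exact_mod_cast h1
  have h4 : (t : ℝ) ≤ N := by exact_mod_cast h2
  exact ⟨div_pos h3 (h3.trans_le h4), (div_le_one (h3.trans_le h4)).2 h4⟩

/-- The coefficient error multiplies the stationary values `v`, whose means are constant in time;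
the distances `|x j - v j|` carry the contractive coefficients `c`. -/
lemma abs_sq_recursion_sub_le {z c₀ d₀ ε : ℝ} {c d x v : Fin p → ℝ} (hc : ∀ j, 0 ≤ c j)
    (hv : ∀ j, 0 ≤ v j) (h₀ : |c₀ - d₀| ≤ ε) (h : ∀ j, |c j - d j| ≤ ε) :
    |z ^ 2 * (c₀ + ∑ j, c j * x j) - z ^ 2 * (d₀ + ∑ j, d j * v j)| ≤
      z ^ 2 * (ε + ∑ j, ε * v j) + z ^ 2 * (0 + ∑ j, c j * |x j - v j|) := by
  have e : z ^ 2 * (c₀ + ∑ j, c j * x j) - z ^ 2 * (d₀ + ∑ j, d j * v j) =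
      z ^ 2 * ((c₀ - d₀) + (∑ j, (c j - d j) * v j + ∑ j, c j * (x j - v j))) := by
    rw [← mul_sub, ← Finset.sum_add_distrib]
    congr 1
    rw [add_sub_add_comm, ← Finset.sum_sub_distrib]
    congr 1
    exact Finset.sum_congr rfl fun j _ => by ring
  rw [e, ← mul_add, abs_mul, abs_of_nonneg (sq_nonneg z)]
  refine mul_le_mul_of_nonneg_left ?_ (sq_nonneg z)
  rw [zero_add, add_assoc]
  refine (abs_add_le _ _).trans (add_le_add h₀ ((abs_add_le _ _).trans (add_le_add ?_ ?_)))
  · refine (Finset.abs_sum_le_sum_abs _ _).trans (Finset.sum_le_sum fun j _ => ?_)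
    rw [abs_mul, abs_of_nonneg (hv j)]
    exact mul_le_mul_of_nonneg_right (h j) (hv j)
  · refine (Finset.abs_sum_le_sum_abs _ _).trans (Finset.sum_le_sum fun j _ => ?_)
    rw [abs_mul, abs_of_nonneg (hc j)]

/-- The bound for `E |X_{t,N}² - V_t|`. -/
noncomputable def driftBound (A B K r u₀ : ℝ) (N : ℕ) (t : ℤ) : ℝ :=
  A * (|(t : ℝ) / N - u₀| + B / N) + K * r ^ t

/-- `driftBound` is a supersolution of the recursion for the distances. Looking back at most p steps
changes |t/N - u₀| by at most p/N, and B = p(1-ν)/ν is the fixed point of (1-ν)(p + B) = B. The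
slack Aν|t/N - u₀| absorbs the coefficient error, and K r^t transports the initial values. -/
lemma driftBound_step {A K ν r E L u₀ : ℝ} (hν0 : 0 < ν)
    (hK : 0 ≤ K) (hr0 : 0 < r) (hr1 : r < 1) (hr : 1 - ν ≤ r ^ p) (hA : 0 ≤ A)
    (hAν : L * (1 + p * E) ≤ A * ν) {c : Fin p → ℝ} (hc : ∀ j, 0 ≤ c j)
    (hsum : ∑ j, c j ≤ 1 - ν) (N : ℕ) (t : ℤ) :
    L * |(t : ℝ) / N - u₀| + ∑ _j : Fin p, L * |(t : ℝ) / N - u₀| * E +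
      ∑ j : Fin p, c j * driftBound A (p * (1 - ν) / ν) K r u₀ N (t - ((j : ℕ) + 1 : ℤ)) ≤
      driftBound A (p * (1 - ν) / ν) K r u₀ N t := by
  set δ := |(t : ℝ) / N - u₀|
  set B := p * (1 - ν) / ν with hB
  have hB' : (1 - ν) * (p + B) = B := by rw [hB]; field_simp; ring
  have hδ : ∀ j : Fin p, |((t - ((j : ℕ) + 1 : ℤ) : ℤ) : ℝ) / N - u₀| ≤ δ + p / N := fun j => by
    have hj : ((j : ℕ) : ℝ) + 1 ≤ p := by exact_mod_cast j.2
    have e : ((t - ((j : ℕ) + 1 : ℤ) : ℤ) : ℝ) / N - u₀ =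
      ((t : ℝ) / N - u₀) - ((j : ℕ) + 1) / N := by push_cast; ring
    rw [e]
    refine (abs_sub _ _).trans ?_
    rw [abs_of_nonneg (by positivity : (0 : ℝ) ≤ (((j : ℕ) : ℝ) + 1) / N)]
    gcongr
  have h1 : ∑ j : Fin p, c j * driftBound A B K r u₀ N (t - ((j : ℕ) + 1 : ℤ)) ≤
      (1 - ν) * (A * (δ + p / N + B / N)) + K * r ^ t := by
    have hc0 : 0 ≤ ∑ j, c j := Finset.sum_nonneg fun j _ => hc j
    have hB0 : 0 ≤ B := by
      rw [hB]; exact div_nonneg (mul_nonneg (Nat.cast_nonneg _) (hc0.trans hsum)) hν0.le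
    have h0 : 0 ≤ A * (δ + p / N + B / N) := by positivity
    calc _ ≤ ∑ j : Fin p, (c j * (A * (δ + p / N + B / N)) +
              K * (c j * r ^ (t - ((j : ℕ) + 1 : ℤ)))) := by
            refine Finset.sum_le_sum fun j _ => ?_
            rw [driftBound, mul_add]
            have := mul_le_mul_of_nonneg_left (mul_le_mul_of_nonneg_left
              (add_le_add_left (hδ j) (B / N)) hA) (hc j)
            linarith
      _ = (∑ j, c j) * (A * (δ + p / N + B / N)) +
            K * ∑ j : Fin p, c j * r ^ (t - ((j : ℕ) + 1 : ℤ)) := by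
            rw [Finset.sum_add_distrib, Finset.sum_mul, Finset.mul_sum]
      _ ≤ _ := by
            gcongr
            exact sum_mul_zpow_le hc hsum hr0 hr1 hr t
  have h2 : (1 - ν) * (A * (δ + p / N + B / N)) = A * δ - A * ν * δ + A * (B / N) := by
    rw [← hB']; ring_nf; rw [hB]; field_simp; ring
  have h3 : L * δ + ∑ _j : Fin p, L * δ * E ≤ A * ν * δ := by
    have : L * δ + ∑ _j : Fin p, L * δ * E = L * (1 + p * E) * δ := by simp; ring
    rw [this]
    exact mul_le_mul_of_nonneg_right hAν (abs_nonneg _)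
  rw [driftBound]
  linarith

/-- At each time the squared innovation is independent of all lagged values, by causality of `X` and
of `V`, so taking means turns the pathwise comparison into the recursion solved by `driftBound`. At
the initial times the distance has mean at most `C + E`, and `r ^ t ≥ 1` there. -/
theorem IsTVARCH.exists_driftBound [IsProbabilityMeasure μ] {Z : ℤ → S → ℝ}
    (hZ : IsInnovation μ Z)
    {a : Fin (p + 1) → ℝ → ℝ} {ν L : ℝ} (ha : RegularParam a ν L)
    {X : ℕ → ℤ → S → ℝ} (hX : IsTVARCH μ Z a X) {u₀ : ℝ} (hu₀ : u₀ ∈ Ioc (0 : ℝ) 1)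
    {V : ℤ → S → ℝ} (hV : IsSquaredARCH μ Z (fun j => a j u₀) V) :
    ∃ A B K r : ℝ, 0 ≤ A ∧ 0 ≤ B ∧ 0 ≤ K ∧ 0 < r ∧ r < 1 ∧ ∀ (N : ℕ) (t : ℤ),
      1 - (p : ℤ) ≤ t → t ≤ N →
      ∫⁻ ω, ENNReal.ofReal |X N t ω ^ 2 - V t ω| ∂μ ≤
        ENNReal.ofReal (driftBound A B K r u₀ N t) := by
  obtain ⟨r, hr0, hr1, hr⟩ := exists_rate p ha.pos ha.lt_one
  have hν := ha.pos
  have hα : ∀ i, 0 ≤ a i u₀ := ha.nonneg u₀ hu₀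
  have hVi := fun t => hV.integrable hZ hα ha.pos ha.lt_one (ha.sum_le u₀ hu₀) t
  have hVp := fun t => hV.aestronglyMeasurable_past hZ hα ha.pos ha.lt_one (ha.sum_le u₀ hu₀) t
  set E := ∫ ω, V 0 ω ∂μ with hE
  have hE0 : 0 ≤ E := integral_nonneg fun ω => hV.nonneg 0 ω
  have hVE : ∀ t, ∫⁻ ω, ENNReal.ofReal (V t ω) ∂μ = ENNReal.ofReal E := fun t => by
    rw [hE, ← hV.integral_eq t, ofReal_integral_eq_lintegral_ofReal (hVi t)
      (Eventually.of_forall fun ω => hV.nonneg t ω)]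
  obtain ⟨C, hC⟩ := hX.initial_bound
  have hL := ha.lip_nonneg
  have h1ν : 0 ≤ 1 - ν := by linarith [ha.lt_one]
  set A := L * (1 + p * E) / ν with hA
  have hA0 : 0 ≤ A := by positivity
  have hB0 : 0 ≤ p * (1 - ν) / ν := by positivity
  refine ⟨A, p * (1 - ν) / ν, C + E, r, hA0, hB0, by positivity, hr0, hr1, fun N => ?_⟩
  have hpos : ∀ t : ℤ, 0 ≤ driftBound A (p * (1 - ν) / ν) (C + E) r u₀ N t := fun t => by
    have : 0 ≤ r ^ t := (zpow_pos hr0 t).le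
    unfold driftBound; positivity
  -- Times are integers starting at `1 - p`, so the induction runs over a natural upper bound `n`;
  -- its base case covers all initial times at once.
  suffices H : ∀ (n : ℕ) (t : ℤ), 1 - (p : ℤ) ≤ t → t ≤ N → t ≤ n →
      ∫⁻ ω, ENNReal.ofReal |X N t ω ^ 2 - V t ω| ∂μ ≤
        ENNReal.ofReal (driftBound A (p * (1 - ν) / ν) (C + E) r u₀ N t) from
    fun t h1 h2 => H N t h1 h2 h2
  intro n
  induction n with
  | zero =>
    intro t h1 h2 h3
    have h3' : t ≤ 0 := by simpa using h3
    calc _ ≤ ∫⁻ ω, (ENNReal.ofReal (V t ω) + ENNReal.ofReal (X N t ω ^ 2)) ∂μ := by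
          refine lintegral_mono fun ω => ?_
          dsimp only
          rw [← ENNReal.ofReal_add (hV.nonneg t ω) (sq_nonneg _)]
          refine ENNReal.ofReal_le_ofReal ((abs_sub _ _).trans ?_)
          rw [abs_of_nonneg (sq_nonneg _), abs_of_nonneg (hV.nonneg t ω), add_comm]
      _ ≤ ENNReal.ofReal E + C := by
          rw [lintegral_add_left' (hV.aemeasurable t).ennreal_ofReal, hVE]
          gcongr
          exact hC N t h1 h3'
      _ = ENNReal.ofReal (C + E) := by
          rw [ENNReal.ofReal_add C.coe_nonneg hE0, ENNReal.ofReal_coe_nnreal, add_comm]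
      _ ≤ _ := by
          refine ENNReal.ofReal_le_ofReal ?_
          have h4 : 1 ≤ r ^ t := one_le_zpow_of_nonpos₀ hr0 hr1.le h3'
          have h5 : (C + E : ℝ) * 1 ≤ (C + E) * r ^ t := by gcongr
          have h6 : 0 ≤ A * (|(t : ℝ) / N - u₀| + p * (1 - ν) / ν / N) := by positivity
          rw [driftBound]; linarith
  | succ n ih =>
    intro t h1 h2 h3
    by_cases h4 : t ≤ n
    · exact ih t h1 h2 h4
    have ht : t = n + 1 := by push_cast at h3; omega
    have ht1 : 1 ≤ t := by omega
    have hu := mem_Ioc_div ht1 h2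
    set δ := |(t : ℝ) / N - u₀| with hδ
    have hprev : ∀ j : Fin p, 1 - (p : ℤ) ≤ t - ((j : ℕ) + 1 : ℤ) ∧
        t - ((j : ℕ) + 1 : ℤ) ≤ N ∧ t - ((j : ℕ) + 1 : ℤ) ≤ n := fun j => by
      have := j.2
      omega
    have hmono : ∀ j : Fin p, sigmaOf Z (Iic (t - ((j : ℕ) + 1 : ℤ))) ≤ sigmaOf Z (Iio t) :=
      fun j => sigmaOf_mono Z (Iic_subset_Iio.2 (by linarith [Int.natCast_nonneg (j : ℕ)]))
    have hVm : ∀ j : Fin p, AEStronglyMeasurable[sigmaOf Z (Iio t)]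
        (V (t - ((j : ℕ) + 1 : ℤ))) μ := fun j => (hVp _).mono (hmono j)
    have hXm : ∀ j : Fin p, AEStronglyMeasurable[sigmaOf Z (Iio t)]
        (fun ω => |X N (t - ((j : ℕ) + 1 : ℤ)) ω ^ 2 - V (t - ((j : ℕ) + 1 : ℤ)) ω|) μ := fun j =>
      continuous_abs.comp_aestronglyMeasurable
        (((hX.aestronglyMeasurable_sq (hprev j).1 (hprev j).2.1).mono (hmono j)).sub (hVm j))
    calc _ ≤ ∫⁻ ω, (ENNReal.ofReal (Z t ω ^ 2 *
              (L * δ + ∑ j : Fin p, L * δ * V (t - ((j : ℕ) + 1 : ℤ)) ω)) +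
            ENNReal.ofReal (Z t ω ^ 2 * (0 + ∑ j : Fin p, a j.succ ((t : ℝ) / N) *
              |X N (t - ((j : ℕ) + 1 : ℤ)) ω ^ 2 - V (t - ((j : ℕ) + 1 : ℤ)) ω|))) ∂μ := by
          refine lintegral_mono_ae ?_
          filter_upwards [hX.sq_eq ht1 h2, hV.equation] with ω hω1 hω2
          have hs : 0 ≤ ∑ j : Fin p, L * δ * V (t - ((j : ℕ) + 1 : ℤ)) ω :=
            Finset.sum_nonneg fun j _ => mul_nonneg (by positivity) (hV.nonneg _ ω)
          have hs2 : 0 ≤ ∑ j : Fin p, a j.succ ((t : ℝ) / N) *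
              |X N (t - ((j : ℕ) + 1 : ℤ)) ω ^ 2 - V (t - ((j : ℕ) + 1 : ℤ)) ω| :=
            Finset.sum_nonneg fun j _ => mul_nonneg (ha.nonneg _ hu _) (abs_nonneg _)
          rw [← ENNReal.ofReal_add (by positivity) (by positivity)]
          refine ENNReal.ofReal_le_ofReal ?_
          rw [hω1, hω2 t]
          exact abs_sq_recursion_sub_le (x := fun j : Fin p => X N (t - ((j : ℕ) + 1 : ℤ)) ω ^ 2)
            (v := fun j : Fin p => V (t - ((j : ℕ) + 1 : ℤ)) ω)
            (fun j => ha.nonneg _ hu _) (fun j => hV.nonneg _ ω) (ha.lip _ hu _ hu₀ _)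
            (fun j => ha.lip _ hu _ hu₀ _)
      _ = (ENNReal.ofReal (L * δ) + ∑ _j : Fin p, ENNReal.ofReal (L * δ) * ENNReal.ofReal E) +
            (∑ j : Fin p, ENNReal.ofReal (a j.succ ((t : ℝ) / N)) *
              ∫⁻ ω, ENNReal.ofReal
                |X N (t - ((j : ℕ) + 1 : ℤ)) ω ^ 2 - V (t - ((j : ℕ) + 1 : ℤ)) ω| ∂μ) := by
          have hm : AEMeasurable (fun ω => ENNReal.ofReal (Z t ω ^ 2 *
              (L * δ + ∑ j : Fin p, L * δ * V (t - ((j : ℕ) + 1 : ℤ)) ω))) μ :=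
            (((hZ.measurable t).pow_const 2).aemeasurable.mul (aemeasurable_const.add
              (Finset.aemeasurable_fun_sum _ fun j _ =>
                (hV.aemeasurable _).const_mul _))).ennreal_ofReal
          rw [lintegral_add_left' hm,
            hZ.lintegral_sq_mul_sum (T := Iio t) (by simp) (by positivity)
              (fun j => by positivity) hVm (fun j ω => hV.nonneg _ ω),
            hZ.lintegral_sq_mul_sum (T := Iio t) (by simp) le_rfl
              (fun j => ha.nonneg _ hu _) hXm (fun j ω => abs_nonneg _),
            ENNReal.ofReal_zero, zero_add]
          simp only [hVE]
      _ ≤ (ENNReal.ofReal (L * δ) + ∑ _j : Fin p, ENNReal.ofReal (L * δ) * ENNReal.ofReal E) +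
            (∑ j : Fin p, ENNReal.ofReal (a j.succ ((t : ℝ) / N)) * ENNReal.ofReal
              (driftBound A (p * (1 - ν) / ν) (C + E) r u₀ N (t - ((j : ℕ) + 1 : ℤ)))) := by
          gcongr with j
          exact ih _ (hprev j).1 (hprev j).2.1 (hprev j).2.2
      _ = ENNReal.ofReal (L * δ + ∑ _j : Fin p, L * δ * E + ∑ j : Fin p, a j.succ ((t : ℝ) / N) *
            driftBound A (p * (1 - ν) / ν) (C + E) r u₀ N (t - ((j : ℕ) + 1 : ℤ))) := by
          have hLδ : 0 ≤ L * δ := by positivity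
          rw [ENNReal.ofReal_add (add_nonneg hLδ (Finset.sum_nonneg fun j _ => mul_nonneg hLδ hE0))
              (Finset.sum_nonneg fun j _ => mul_nonneg (ha.nonneg _ hu _) (hpos _)),
            ENNReal.ofReal_add hLδ (Finset.sum_nonneg fun j _ => mul_nonneg hLδ hE0),
            ENNReal.ofReal_sum_of_nonneg (fun j _ => mul_nonneg hLδ hE0),
            ENNReal.ofReal_sum_of_nonneg fun j _ => mul_nonneg (ha.nonneg _ hu _) (hpos _)]
          simp only [ENNReal.ofReal_mul hLδ, ENNReal.ofReal_mul (ha.nonneg _ hu _)]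
      _ ≤ _ := ENNReal.ofReal_le_ofReal (driftBound_step ha.pos (by positivity) hr0 hr1 hr hA0
            (by rw [hA]; field_simp; rfl) (fun j => ha.nonneg _ hu _) (ha.sum_le _ hu) N t)

end TVARCH

namespace TVARCH

variable {p : ℕ} {S : Type*} [MeasurableSpace S] {μ : Measure S}

/-! ### A weighted law of large numbers in mean -/

lemma abs_covariance_le_of_bound [IsProbabilityMeasure μ] {f g : S → ℝ} {R : ℝ} (hR : 0 ≤ R)
    (hf : AEStronglyMeasurable f μ) (hg : AEStronglyMeasurable g μ) (hfR : ∀ ω, |f ω| ≤ R)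
    (hgR : ∀ ω, |g ω| ≤ R) : |cov[f, g; μ]| ≤ 2 * R ^ 2 := by
  rw [covariance_eq_sub (MemLp.of_bound hf R (Eventually.of_forall hfR))
    (MemLp.of_bound hg R (Eventually.of_forall hgR))]
  have h0 : ∀ h : S → ℝ, ∀ C : ℝ, (∀ ω, |h ω| ≤ C) → |∫ ω, h ω ∂μ| ≤ C := fun h C hC => by
    have := norm_integral_le_of_norm_le_const (μ := μ) (f := h) (Eventually.of_forall hC)
    simpa using this
  have h1 : |∫ ω, (f * g) ω ∂μ| ≤ R * R := h0 _ _ fun ω => by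
    rw [Pi.mul_apply, abs_mul]
    exact mul_le_mul (hfR ω) (hgR ω) (abs_nonneg _) hR
  have h2 : |(∫ ω, f ω ∂μ) * ∫ ω, g ω ∂μ| ≤ R * R := by
    rw [abs_mul]
    exact mul_le_mul (h0 f R hfR) (h0 g R hgR) (abs_nonneg _) hR
  refine (abs_sub _ _).trans ?_
  linarith

lemma IsInnovation.covariance_eq_zero [IsProbabilityMeasure μ] {Z : ℤ → S → ℝ}
    (hZ : IsInnovation μ Z) {T U : Set ℤ} (hTU : Disjoint T U) {f g : S → ℝ} {R : ℝ}
    (hf : Measurable[sigmaOf Z T] f) (hg : Measurable[sigmaOf Z U] g) (hfR : ∀ ω, |f ω| ≤ R)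
    (hgR : ∀ ω, |g ω| ≤ R) : cov[f, g; μ] = 0 := by
  have hi : IndepFun f g μ := by
    rw [IndepFun_iff_Indep]
    exact indep_of_indep_of_le_left (indep_of_indep_of_le_right (hZ.indep_sigmaOf hTU)
      hg.comap_le) hf.comap_le
  exact hi.covariance_eq_zero
    (MemLp.of_bound (hf.mono (hZ.sigmaOf_le _) le_rfl).aestronglyMeasurable R
      (Eventually.of_forall hfR))
    (MemLp.of_bound (hg.mono (hZ.sigmaOf_le _) le_rfl).aestronglyMeasurable R
      (Eventually.of_forall hgR))

/-- Variables more than `m` apart are independent, so each index has at most `2 * m + 1` nonzero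
covariances. One weight of each pair is summed to `D`, the other is bounded by `c`. -/
lemma variance_weighted_sum_le [IsProbabilityMeasure μ] {Z : ℤ → S → ℝ} (hZ : IsInnovation μ Z)
    {m : ℕ} {R : ℝ} (hR : 0 ≤ R) {U : ℕ → S → ℝ}
    (hU : ∀ k : ℕ, Measurable[sigmaOf Z (Icc ((k : ℤ) - m) k)] (U k))
    (hUR : ∀ k ω, |U k ω| ≤ R) (s : Finset ℕ) (w : ℕ → ℝ) {c D : ℝ} (hD : ∑ k ∈ s, |w k| ≤ D)
    (hc : ∀ k ∈ s, |w k| ≤ c) (hc0 : 0 ≤ c) :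
    Var[fun ω => ∑ k ∈ s, w k * U k ω; μ] ≤ D * ((2 * m + 1) * (c * (2 * R ^ 2))) := by
  have hm : ∀ k, AEStronglyMeasurable (U k) μ := fun k =>
    ((hU k).mono (hZ.sigmaOf_le _) le_rfl).aestronglyMeasurable
  have hL : ∀ k, MemLp (U k) 2 μ := fun k =>
    MemLp.of_bound (hm k) R (Eventually.of_forall (hUR k))
  rw [variance_fun_sum' fun k _ => (hL k).const_mul (w k)]
  have key : ∀ k ∈ s, ∑ l ∈ s, cov[fun ω => w k * U k ω, fun ω => w l * U l ω; μ] ≤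
      |w k| * ((2 * m + 1) * (c * (2 * R ^ 2))) := by
    intro k _
    have h1 : ∀ l ∈ s, cov[fun ω => w k * U k ω, fun ω => w l * U l ω; μ] ≤
        -- The truncated subtraction `k - m` loses nothing, since `l` is a natural number.
        if l ∈ Finset.Icc (k - m) (k + m) then |w k| * (c * (2 * R ^ 2)) else 0 := by
      intro l hl
      rw [covariance_const_mul_left, covariance_const_mul_right]
      split_ifs with h
      · refine (le_abs_self _).trans ?_
        rw [abs_mul, abs_mul]
        gcongr
        · exact hc l hl
        · exact abs_covariance_le_of_bound hR (hm k) (hm l) (hUR k) (hUR l)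
      · rw [hZ.covariance_eq_zero ?_ (hU k) (hU l) (hUR k) (hUR l), mul_zero, mul_zero]
        rw [Set.disjoint_left]
        rintro x ⟨hx1, hx2⟩ ⟨hx3, hx4⟩
        refine h (Finset.mem_Icc.2 ⟨by omega, by omega⟩)
    refine (Finset.sum_le_sum h1).trans ?_
    rw [← Finset.sum_filter, Finset.sum_const, nsmul_eq_mul]
    have h2 : ((s.filter fun l => l ∈ Finset.Icc (k - m) (k + m)).card : ℝ) ≤ 2 * m + 1 := by
      have h3 : (s.filter fun l => l ∈ Finset.Icc (k - m) (k + m)).card ≤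
          (Finset.Icc (k - m) (k + m)).card :=
        Finset.card_le_card fun l hl => (Finset.mem_filter.1 hl).2
      rw [Nat.card_Icc] at h3
      have h4 : k + m + 1 - (k - m) ≤ 2 * m + 1 := by omega
      exact_mod_cast h3.trans h4
    calc _ ≤ (2 * m + 1) * (|w k| * (c * (2 * R ^ 2))) := by gcongr
      _ = _ := by ring
  refine (Finset.sum_le_sum key).trans ?_
  rw [← Finset.sum_mul]
  gcongr

/-- Pointwise x ≤ η + x²/η for x ≥ 0, so no square root of the variance is needed. -/
lemma integral_abs_sub_le_of_variance [IsProbabilityMeasure μ] {f : S → ℝ} (hf : MemLp f 2 μ)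
    {η : ℝ} (hη : 0 < η) : ∫ ω, |f ω - ∫ x, f x ∂μ| ∂μ ≤ η + Var[f; μ] / η := by
  have h2 : MemLp (fun ω => f ω - ∫ x, f x ∂μ) 2 μ := hf.sub (memLp_const _)
  rw [variance_eq_integral hf.aestronglyMeasurable.aemeasurable, ← integral_div]
  have hi : Integrable (fun ω => (f ω - ∫ x, f x ∂μ) ^ 2 / η) μ := h2.integrable_sq.div_const η
  have h1 : ∫ ω, (η + (f ω - ∫ x, f x ∂μ) ^ 2 / η) ∂μ =
      η + ∫ ω, (f ω - ∫ x, f x ∂μ) ^ 2 / η ∂μ := by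
    rw [integral_add (integrable_const _) hi]; simp
  rw [← h1]
  refine integral_mono_ae (h2.integrable (by norm_num)).abs ((integrable_const _).add hi)
    (Eventually.of_forall fun ω => ?_)
  dsimp only [Pi.add_apply]
  rw [← sq_abs]
  set x := |f ω - ∫ x, f x ∂μ|
  have hx : 0 ≤ x := abs_nonneg _
  have h3 : η + x ^ 2 / η - x = (η ^ 2 + x ^ 2 - η * x) / η := by field_simp
  have h4 : 0 ≤ (η ^ 2 + x ^ 2 - η * x) / η := by
    apply div_nonneg _ hη.le
    nlinarith [sq_nonneg (η - x)]
  linarith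

/-- Weighted averages of a sequence that is approximable in mean by bounded functions of finitely
many innovations concentrate in mean. -/
theorem tendsto_integral_abs_weighted_sum [IsProbabilityMeasure μ] {Z : ℤ → S → ℝ}
    (hZ : IsInnovation μ Z) {U : ℕ → S → ℝ} (hU : ∀ k, Integrable (U k) μ)
    (happ : ∀ ε > 0, ∃ (m : ℕ) (R : ℝ) (U' : ℕ → S → ℝ), 0 ≤ R ∧
      (∀ k : ℕ, Measurable[sigmaOf Z (Icc ((k : ℤ) - m) k)] (U' k)) ∧ (∀ k ω, |U' k ω| ≤ R) ∧
      ∀ k, ∫ ω, |U k ω - U' k ω| ∂μ ≤ ε)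
    {s : ℕ → Finset ℕ} {w : ℕ → ℕ → ℝ} {c : ℕ → ℝ} {D : ℝ} (hD0 : 0 ≤ D)
    (hD : ∀ᶠ N in atTop, ∑ k ∈ s N, |w N k| ≤ D) (hwc : ∀ᶠ N in atTop, ∀ k ∈ s N, |w N k| ≤ c N)
    (hc0 : ∀ᶠ N in atTop, 0 ≤ c N) (hc : Tendsto c atTop (𝓝 0)) :
    Tendsto (fun N => ∫ ω, |∑ k ∈ s N, w N k * (U k ω - ∫ x, U k x ∂μ)| ∂μ) atTop (𝓝 0) := by
  rw [Metric.tendsto_nhds]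
  intro ε hε
  -- Replacing both the variables and their means costs 2ε/(8(D+1)) per unit of weight, at most ε/4
  -- in total. The centred sum contributes ε/4 plus its variance over ε/4.
  obtain ⟨m, R, U', hR, hm, hUR, hclose⟩ := happ (ε / (8 * (D + 1))) (by positivity)
  have hU' : ∀ k, Integrable (U' k) μ := fun k => Integrable.of_bound
    ((hm k).mono (hZ.sigmaOf_le _) le_rfl).aestronglyMeasurable R (Eventually.of_forall (hUR k))
  have hcv : Tendsto (fun N => D * ((2 * m + 1) * (c N * (2 * R ^ 2))) / (ε / 4)) atTop (𝓝 0) := by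
    simpa using ((((hc.mul_const (2 * R ^ 2)).const_mul (2 * m + 1 : ℝ)).const_mul D).div_const
      (ε / 4))
  filter_upwards [hD, hwc, hc0, hcv.eventually (gt_mem_nhds (show 0 < ε / 4 by positivity))]
    with N hN1 hN2 hN3 hN4
  rw [Real.dist_eq, sub_zero, abs_of_nonneg (integral_nonneg fun ω => abs_nonneg _)]
  have hL : MemLp (fun ω => ∑ k ∈ s N, w N k * U' k ω) 2 μ :=
    memLp_finsetSum _ fun k _ => MemLp.const_mul (MemLp.of_bound (hU' k).aestronglyMeasurable R
      (Eventually.of_forall (hUR k))) _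
  have h1 := integral_abs_sub_le_of_variance hL (show 0 < ε / 4 by positivity)
  have h2 : Var[fun ω => ∑ k ∈ s N, w N k * U' k ω; μ] / (ε / 4) ≤
      D * ((2 * m + 1) * (c N * (2 * R ^ 2))) / (ε / 4) := by
    gcongr
    exact variance_weighted_sum_le hZ hR hm hUR (s N) (w N) hN1 hN2 hN3
  have hEsum : ∫ ω, ∑ k ∈ s N, w N k * U' k ω ∂μ = ∑ k ∈ s N, w N k * ∫ x, U' k x ∂μ := by
    rw [integral_finsetSum _ fun k _ => (hU' k).const_mul _]
    simp only [integral_const_mul]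
  rw [hEsum] at h1
  have hd : ∀ k, Integrable (fun ω => |U k ω - U' k ω|) μ := fun k => ((hU k).sub (hU' k)).abs
  have hEd : ∀ k, |∫ x, U k x ∂μ - ∫ x, U' k x ∂μ| ≤ ε / (8 * (D + 1)) := fun k => by
    rw [← integral_sub (hU k) (hU' k)]
    exact (abs_integral_le_integral_abs).trans (hclose k)
  have hpt : ∀ ω, |∑ k ∈ s N, w N k * (U k ω - ∫ x, U k x ∂μ)| ≤
      |∑ k ∈ s N, w N k * U' k ω - ∑ k ∈ s N, w N k * ∫ x, U' k x ∂μ| +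
        ∑ k ∈ s N, |w N k| * (|U k ω - U' k ω| + ε / (8 * (D + 1))) := fun ω => by
    have e : ∑ k ∈ s N, w N k * (U k ω - ∫ x, U k x ∂μ) =
        (∑ k ∈ s N, w N k * U' k ω - ∑ k ∈ s N, w N k * ∫ x, U' k x ∂μ) +
        ∑ k ∈ s N, w N k * ((U k ω - U' k ω) - (∫ x, U k x ∂μ - ∫ x, U' k x ∂μ)) := by
      rw [← Finset.sum_sub_distrib, ← Finset.sum_add_distrib]
      exact Finset.sum_congr rfl fun k _ => by ring
    rw [e]
    refine (abs_add_le _ _).trans (add_le_add le_rfl ((Finset.abs_sum_le_sum_abs _ _).trans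
      (Finset.sum_le_sum fun k _ => ?_)))
    rw [abs_mul]
    gcongr
    exact (abs_sub _ _).trans (add_le_add le_rfl (hEd k))
  have hi1 : Integrable (fun ω =>
      |∑ k ∈ s N, w N k * U' k ω - ∑ k ∈ s N, w N k * ∫ x, U' k x ∂μ|) μ :=
    ((hL.integrable (by norm_num)).sub (integrable_const _)).abs
  have hi2 : ∀ k ∈ s N, Integrable (fun ω =>
      |w N k| * (|U k ω - U' k ω| + ε / (8 * (D + 1)))) μ := fun k _ =>
    ((hd k).add (integrable_const _)).const_mul _
  have hi0 : Integrable (fun ω => |∑ k ∈ s N, w N k * (U k ω - ∫ x, U k x ∂μ)|) μ :=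
    (integrable_finsetSum _ fun k _ =>
      ((hU k).sub (integrable_const _)).const_mul (w N k)).abs
  have h3 : ∑ k ∈ s N, ∫ ω, |w N k| * (|U k ω - U' k ω| + ε / (8 * (D + 1))) ∂μ ≤ ε / 4 := by
    calc _ ≤ ∑ k ∈ s N, |w N k| * (2 * (ε / (8 * (D + 1)))) := by
          refine Finset.sum_le_sum fun k _ => ?_
          rw [integral_const_mul, integral_add (hd k) (integrable_const _)]
          gcongr
          have := hclose k
          simp only [integral_const, probReal_univ, one_smul]
          linarith
      _ = (∑ k ∈ s N, |w N k|) * (2 * (ε / (8 * (D + 1)))) := by rw [Finset.sum_mul]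
      _ ≤ (D + 1) * (2 * (ε / (8 * (D + 1)))) := by gcongr; linarith
      _ = ε / 4 := by field_simp; ring
  calc _ ≤ ∫ ω, (|∑ k ∈ s N, w N k * U' k ω - ∑ k ∈ s N, w N k * ∫ x, U' k x ∂μ| +
        ∑ k ∈ s N, |w N k| * (|U k ω - U' k ω| + ε / (8 * (D + 1)))) ∂μ :=
        integral_mono hi0 (hi1.add (integrable_finsetSum _ hi2)) hpt
    _ = ∫ ω, |∑ k ∈ s N, w N k * U' k ω - ∑ k ∈ s N, w N k * ∫ x, U' k x ∂μ| ∂μ +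
        ∑ k ∈ s N, ∫ ω, |w N k| * (|U k ω - U' k ω| + ε / (8 * (D + 1))) ∂μ := by
        rw [integral_add hi1 (integrable_finsetSum _ hi2), integral_finsetSum _ hi2]
    _ < ε := by linarith

/-! ### Truncation -/

/-- Truncation to `[-R, R]`. -/
def clip (R x : ℝ) : ℝ := max (-R) (min R x)

lemma abs_clip_le {R : ℝ} (hR : 0 ≤ R) (x : ℝ) : |clip R x| ≤ R :=
  abs_le.2 ⟨le_max_left _ _, max_le (by linarith) (min_le_left _ _)⟩

lemma abs_clip_sub_clip_le (R x y : ℝ) : |clip R x - clip R y| ≤ |x - y| := by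
  refine (abs_max_sub_max_le_max _ _ _ _).trans ?_
  rw [sub_self, abs_zero]
  refine max_le (abs_nonneg _) ((abs_min_sub_min_le_max _ _ _ _).trans ?_)
  simp

lemma clip_eq_self {R x : ℝ} (h : |x| ≤ R) : clip R x = x := by
  rw [clip, min_eq_right (abs_le.1 h).2, max_eq_right (abs_le.1 h).1]

lemma measurable_clip (R : ℝ) : Measurable (clip R) :=
  measurable_const.max (measurable_const.min measurable_id)

lemma tendsto_integral_abs_sub_clip {f : S → ℝ} (hf : Integrable f μ) :
    Tendsto (fun n : ℕ => ∫ ω, |f ω - clip n (f ω)| ∂μ) atTop (𝓝 0) := by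
  rw [show 𝓝 (0 : ℝ) = 𝓝 (∫ _ : S, (0 : ℝ) ∂μ) by simp]
  refine tendsto_integral_of_dominated_convergence (fun ω => |f ω|) (fun n => ?_) hf.abs
    (fun n => Eventually.of_forall fun ω => ?_) (Eventually.of_forall fun ω => ?_)
  · exact (hf.aestronglyMeasurable.sub
      ((measurable_clip n).comp_aemeasurable hf.aemeasurable).aestronglyMeasurable).norm
  · rw [Real.norm_eq_abs, abs_abs]
    by_cases h : |f ω| ≤ n
    · rw [clip_eq_self h, sub_self, abs_zero]; exact abs_nonneg _
    · have hn : (0 : ℝ) ≤ n := Nat.cast_nonneg n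
      rw [not_le, lt_abs] at h
      rcases h with h | h
      · rw [clip, min_eq_left h.le, max_eq_right (by linarith), abs_of_pos (by linarith),
          abs_of_pos (by linarith)]
        linarith
      · rw [clip, min_eq_right (by linarith), max_eq_left (by linarith), abs_of_neg (by linarith),
          abs_of_neg (by linarith)]
        linarith
  · obtain ⟨n, hn⟩ := exists_nat_ge |f ω|
    refine tendsto_const_nhds.congr' ?_
    filter_upwards [eventually_ge_atTop n] with k hk
    rw [clip_eq_self (hn.trans (by exact_mod_cast hk)), sub_self, abs_zero]

lemma integrable_tail {f : S → ℝ} (hf : Integrable f μ) (T : ℝ) :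
    Integrable (fun ω => if T < f ω then f ω else 0) μ := by
  refine Integrable.mono hf ?_ (Eventually.of_forall fun ω => ?_)
  · have hm : Measurable fun x : ℝ => if T < x then x else 0 :=
      Measurable.ite measurableSet_Ioi measurable_id measurable_const
    exact (hm.comp_aemeasurable hf.aemeasurable).aestronglyMeasurable
  · split_ifs <;> simp

lemma tendsto_integral_tail {f : S → ℝ} (hf : Integrable f μ) :
    Tendsto (fun n : ℕ => ∫ ω, (if (n : ℝ) < f ω then f ω else 0) ∂μ) atTop (𝓝 0) := by
  rw [show 𝓝 (0 : ℝ) = 𝓝 (∫ _ : S, (0 : ℝ) ∂μ) by simp]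
  refine tendsto_integral_of_dominated_convergence (fun ω => |f ω|)
    (fun n => (integrable_tail hf n).aestronglyMeasurable) hf.abs
    (fun n => Eventually.of_forall fun ω => ?_) (Eventually.of_forall fun ω => ?_)
  · split_ifs <;> simp
  · obtain ⟨n, hn⟩ := exists_nat_ge (f ω)
    refine tendsto_const_nhds.congr' ?_
    filter_upwards [eventually_ge_atTop n] with k hk
    have : ¬ (k : ℝ) < f ω := not_lt.2 (hn.trans (by exact_mod_cast hk))
    rw [if_neg this]

end TVARCH

namespace TVARCH

variable {p : ℕ} {S : Type*} [MeasurableSpace S] {μ : Measure S}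

/-! ### Uniform convergence in mean -/

/-- `sup_{α ∈ K} ‖F_N(α) - G(α)‖` has integrable upper bounds whose means tend to zero. -/
def UnifTendstoInMean {V E : Type*} [NormedAddCommGroup E] (μ : Measure S) (K : Set V)
    (F : ℕ → S → V → E) (G : V → E) : Prop :=
  ∀ η : ℝ, 0 < η → ∀ᶠ N in atTop, ∃ h : S → ℝ, Integrable h μ ∧ (∀ ω, 0 ≤ h ω) ∧
    (∀ᵐ ω ∂μ, ∀ α ∈ K, ‖F N ω α - G α‖ ≤ h ω) ∧ ∫ ω, h ω ∂μ ≤ η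

lemma ennreal_edist_zero (x : ENNReal) : edist x 0 = x := by
  induction x with
  | top => rfl
  | coe a =>
    change edist a (0 : NNReal) = a
    rw [edist_nndist, NNReal.nndist_zero_eq_val']

/-- Markov's inequality is applied to the majorant, so the supremum over the parameters need not be
measurable. -/
lemma UnifTendstoInMean.unifTendstoInProb {V E : Type*} [NormedAddCommGroup E] {K : Set V}
    {F : ℕ → S → V → E} {G : V → E} (hF : UnifTendstoInMean μ K F G) :
    UnifTendstoInProb μ K F G := by
  intro ε hε
  rw [ENNReal.tendsto_nhds_zero]
  intro δ hδ
  -- The levels `ε` and `δ` may be infinite; capping them at 1 keeps their product finite.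
  have hε'0 : 0 < min ε 1 := lt_min hε one_pos
  have hε't : min ε 1 ≠ ⊤ := ((min_le_right _ _).trans_lt ENNReal.one_lt_top).ne
  have hδ'0 : 0 < min δ 1 := lt_min hδ one_pos
  have hδ't : min δ 1 ≠ ⊤ := ((min_le_right _ _).trans_lt ENNReal.one_lt_top).ne
  have hpt : min δ 1 * min ε 1 ≠ ⊤ := ENNReal.mul_ne_top hδ't hε't
  have hη : 0 < (min δ 1 * min ε 1).toReal :=
    ENNReal.toReal_pos (mul_ne_zero hδ'0.ne' hε'0.ne') hpt
  filter_upwards [hF _ hη] with N ⟨h, hi, h0, hle, hint⟩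
  calc _ ≤ μ {ω | min ε 1 ≤ ENNReal.ofReal (h ω)} := by
        refine measure_mono_ae ?_
        filter_upwards [hle] with ω hω (hlt : ε ≤ edist _ _)
        have h1 : (⨆ α ∈ K, ‖F N ω α - G α‖ₑ) ≤ ENNReal.ofReal (h ω) :=
          iSup₂_le fun α hα => by
            rw [← ofReal_norm]
            exact ENNReal.ofReal_le_ofReal (hω α hα)
        have h2 : edist (⨆ α ∈ K, ‖F N ω α - G α‖ₑ) 0 = ⨆ α ∈ K, ‖F N ω α - G α‖ₑ := by
          exact ennreal_edist_zero _
        exact (min_le_left _ _).trans (hlt.trans (h2.le.trans h1))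
    _ ≤ (∫⁻ ω, ENNReal.ofReal (h ω) ∂μ) / min ε 1 :=
        meas_ge_le_lintegral_div hi.aestronglyMeasurable.aemeasurable.ennreal_ofReal hε'0.ne' hε't
    _ ≤ (min δ 1 * min ε 1) / min ε 1 := by
        gcongr
        rw [← ofReal_integral_eq_lintegral_ofReal hi (Eventually.of_forall h0)]
        exact (ENNReal.ofReal_le_ofReal hint).trans (ENNReal.ofReal_toReal hpt).le
    _ ≤ δ := by
        rw [ENNReal.mul_div_cancel_right hε'0.ne' hε't]
        exact min_le_left _ _

lemma UnifTendstoInMean.congr {V E : Type*} [NormedAddCommGroup E] {K : Set V}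
    {F F' : ℕ → S → V → E} {G G' : V → E} (hF : UnifTendstoInMean μ K F G)
    (h : ∀ N ω, ∀ α ∈ K, F N ω α = F' N ω α) (hG : ∀ α ∈ K, G α = G' α) :
    UnifTendstoInMean μ K F' G' := by
  intro η hη
  filter_upwards [hF η hη] with N ⟨f, hi, h0, hle, hint⟩
  refine ⟨f, hi, h0, ?_, hint⟩
  filter_upwards [hle] with ω hω α hα
  rw [← h N ω α hα, ← hG α hα]
  exact hω α hα

lemma UnifTendstoInMean.mono {V E : Type*} [NormedAddCommGroup E] {K K' : Set V}
    {F : ℕ → S → V → E} {G : V → E} (hF : UnifTendstoInMean μ K F G) (h : K' ⊆ K) :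
    UnifTendstoInMean μ K' F G := by
  intro η hη
  filter_upwards [hF η hη] with N ⟨f, hi, h0, hle, hint⟩
  exact ⟨f, hi, h0, hle.mono fun ω hω α hα => hω α (h hα), hint⟩

lemma UnifTendstoInMean.add {V E : Type*} [NormedAddCommGroup E] {K : Set V}
    {F F' : ℕ → S → V → E} {G G' : V → E} (hF : UnifTendstoInMean μ K F G)
    (hF' : UnifTendstoInMean μ K F' G') :
    UnifTendstoInMean μ K (fun N ω α => F N ω α + F' N ω α) (fun α => G α + G' α) := by
  intro η hη
  filter_upwards [hF _ (half_pos hη), hF' _ (half_pos hη)] with N ⟨f, hi, h0, hle, hint⟩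
    ⟨f', hi', h0', hle', hint'⟩
  refine ⟨fun ω => f ω + f' ω, hi.add hi', fun ω => add_nonneg (h0 ω) (h0' ω), ?_, ?_⟩
  · filter_upwards [hle, hle'] with ω hω hω' α hα
    rw [add_sub_add_comm]
    exact (norm_add_le _ _).trans (add_le_add (hω α hα) (hω' α hα))
  · rw [integral_add hi hi']; linarith

section Matrix

attribute [local instance] Matrix.normedAddCommGroup

lemma unifTendstoInMean_matrix {V : Type*} {n : ℕ} {K : Set V}
    {F : ℕ → S → V → Matrix (Fin n) (Fin n) ℝ} {G : V → Matrix (Fin n) (Fin n) ℝ}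
    (h : ∀ i j, UnifTendstoInMean μ K (fun N ω α => F N ω α i j) (fun α => G α i j)) :
    UnifTendstoInMean μ K F G := by
  intro η hη
  -- The entrywise majorants are added; the extra 1 in the denominator covers `n = 0`.
  have hη' : 0 < η / (n ^ 2 + 1) := by positivity
  filter_upwards [eventually_all.2 fun i => eventually_all.2 fun j => h i j _ hη'] with N hN
  choose f hi h0 hle hint using hN
  refine ⟨fun ω => ∑ i, ∑ j, f i j ω,
    integrable_finsetSum _ fun i _ => integrable_finsetSum _ fun j _ => hi i j,
    fun ω => Finset.sum_nonneg fun i _ => Finset.sum_nonneg fun j _ => h0 i j ω, ?_, ?_⟩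
  · filter_upwards [ae_all_iff.2 fun i => ae_all_iff.2 fun j => hle i j] with ω hω α hα
    have hs : ∀ i, 0 ≤ ∑ j, f i j ω := fun i => Finset.sum_nonneg fun j _ => h0 i j ω
    rw [Matrix.norm_le_iff (Finset.sum_nonneg fun i _ => hs i)]
    intro i j
    refine (hω i j α hα).trans ?_
    exact (Finset.single_le_sum (f := fun j => f i j ω) (fun j _ => h0 i j ω)
      (Finset.mem_univ j)).trans (Finset.single_le_sum (f := fun i => ∑ j, f i j ω)
        (fun i _ => hs i) (Finset.mem_univ i))
  · rw [integral_finsetSum _ fun i _ => integrable_finsetSum _ fun j _ => hi i j]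
    simp only [integral_finsetSum Finset.univ fun j _ => hi _ j]
    calc _ ≤ ∑ _i : Fin n, ∑ _j : Fin n, η / (n ^ 2 + 1) :=
          Finset.sum_le_sum fun i _ => Finset.sum_le_sum fun j _ => hint i j
      _ = n ^ 2 / (n ^ 2 + 1) * η := by simp; ring
      _ ≤ 1 * η := by
          gcongr
          rw [div_le_one (by positivity)]; linarith
      _ = η := one_mul η

end Matrix

/-! ### The stationary approximation -/

lemma IsStationaryARCH.identDistrib_lagSq {Z : ℤ → S → ℝ} {α : Param p} {Y : ℤ → S → ℝ}
    (hY : IsStationaryARCH μ Z α Y) (k : ℤ) :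
    IdentDistrib (fun ω => (lagSq (fun t => Y t ω) k : Fin (p + 1) → ℝ))
      (fun ω => lagSq (fun t => Y t ω) 0) μ μ := by
  have hm : Measurable fun x : ℤ → ℝ => (lagSq x 0 : Fin (p + 1) → ℝ) :=
    measurable_pi_lambda _ fun j => (measurable_pi_apply _).pow_const 2
  have := (hY.stationary k).comp hm
  have e : (fun ω => (lagSq (fun t => Y t ω) k : Fin (p + 1) → ℝ)) =
      (fun x : ℤ → ℝ => lagSq x 0) ∘ fun ω t => Y (t + k) ω := by
    funext ω j
    simp only [Function.comp, lagSq]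
    congr 2
    ring_nf
  rw [e]
  exact this

/-- Tame functions of the squared lags are approximable in mean by bounded functions of finitely
many innovations. -/
lemma IsStationaryARCH.exists_finite_range_approx [IsProbabilityMeasure μ] {Z : ℤ → S → ℝ}
    (hZ : IsInnovation μ Z) {α : Param p} {Y : ℤ → S → ℝ} (hY : IsStationaryARCH μ Z α Y)
    (hα : ∀ i, 0 ≤ α i) {ν : ℝ} (hν0 : 0 < ν) (hν1 : ν < 1)
    (hsum : ∑ j : Fin p, α j.succ ≤ 1 - ν) {K : Set (Param p)} {C : ℝ}
    {g : Param p → (Fin (p + 1) → ℝ) → ℝ} (hg : TameFamily K C g) {β : Param p} (hβ : β ∈ K)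
    {ε : ℝ} (hε : 0 < ε) :
    ∃ (m : ℕ) (R : ℝ) (U' : ℕ → S → ℝ), 0 ≤ R ∧
      (∀ k : ℕ, Measurable[sigmaOf Z (Icc ((k : ℤ) - m) k)] (U' k)) ∧ (∀ k ω, |U' k ω| ≤ R) ∧
      ∀ k : ℕ, ∫ ω, |g β (lagSq (fun t => Y t ω) k) - U' k ω| ∂μ ≤ ε := by
  have hV := hY.isSquaredARCH
  have hC := hg.nonneg
  have hVi := fun t => hV.integrable hZ hα hν0 hν1 hsum t
  have hvi : ∀ k : ℤ, Integrable (fun ω => (lagSq (fun t => Y t ω) k : Fin (p + 1) → ℝ)) μ :=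
    fun k => Integrable.of_eval fun j => hVi _
  have hgi : ∀ k : ℤ, Integrable (fun ω => g β (lagSq (fun t => Y t ω) k)) μ := fun k =>
    integrable_tame hg (hvi k) (fun ω => lagSq_nonneg _ _) hβ
  have hε3 : 0 < ε / 3 := by positivity
  -- Three errors of size ε/3: clipping at `R`, the tail beyond `T` from the tame bound, and the lag
  -- approximation. The order matters, as `m` is chosen for the Lipschitz constant `C * (1 + T)`.
  obtain ⟨R, hR⟩ := ((tendsto_integral_abs_sub_clip (hgi 0)).eventually (gt_mem_nhds hε3)).exists
  have htail : Tendsto (fun n : ℕ =>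
      C * ∫ ω, (if (n : ℝ) < Y 0 ω ^ 2 then Y 0 ω ^ 2 else 0) ∂μ) atTop (𝓝 0) := by
    simpa using (tendsto_integral_tail (hVi 0)).const_mul C
  obtain ⟨T, hT⟩ := (htail.eventually (gt_mem_nhds hε3)).exists
  obtain ⟨m, hm⟩ := hV.exists_archApprox_close hZ hα hν0 hν1 hsum
    (show 0 < ε / 3 / (C * (1 + T) * (p + 1) + 1) by positivity)
  -- The oldest lag is `k - p`, and `m` iterations look back another `p * m` steps; this gives the
  -- window length `p * m + p`.
  set v' : ℤ → S → Fin (p + 1) → ℝ := fun k ω j => archApprox α Z m (k - (j : ℕ)) ω with hv'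
  have hv'0 : ∀ k ω, 0 ≤ v' k ω := fun k ω j => archApprox_nonneg hα Z m _ ω
  have hmeas : ∀ k : ℤ, Measurable[sigmaOf Z (Icc (k - (p * m + p : ℕ)) k)] (v' k) := fun k =>
    @measurable_pi_lambda _ _ _ (sigmaOf Z (Icc (k - (p * m + p : ℕ)) k)) _ _ fun j =>
      (measurable_archApprox α Z m _).mono
      (sigmaOf_mono Z (Icc_subset_Icc (by have := j.2; push_cast; omega) (by omega))) le_rfl
  have hv'm : ∀ k, Measurable (v' k) := fun k => (hmeas k).mono (hZ.sigmaOf_le _) le_rfl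
  have hdi : ∀ (k : ℤ) (j : Fin (p + 1)), Integrable (fun ω =>
      |Y (k - (j : ℕ)) ω ^ 2 - archApprox α Z m (k - (j : ℕ)) ω|) μ := fun k j =>
    ((hVi _).sub (integrable_archApprox hZ hα hν0 hsum m _)).abs
  refine ⟨p * m + p, R, fun k ω => clip R (g β (v' k ω)), Nat.cast_nonneg R,
    fun k => (measurable_clip R).comp ((hg.measurable β).comp (hmeas k)),
    fun k ω => abs_clip_le (Nat.cast_nonneg R) _, fun k => ?_⟩
  have hpt : ∀ ω, |g β (lagSq (fun t => Y t ω) k) - clip R (g β (v' k ω))| ≤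
      |g β (lagSq (fun t => Y t ω) k) - clip R (g β (lagSq (fun t => Y t ω) k))| +
      (C * (1 + T) * ∑ j : Fin (p + 1),
        |Y ((k : ℤ) - (j : ℕ)) ω ^ 2 - archApprox α Z m ((k : ℤ) - (j : ℕ)) ω| +
        C * (if (T : ℝ) < Y k ω ^ 2 then Y k ω ^ 2 else 0)) := fun ω => by
    refine (abs_sub_le _ (clip R (g β (lagSq (fun t => Y t ω) k))) _).trans
      (add_le_add le_rfl ((abs_clip_sub_clip_le _ _ _).trans ?_))
    have h1 := hg.lag T (Nat.cast_nonneg T) β hβ (v' k ω) (lagSq (fun t => Y t ω) k) (hv'0 k ω)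
      (lagSq_nonneg _ _)
    rw [abs_sub_comm, norm_sub_rev] at h1
    have h2 : lagSq (p := p) (fun t => Y t ω) k 0 = Y k ω ^ 2 := by simp [lagSq]
    rw [h2] at h1
    refine h1.trans ?_
    gcongr
    refine (pi_norm_le_iff_of_nonneg (Finset.sum_nonneg fun j _ => abs_nonneg _)).2 fun j => ?_
    exact Finset.single_le_sum (f := fun j : Fin (p + 1) =>
      |Y ((k : ℤ) - (j : ℕ)) ω ^ 2 - archApprox α Z m ((k : ℤ) - (j : ℕ)) ω|)
      (fun j _ => abs_nonneg _) (Finset.mem_univ j)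
  have hclip : Measurable fun y => |g β y - clip R (g β y)| :=
    ((hg.measurable β).sub ((measurable_clip R).comp (hg.measurable β))).abs
  have hi1 : Integrable (fun ω =>
      |g β (lagSq (fun t => Y t ω) k) - clip R (g β (lagSq (fun t => Y t ω) k))|) μ :=
    ((hgi k).sub (Integrable.of_bound ((measurable_clip R).comp_aemeasurable
      (hgi k).aemeasurable).aestronglyMeasurable R
      (Eventually.of_forall fun ω => abs_clip_le (Nat.cast_nonneg R) _))).abs
  have hi2 := integrable_finsetSum (Finset.univ : Finset (Fin (p + 1))) fun j _ => hdi k j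
  have hi3 := integrable_tail (hVi k) T
  have e1 : ∫ ω, |g β (lagSq (fun t => Y t ω) k) - clip R (g β (lagSq (fun t => Y t ω) k))| ∂μ =
      ∫ ω, |g β (lagSq (fun t => Y t ω) 0) - clip R (g β (lagSq (fun t => Y t ω) 0))| ∂μ :=
    ((hY.identDistrib_lagSq k).comp hclip).integral_eq
  have e3 : ∫ ω, (if (T : ℝ) < Y k ω ^ 2 then Y k ω ^ 2 else 0) ∂μ =
      ∫ ω, (if (T : ℝ) < Y 0 ω ^ 2 then Y 0 ω ^ 2 else 0) ∂μ :=
    ((hV.identDistrib k).comp (u := fun x : ℝ => if (T : ℝ) < x then x else 0)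
      (Measurable.ite measurableSet_Ioi measurable_id measurable_const)).integral_eq
  have hrhs := hi1.add ((hi2.const_mul (C * (1 + T))).add (hi3.const_mul C))
  have hlhs : Integrable (fun ω => |g β (lagSq (fun t => Y t ω) k) - clip R (g β (v' k ω))|) μ :=
    ((hgi k).sub (Integrable.of_bound ((measurable_clip R).comp
      ((hg.measurable β).comp (hv'm k))).aestronglyMeasurable R
      (Eventually.of_forall fun ω => abs_clip_le (Nat.cast_nonneg R) _))).abs
  refine (integral_mono hlhs hrhs hpt).trans ?_
  have e4 := integral_add hi1 ((hi2.const_mul (C * (1 + T))).add (hi3.const_mul C))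
  have e5 := integral_add (hi2.const_mul (C * (1 + T))) (hi3.const_mul C)
  simp only [Pi.add_apply] at e4 e5 ⊢
  rw [e4, e5, integral_const_mul, integral_const_mul, e1, e3,
    integral_finsetSum _ fun j _ => hdi k j]
  have h6 : C * (1 + T) * ∑ j : Fin (p + 1),
      ∫ ω, |Y ((k : ℤ) - (j : ℕ)) ω ^ 2 - archApprox α Z m ((k : ℤ) - (j : ℕ)) ω| ∂μ ≤ ε / 3 := by
    calc _ ≤ C * (1 + T) * ∑ _j : Fin (p + 1), ε / 3 / (C * (1 + T) * (p + 1) + 1) := by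
          gcongr with j
          exact hm _
      _ = (C * (1 + T) * (p + 1)) / (C * (1 + T) * (p + 1) + 1) * (ε / 3) := by
          simp; ring
      _ ≤ 1 * (ε / 3) := by
          gcongr
          rw [div_le_one (by positivity)]; linarith
      _ = ε / 3 := one_mul _
  linarith

end TVARCH

namespace TVARCH

variable {p : ℕ} {S : Type*} [MeasurableSpace S] {μ : Measure S}

/-! ### Uniform limit theorems for tame families -/

lemma isCompact_box (p : ℕ) (δ R : ℝ) : IsCompact (box p δ R) := by
  have : box p δ R = Icc (fun _ => δ) (fun _ => R) := by
    ext α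
    simp only [box, mem_ofPred_eq, mem_Icc, Pi.le_def, forall_and]
  rw [this]
  exact isCompact_Icc

/-- Since `u₀` is interior and `b` tends to zero, the kernel window stays a fixed fraction of `N`
away from both ends. In particular the summation range p+1, …, N eventually cuts nothing off. -/
lemma eventually_window {u₀ : ℝ} (hu₀ : u₀ ∈ Ioo (0 : ℝ) 1) {t₀ : ℕ → ℕ}
    (ht₀ : ∀ᶠ N : ℕ in atTop, |u₀ - (t₀ N : ℝ) / N| < 1 / N) {b : ℕ → ℝ}
    (hb : Tendsto b atTop (𝓝 0)) (n : ℕ) :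
    ∀ᶠ N : ℕ in atTop, ∀ y : ℝ, |(t₀ N : ℝ) - y| ≤ b N * N → n ≤ y ∧ y ≤ N := by
  set d := min u₀ (1 - u₀) / 2 with hd
  have hd0 : 0 < d := half_pos (lt_min hu₀.1 (by linarith [hu₀.2]))
  have h1 : 2 * d ≤ u₀ := by rw [hd]; linarith [min_le_left u₀ (1 - u₀)]
  have h2 : 2 * d ≤ 1 - u₀ := by rw [hd]; linarith [min_le_right u₀ (1 - u₀)]
  filter_upwards [ht₀, hb.eventually (gt_mem_nhds hd0), eventually_gt_atTop 0,
    (tendsto_natCast_atTop_atTop.const_mul_atTop hd0).eventually_ge_atTop ((n : ℝ) + 1)]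
    with N hN1 hN2 hN3 hN4 y hy
  have hN : (0 : ℝ) < N := by exact_mod_cast hN3
  have h3 : |u₀ * N - t₀ N| < 1 := by
    have e : u₀ * N - t₀ N = (u₀ - (t₀ N : ℝ) / N) * N := by field_simp
    rw [e, abs_mul, abs_of_pos hN]
    calc _ < 1 / (N : ℝ) * N := by gcongr
      _ = 1 := by field_simp
  rw [abs_lt] at h3
  rw [abs_le] at hy
  have h4 : b N * N ≤ d * N := by gcongr
  have h5 : 2 * d * N ≤ u₀ * N := by gcongr
  have h6 : 2 * d * N ≤ (1 - u₀) * N := by gcongr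
  constructor <;> linarith [hy.1, hy.2, h3.1, h3.2]

/-- The uniform law of large numbers for tame families of the stationary process. -/
theorem IsStationaryARCH.unifTendstoInMean_sum [IsProbabilityMeasure μ] {Z : ℤ → S → ℝ}
    (hZ : IsInnovation μ Z) {α₀ : Param p} {Y : ℤ → S → ℝ} (hY : IsStationaryARCH μ Z α₀ Y)
    (hα₀ : ∀ i, 0 ≤ α₀ i) {ν : ℝ} (hν0 : 0 < ν) (hν1 : ν < 1)
    (hsum : ∑ j : Fin p, α₀ j.succ ≤ 1 - ν) {K : Set (Param p)} (hK : IsCompact K) {C : ℝ}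
    {g : Param p → (Fin (p + 1) → ℝ) → ℝ} (hg : TameFamily K C g)
    {s : ℕ → Finset ℕ} {w : ℕ → ℕ → ℝ} {c : ℕ → ℝ} {D : ℝ} (hD0 : 0 ≤ D)
    (hD : ∀ᶠ N in atTop, ∑ k ∈ s N, |w N k| ≤ D) (hwc : ∀ᶠ N in atTop, ∀ k ∈ s N, |w N k| ≤ c N)
    (hc0 : ∀ᶠ N in atTop, 0 ≤ c N) (hc : Tendsto c atTop (𝓝 0))
    (hw1 : Tendsto (fun N => ∑ k ∈ s N, w N k) atTop (𝓝 1)) :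
    UnifTendstoInMean μ K (fun N ω α => ∑ k ∈ s N, w N k * g α (lagSq (fun t => Y t ω) k))
      (fun α => ∫ ω, g α (lagSq (fun t => Y t ω) 0) ∂μ) := by
  intro η hη
  have hC := hg.nonneg
  have hV := hY.isSquaredARCH
  have hvi : ∀ k : ℤ, Integrable (fun ω => (lagSq (fun t => Y t ω) k : Fin (p + 1) → ℝ)) μ :=
    fun k => Integrable.of_eval fun j => hV.integrable hZ hα₀ hν0 hν1 hsum _
  have hni : ∀ k : ℤ, Integrable
      (fun ω => 1 + ‖(lagSq (fun t => Y t ω) k : Fin (p + 1) → ℝ)‖) μ := fun k =>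
    (integrable_const _).add (hvi k).norm
  have hgi : ∀ α ∈ K, ∀ k : ℤ, Integrable (fun ω => g α (lagSq (fun t => Y t ω) k)) μ :=
    fun α hα k => integrable_tame hg (hvi k) (fun ω => lagSq_nonneg _ _) hα
  set M := ∫ ω, (1 + ‖(lagSq (fun t => Y t ω) 0 : Fin (p + 1) → ℝ)‖) ∂μ with hM
  have hM0 : 0 ≤ M := integral_nonneg fun ω => by positivity
  have hMk : ∀ k : ℤ, ∫ ω, (1 + ‖(lagSq (fun t => Y t ω) k : Fin (p + 1) → ℝ)‖) ∂μ = M :=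
    fun k => ((hY.identDistrib_lagSq k).comp
      (u := fun y : Fin (p + 1) → ℝ => 1 + ‖y‖) (by fun_prop)).integral_eq
  have hgk : ∀ α (k : ℕ), ∫ ω, g α (lagSq (fun t => Y t ω) k) ∂μ =
      ∫ ω, g α (lagSq (fun t => Y t ω) 0) ∂μ := fun α k =>
    ((hY.identDistrib_lagSq k).comp (hg.measurable α)).integral_eq
  -- The mesh of the net: moving α to the nearest net point costs at most C e (D M + M) in mean,
  -- which this choice makes at most η/2.
  set e := η / (2 * (C * (D + 1) * M + 1)) with he
  have he0 : 0 < e := by positivity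
  obtain ⟨net, hnetK, hnetf, hnet⟩ := hK.finite_cover_balls he0
  set net' := hnetf.toFinset with hnet'
  have hmem : ∀ β ∈ net', β ∈ K := fun β hβ => hnetK (by simpa [hnet'] using hβ)
  set G := fun α => ∫ ω, g α (lagSq (fun t => Y t ω) 0) ∂μ with hG
  have hlim : Tendsto (fun N => ∑ β ∈ net',
      (∫ ω, |∑ k ∈ s N, w N k * (g β (lagSq (fun t => Y t ω) k) - G β)| ∂μ +
        |∑ k ∈ s N, w N k - 1| * |G β|)) atTop (𝓝 0) := by
    rw [← Finset.sum_const_zero (s := net')]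
    refine tendsto_finsetSum _ fun β hβ => ?_
    have h1 := tendsto_integral_abs_weighted_sum hZ
      (U := fun k : ℕ => fun ω => g β (lagSq (fun t => Y t ω) k))
      (fun k => hgi β (hmem β hβ) k)
      (fun ε hε => hY.exists_finite_range_approx hZ hα₀ hν0 hν1 hsum hg (hmem β hβ) hε)
      hD0 hD hwc hc0 hc
    simp only [hgk] at h1
    have h2 : Tendsto (fun N => |∑ k ∈ s N, w N k - 1| * |G β|) atTop (𝓝 0) := by
      have := ((hw1.sub_const 1).abs).mul_const |G β|
      simpa using this
    simpa using h1.add h2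
  filter_upwards [hD, hlim.eventually (gt_mem_nhds (half_pos hη))] with N hN1 hN2
  have hI1 : ∀ k ∈ s N, Integrable
      (fun ω => |w N k| * (1 + ‖(lagSq (fun t => Y t ω) k : Fin (p + 1) → ℝ)‖)) μ :=
    fun k _ => (hni k).const_mul _
  have hI2 : ∀ β ∈ net', Integrable (fun ω =>
      |∑ k ∈ s N, w N k * (g β (lagSq (fun t => Y t ω) k) - G β)| +
        |∑ k ∈ s N, w N k - 1| * |G β|) μ := fun β hβ =>
    (integrable_finsetSum _ fun (k : ℕ) _ =>
      ((hgi β (hmem β hβ) k).sub (integrable_const _)).const_mul (w N k)).abs.add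
        (integrable_const _)
  refine ⟨fun ω => C * e * (∑ k ∈ s N,
      |w N k| * (1 + ‖(lagSq (fun t => Y t ω) k : Fin (p + 1) → ℝ)‖) + M) +
      ∑ β ∈ net', (|∑ k ∈ s N, w N k * (g β (lagSq (fun t => Y t ω) k) - G β)| +
        |∑ k ∈ s N, w N k - 1| * |G β|), ?_, fun ω => by positivity, ?_, ?_⟩
  · exact (((integrable_finsetSum _ hI1).add (integrable_const M)).const_mul _).add
      (integrable_finsetSum _ hI2)
  · refine Eventually.of_forall fun ω α hα => ?_
    obtain ⟨β, hβ, hαβ⟩ := mem_iUnion₂.1 (hnet hα)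
    have hβ' : β ∈ net' := by simpa [hnet'] using hβ
    have hβK := hmem β hβ'
    rw [Metric.mem_ball, dist_eq_norm] at hαβ
    -- Discretization error at α against the net point β, fluctuation of the centred sum at β, and
    -- the defect of the total weight from 1.
    have e1 : ∑ k ∈ s N, w N k * g α (lagSq (fun t => Y t ω) k) - G α =
        (∑ k ∈ s N, w N k * (g α (lagSq (fun t => Y t ω) k) - g β (lagSq (fun t => Y t ω) k)) +
          (G β - G α)) +
        (∑ k ∈ s N, w N k * (g β (lagSq (fun t => Y t ω) k) - G β) +
          (∑ k ∈ s N, w N k - 1) * G β) := by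
      simp only [mul_sub, Finset.sum_sub_distrib, ← Finset.sum_mul]
      ring
    have h1 : |∑ k ∈ s N, w N k * (g α (lagSq (fun t => Y t ω) k) -
        g β (lagSq (fun t => Y t ω) k))| ≤ C * e * ∑ k ∈ s N,
        |w N k| * (1 + ‖(lagSq (fun t => Y t ω) k : Fin (p + 1) → ℝ)‖) := by
      refine (Finset.abs_sum_le_sum_abs _ _).trans ?_
      rw [Finset.mul_sum]
      refine Finset.sum_le_sum fun k _ => ?_
      rw [abs_mul, mul_left_comm]
      gcongr
      refine (hg.param α hα β hβK _ (lagSq_nonneg _ _)).trans ?_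
      gcongr
    have h2 : |G β - G α| ≤ C * e * M := by
      rw [hG, ← integral_sub (hgi β hβK 0) (hgi α hα 0)]
      refine abs_integral_le_integral_abs.trans ?_
      rw [hM, ← integral_const_mul]
      refine integral_mono ((hgi β hβK 0).sub (hgi α hα 0)).abs ((hni 0).const_mul _) fun ω => ?_
      dsimp only [Pi.sub_apply]
      rw [abs_sub_comm]
      refine (hg.param α hα β hβK _ (lagSq_nonneg _ _)).trans ?_
      gcongr
    have h3 := Finset.single_le_sum (f := fun β =>
      |∑ k ∈ s N, w N k * (g β (lagSq (fun t => Y t ω) k) - G β)| +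
        |∑ k ∈ s N, w N k - 1| * |G β|) (fun β _ => by positivity) hβ'
    dsimp only
    rw [e1, Real.norm_eq_abs, mul_add]
    refine (abs_add_le _ _).trans (add_le_add ((abs_add_le _ _).trans (add_le_add h1 h2))
      (le_trans ?_ h3))
    refine (abs_add_le _ _).trans ?_
    rw [abs_mul]
  · have hI3 : Integrable (fun ω => C * e * (∑ k ∈ s N,
        |w N k| * (1 + ‖(lagSq (fun t => Y t ω) k : Fin (p + 1) → ℝ)‖) + M)) μ :=
      ((integrable_finsetSum _ hI1).add (integrable_const M)).const_mul _
    rw [integral_add hI3 (integrable_finsetSum _ hI2), integral_const_mul,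
      integral_add (integrable_finsetSum _ hI1) (integrable_const M), integral_finsetSum _ hI1,
      integral_finsetSum _ hI2]
    have h1 : ∑ k ∈ s N, ∫ ω, |w N k| *
        (1 + ‖(lagSq (fun t => Y t ω) k : Fin (p + 1) → ℝ)‖) ∂μ ≤ D * M := by
      simp only [integral_const_mul, hMk, ← Finset.sum_mul]
      gcongr
    have h2 : ∑ β ∈ net', ∫ ω, (|∑ k ∈ s N, w N k * (g β (lagSq (fun t => Y t ω) k) - G β)| +
        |∑ k ∈ s N, w N k - 1| * |G β|) ∂μ ≤ η / 2 := by
      refine le_trans (le_of_eq ?_) hN2.le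
      refine Finset.sum_congr rfl fun β hβ => ?_
      rw [integral_add _ (integrable_const _)]
      · simp
      · exact (integrable_finsetSum _ fun (k : ℕ) _ =>
          ((hgi β (hmem β hβ) k).sub (integrable_const _)).const_mul (w N k)).abs
    have h3 : C * e * (D * M + M) ≤ η / 2 := by
      have : C * e * (D * M + M) =
          (C * (D + 1) * M) / (C * (D + 1) * M + 1) * (η / 2) := by rw [he]; field_simp
      rw [this]
      calc _ ≤ 1 * (η / 2) := by
            gcongr
            rw [div_le_one (by positivity)]; linarith
        _ = _ := one_mul _
    have h4 : ∫ _ω : S, M ∂μ = M := by simp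
    rw [h4]
    have h5 : C * e * (∑ k ∈ s N, ∫ ω, |w N k| *
        (1 + ‖(lagSq (fun t => Y t ω) k : Fin (p + 1) → ℝ)‖) ∂μ + M) ≤ C * e * (D * M + M) := by
      gcongr
    linarith

/-- Along the window, the drift bound tends to zero. -/
lemma eventually_driftBound_le {A B K r : ℝ} (hA : 0 ≤ A) (hK : 0 ≤ K) (hr0 : 0 < r)
    (hr1 : r < 1) {u₀ : ℝ} (hu₀ : u₀ ∈ Ioo (0 : ℝ) 1) {t₀ : ℕ → ℕ}
    (ht₀ : ∀ᶠ N : ℕ in atTop, |u₀ - (t₀ N : ℝ) / N| < 1 / N) {b : ℕ → ℝ}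
    (hb : Tendsto b atTop (𝓝 0)) (q : ℕ) {ε : ℝ} (hε : 0 < ε) :
    ∀ᶠ N : ℕ in atTop, ∀ k : ℤ, |(t₀ N : ℝ) - k| ≤ b N * N → ∀ j : ℕ, j ≤ q →
      driftBound A B K r u₀ N (k - j) ≤ ε := by
  have h1 : Tendsto (fun n : ℕ => K * r ^ n) atTop (𝓝 0) := by
    simpa using (tendsto_pow_atTop_nhds_zero_of_lt_one hr0.le hr1).const_mul K
  obtain ⟨n, hn⟩ := (h1.eventually (gt_mem_nhds (half_pos hε))).exists
  -- A lagged time in the window is within b of t₀/N up to the lag q/N, and t₀/N is within 1/N of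
  -- `u₀`. The geometric term is handled by keeping the lagged times beyond `n`.
  have h2 : Tendsto (fun N : ℕ => A * ((b N + (q + 1) / N) + B / N)) atTop (𝓝 0) := by
    have h3 := tendsto_const_div_atTop_nhds_zero_nat ((q : ℝ) + 1)
    have h4 := tendsto_const_div_atTop_nhds_zero_nat B
    simpa using ((hb.add h3).add h4).const_mul A
  filter_upwards [eventually_window hu₀ ht₀ hb (n + q), ht₀, eventually_gt_atTop 0,
    h2.eventually (gt_mem_nhds (half_pos hε))] with N hN1 hN2 hN3 hN4 k hk j hj
  have hN : (0 : ℝ) < N := by exact_mod_cast hN3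
  have hjq : (j : ℝ) ≤ q := by exact_mod_cast hj
  have h5 : (n : ℤ) ≤ k - j := by
    have h6 := (hN1 k hk).1
    have h7 : ((n + q : ℕ) : ℤ) ≤ k := by exact_mod_cast h6
    push_cast at h7
    omega
  have h6 : r ^ (k - j : ℤ) ≤ r ^ n := by
    rw [← zpow_natCast]
    exact zpow_le_zpow_right_of_le_one₀ hr0 hr1.le h5
  have h7 : |((k - j : ℤ) : ℝ) / N - u₀| ≤ b N + (q + 1) / N := by
    have e : ((k - j : ℤ) : ℝ) / N - u₀ =
        -(((t₀ N : ℝ) - k) / N) + (-((j : ℝ) / N) + -(u₀ - (t₀ N : ℝ) / N)) := by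
      push_cast; ring
    rw [e]
    refine (abs_add_le _ _).trans (add_le_add ?_ ((abs_add_le _ _).trans ?_))
    · rw [abs_neg, abs_div, abs_of_pos hN, div_le_iff₀ hN]; exact hk
    · rw [abs_neg, abs_neg, abs_of_nonneg (by positivity), add_div]
      gcongr
  rw [driftBound]
  have h8 : A * (|((k - j : ℤ) : ℝ) / N - u₀| + B / N) ≤ A * ((b N + (q + 1) / N) + B / N) := by
    gcongr
  have h9 : K * r ^ (k - j : ℤ) ≤ K * r ^ n := by gcongr
  linarith

/-- Replacing the time-varying process by its stationary approximation in local averages. -/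
theorem IsTVARCH.unifTendstoInMean_sum_sub [IsProbabilityMeasure μ] {Z : ℤ → S → ℝ}
    (hZ : IsInnovation μ Z) {a : Fin (p + 1) → ℝ → ℝ} {ν L : ℝ} (ha : RegularParam a ν L)
    {X : ℕ → ℤ → S → ℝ} (hX : IsTVARCH μ Z a X) {u₀ : ℝ} (hu₀ : u₀ ∈ Ioo (0 : ℝ) 1)
    {Y : ℤ → S → ℝ} (hY : IsStationaryARCH μ Z (fun j => a j u₀) Y)
    {t₀ : ℕ → ℕ} (ht₀ : ∀ᶠ N : ℕ in atTop, |u₀ - (t₀ N : ℝ) / N| < 1 / N)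
    {b : ℕ → ℝ} (hb : Tendsto b atTop (𝓝 0)) {K : Set (Param p)} {C : ℝ}
    {g : Param p → (Fin (p + 1) → ℝ) → ℝ} (hg : TameFamily K C g)
    {w : ℕ → ℕ → ℝ} {D : ℝ} (hD0 : 0 ≤ D)
    (hD : ∀ᶠ N in atTop, ∑ k ∈ Finset.Icc (p + 1) N, |w N k| ≤ D)
    (hw : ∀ᶠ N in atTop, ∀ k, w N k ≠ 0 → |(t₀ N : ℝ) - k| ≤ b N * N) :
    UnifTendstoInMean μ K (fun N ω α => ∑ k ∈ Finset.Icc (p + 1) N, w N k *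
      (g α (lagSq (fun t => X N t ω) k) - g α (lagSq (fun t => Y t ω) k))) 0 := by
  have hu₀' : u₀ ∈ Ioc (0 : ℝ) 1 := ⟨hu₀.1, hu₀.2.le⟩
  have hV := hY.isSquaredARCH
  have hVi := fun t => hV.integrable hZ (ha.nonneg u₀ hu₀') ha.pos ha.lt_one (ha.sum_le u₀ hu₀') t
  obtain ⟨A, B, K', r, hA, hB, hK', hr0, hr1, hdrift⟩ := hX.exists_driftBound hZ ha hu₀' hV
  intro η hη
  have hC := hg.nonneg
  have htail : Tendsto (fun n : ℕ => D *
      (C * ∫ ω, (if (n : ℝ) < Y 0 ω ^ 2 then Y 0 ω ^ 2 else 0) ∂μ)) atTop (𝓝 0) := by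
    simpa using ((tendsto_integral_tail (hVi 0)).const_mul C).const_mul D
  -- The tail level `T` is fixed by integrability of the stationary square; afterwards `ε`, the
  -- permitted drift, is chosen for the Lipschitz constant `C * (1 + T)`.
  obtain ⟨T, hT⟩ := (htail.eventually (gt_mem_nhds (half_pos hη))).exists
  set ε := η / (2 * (D * (C * (1 + T) * (p + 1)) + 1)) with hε
  have hε0 : 0 < ε := by positivity
  filter_upwards [hD, hw, eventually_driftBound_le (B := B) hA hK' hr0 hr1 hu₀ ht₀ hb p hε0]
    with N hN1 hN2 hN3
  have hidx : ∀ k ∈ Finset.Icc (p + 1) N, ∀ j : Fin (p + 1),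
      1 - (p : ℤ) ≤ (k : ℤ) - (j : ℕ) ∧ (k : ℤ) - (j : ℕ) ≤ N := fun k hk j => by
    have := j.2
    have := Finset.mem_Icc.1 hk
    omega
  have hdi : ∀ k ∈ Finset.Icc (p + 1) N, ∀ j : Fin (p + 1), Integrable
      (fun ω => |X N ((k : ℤ) - (j : ℕ)) ω ^ 2 - Y ((k : ℤ) - (j : ℕ)) ω ^ 2|) μ := by
    intro k hk j
    refine ⟨?_, ?_⟩
    · exact (((hX.aestronglyMeasurable_sq (hidx k hk j).1 (hidx k hk j).2).mono
        (hZ.sigmaOf_le _)).sub (hVi _).aestronglyMeasurable).norm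
    · rw [hasFiniteIntegral_iff_ofReal (Eventually.of_forall fun ω => abs_nonneg _)]
      exact (hdrift N _ (hidx k hk j).1 (hidx k hk j).2).trans_lt ENNReal.ofReal_lt_top
  have hdb : ∀ k ∈ Finset.Icc (p + 1) N, w N k ≠ 0 → ∀ j : Fin (p + 1),
      ∫ ω, |X N ((k : ℤ) - (j : ℕ)) ω ^ 2 - Y ((k : ℤ) - (j : ℕ)) ω ^ 2| ∂μ ≤ ε := by
    intro k hk hwk j
    have h1 := hdrift N _ (hidx k hk j).1 (hidx k hk j).2
    have h2 := hN3 k (by exact_mod_cast hN2 k hwk) j (by have := j.2; omega)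
    rw [integral_eq_lintegral_of_nonneg_ae (Eventually.of_forall fun ω => abs_nonneg _)
      (hdi k hk j).aestronglyMeasurable]
    exact ENNReal.toReal_le_of_le_ofReal hε0.le (h1.trans (ENNReal.ofReal_le_ofReal h2))
  have hti : ∀ k : ℕ, Integrable (fun ω => if (T : ℝ) < Y k ω ^ 2 then Y k ω ^ 2 else 0) μ :=
    fun k => integrable_tail (hVi k) T
  have htk : ∀ k : ℕ, ∫ ω, (if (T : ℝ) < Y k ω ^ 2 then Y k ω ^ 2 else 0) ∂μ =
      ∫ ω, (if (T : ℝ) < Y 0 ω ^ 2 then Y 0 ω ^ 2 else 0) ∂μ := fun k =>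
    ((hV.identDistrib k).comp (u := fun x : ℝ => if (T : ℝ) < x then x else 0)
      (Measurable.ite measurableSet_Ioi measurable_id measurable_const)).integral_eq
  have hsi : ∀ k ∈ Finset.Icc (p + 1) N, Integrable (fun ω => C * (1 + T) * ∑ j : Fin (p + 1),
      |X N ((k : ℤ) - (j : ℕ)) ω ^ 2 - Y ((k : ℤ) - (j : ℕ)) ω ^ 2|) μ := fun k hk =>
    (integrable_finsetSum _ fun j _ => hdi k hk j).const_mul _
  have hki : ∀ k ∈ Finset.Icc (p + 1) N, Integrable (fun ω => |w N k| *
      (C * (1 + T) * ∑ j : Fin (p + 1),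
        |X N ((k : ℤ) - (j : ℕ)) ω ^ 2 - Y ((k : ℤ) - (j : ℕ)) ω ^ 2| +
        C * (if (T : ℝ) < Y k ω ^ 2 then Y k ω ^ 2 else 0))) μ := fun k hk =>
    ((hsi k hk).add ((hti k).const_mul C)).const_mul _
  have ht0 : ∀ (k : ℕ) ω, 0 ≤ (if (T : ℝ) < Y k ω ^ 2 then Y k ω ^ 2 else 0) := fun k ω => by
    split_ifs; exacts [sq_nonneg _, le_rfl]
  refine ⟨fun ω => ∑ k ∈ Finset.Icc (p + 1) N, |w N k| * (C * (1 + T) * ∑ j : Fin (p + 1),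
      |X N ((k : ℤ) - (j : ℕ)) ω ^ 2 - Y ((k : ℤ) - (j : ℕ)) ω ^ 2| +
      C * (if (T : ℝ) < Y k ω ^ 2 then Y k ω ^ 2 else 0)),
    integrable_finsetSum _ hki, fun ω => Finset.sum_nonneg fun k _ => ?_,
    Eventually.of_forall fun ω α hα => ?_, ?_⟩
  · have := ht0 k ω
    positivity
  · rw [Pi.zero_apply, sub_zero, Real.norm_eq_abs]
    refine (Finset.abs_sum_le_sum_abs _ _).trans (Finset.sum_le_sum fun k _ => ?_)
    rw [abs_mul]
    gcongr
    have h1 := hg.lag T (Nat.cast_nonneg T) α hα (lagSq (fun t => X N t ω) k)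
      (lagSq (fun t => Y t ω) k) (lagSq_nonneg _ _) (lagSq_nonneg _ _)
    have h2 : lagSq (p := p) (fun t => Y t ω) k 0 = Y k ω ^ 2 := by simp [lagSq]
    rw [h2] at h1
    refine h1.trans ?_
    gcongr
    refine (pi_norm_le_iff_of_nonneg (Finset.sum_nonneg fun j _ => abs_nonneg _)).2 fun j => ?_
    exact Finset.single_le_sum (f := fun j : Fin (p + 1) =>
      |X N ((k : ℤ) - (j : ℕ)) ω ^ 2 - Y ((k : ℤ) - (j : ℕ)) ω ^ 2|)
      (fun j _ => abs_nonneg _) (Finset.mem_univ j)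
  · rw [integral_finsetSum _ hki]
    set τ := ∫ ω, (if (T : ℝ) < Y 0 ω ^ 2 then Y 0 ω ^ 2 else 0) ∂μ with hτ
    have hτ0 : 0 ≤ τ := integral_nonneg fun ω => by simpa using ht0 0 ω
    have hk : ∀ k ∈ Finset.Icc (p + 1) N, ∫ ω, |w N k| * (C * (1 + T) * ∑ j : Fin (p + 1),
        |X N ((k : ℤ) - (j : ℕ)) ω ^ 2 - Y ((k : ℤ) - (j : ℕ)) ω ^ 2| +
        C * (if (T : ℝ) < Y k ω ^ 2 then Y k ω ^ 2 else 0)) ∂μ ≤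
        |w N k| * (C * (1 + T) * ((p + 1) * ε) + C * τ) := by
      intro k hk
      rw [integral_const_mul]
      -- The drift bound is small only inside the window, and outside it the weight vanishes.
      by_cases hwk : w N k = 0
      · simp [hwk]
      · rw [integral_add (hsi k hk) ((hti k).const_mul C), integral_const_mul, integral_const_mul,
          htk, integral_finsetSum _ fun j _ => hdi k hk j]
        gcongr
        refine (Finset.sum_le_sum fun j _ => hdb k hk hwk j).trans ?_
        simp
    refine (Finset.sum_le_sum hk).trans ?_
    rw [← Finset.sum_mul]
    have h1 : (∑ k ∈ Finset.Icc (p + 1) N, |w N k|) * (C * (1 + T) * ((p + 1) * ε) + C * τ) ≤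
        D * (C * (1 + T) * ((p + 1) * ε) + C * τ) := by gcongr
    have h2 : D * (C * (1 + T) * ((p + 1) * ε)) ≤ η / 2 := by
      have : D * (C * (1 + T) * ((p + 1) * ε)) =
        (D * (C * (1 + T) * (p + 1))) / (D * (C * (1 + T) * (p + 1)) + 1) * (η / 2) := by
        rw [hε]; field_simp
      rw [this]
      calc _ ≤ 1 * (η / 2) := by
            gcongr
            rw [div_le_one (by positivity)]; linarith
        _ = _ := one_mul _
    rw [mul_add] at h1
    linarith

end TVARCH

namespace TVARCH

/-! ### The local quasi-likelihood -/

lemma paramSet_subset_box (p : ℕ) {ρ₁ ρ₂ : ℝ} (hρ₁ : 0 < ρ₁) :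
    paramSet p ρ₁ ρ₂ ⊆ box p ρ₁ (max ρ₂ 1) := by
  rintro α ⟨h1, h2, h3, h4⟩ i
  refine Fin.cases ⟨h2, h3.trans (le_max_left _ _)⟩ (fun j => ⟨h4 j, le_max_of_le_right ?_⟩) i
  exact (Finset.single_le_sum (f := fun j : Fin p => α j.succ)
    (fun j _ => hρ₁.le.trans (h4 j)) (Finset.mem_univ j)).trans h1

/-- The setting of the limit theorems for local weighted averages. -/
structure LocalSetting {S : Type*} [MeasurableSpace S] (μ : Measure S) {p : ℕ} (K : Set (Param p))
    (W : ℝ → ℝ) (b : ℕ → ℝ) (t₀ : ℕ → ℕ) (X : ℕ → ℤ → S → ℝ) (Y : ℤ → S → ℝ) : Prop where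
  integrable : ∀ k : ℤ, Integrable (fun ω => (lagSq (fun t => Y t ω) k : Fin (p + 1) → ℝ)) μ
  stationary : ∀ g : Param p → (Fin (p + 1) → ℝ) → ℝ, (∃ C, TameFamily K C g) →
    UnifTendstoInMean μ K (fun N ω α => ∑ k ∈ Finset.Icc (p + 1) N,
      1 / (b N * N) * W (((t₀ N : ℝ) - k) / (b N * N)) * g α (lagSq (fun t => Y t ω) k))
      (fun α => ∫ ω, g α (lagSq (fun t => Y t ω) 0) ∂μ)
  difference : ∀ g : Param p → (Fin (p + 1) → ℝ) → ℝ, (∃ C, TameFamily K C g) →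
    UnifTendstoInMean μ K (fun N ω α => ∑ k ∈ Finset.Icc (p + 1) N,
      1 / (b N * N) * W (((t₀ N : ℝ) - k) / (b N * N)) *
        (g α (lagSq (fun t => X N t ω) k) - g α (lagSq (fun t => Y t ω) k))) 0

/-- The kernel provides what the two limit theorems ask of the weights: absolute sums at most `2 *
C`, maxima at most `C / (b N * N)`, total weight tending to 1, and support in the window. -/
theorem IsTVARCH.localSetting {S : Type*} [MeasurableSpace S] {μ : Measure S}
    [IsProbabilityMeasure μ] {Z : ℤ → S → ℝ} (hZ : IsInnovation μ Z) {p : ℕ}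
    {a : Fin (p + 1) → ℝ → ℝ} {ν L : ℝ} (ha : RegularParam a ν L)
    {X : ℕ → ℤ → S → ℝ} (hX : IsTVARCH μ Z a X) {u₀ : ℝ} (hu₀ : u₀ ∈ Ioo (0 : ℝ) 1)
    {Y : ℤ → S → ℝ} (hY : IsStationaryARCH μ Z (fun j => a j u₀) Y)
    {t₀ : ℕ → ℕ} (ht₀ : ∀ᶠ N : ℕ in atTop, |u₀ - (t₀ N : ℝ) / N| < 1 / N)
    {W : ℝ → ℝ} (hW : IsKernel W) {b : ℕ → ℝ} (hb : Tendsto b atTop (𝓝 0))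
    (hbN : Tendsto (fun N : ℕ => b N * N) atTop atTop) {K : Set (Param p)} (hK : IsCompact K) :
    LocalSetting μ K W b t₀ X Y := by
  obtain ⟨C, hC0, hC⟩ := hW.exists_bound
  have hu₀' : u₀ ∈ Ioc (0 : ℝ) 1 := ⟨hu₀.1, hu₀.2.le⟩
  have hα := ha.nonneg u₀ hu₀'
  have hsum := ha.sum_le u₀ hu₀'
  set w : ℕ → ℕ → ℝ := fun N k => kernelWeight W (b N * N) (t₀ N) k with hw
  have hD : ∀ᶠ N in atTop, ∑ k ∈ Finset.Icc (p + 1) N, |w N k| ≤ 2 * C := by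
    filter_upwards [hbN.eventually_ge_atTop 1] with N hN
    exact sum_abs_kernelWeight_le hW hC0.le hC hN _ _
  have hwin : ∀ᶠ N : ℕ in atTop, ∀ k : ℤ, |(t₀ N : ℤ) - k| ≤ b N * N →
      ∃ j ∈ Finset.Icc (p + 1) N, (j : ℤ) = k := by
    filter_upwards [eventually_window hu₀ ht₀ hb (p + 1)] with N hN k hk
    obtain ⟨h1, h2⟩ := hN k (by push_cast at hk; exact hk)
    have h1' : ((p + 1 : ℕ) : ℤ) ≤ k := by exact_mod_cast h1
    have h2' : k ≤ N := by exact_mod_cast h2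
    exact ⟨k.toNat, Finset.mem_Icc.2 (by omega), by omega⟩
  refine ⟨fun k => Integrable.of_eval fun j =>
    hY.isSquaredARCH.integrable hZ hα ha.pos ha.lt_one hsum _, fun g ⟨C', hg⟩ => ?_,
    fun g ⟨C', hg⟩ => ?_⟩
  · refine hY.unifTendstoInMean_sum hZ hα ha.pos ha.lt_one hsum hK hg (w := w)
      (c := fun N : ℕ => C / (b N * N)) (by positivity) hD ?_ ?_ ?_ ?_
    · filter_upwards [hbN.eventually_gt_atTop 0] with N hN k _
      exact abs_kernelWeight_le hC hN _ _
    · filter_upwards [hbN.eventually_gt_atTop 0] with N hN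
      positivity
    · exact tendsto_const_nhds.div_atTop hbN
    · exact tendsto_sum_kernelWeight hW hbN hwin
  · refine hX.unifTendstoInMean_sum_sub hZ ha hu₀ hY ht₀ hb hg (w := w) (D := 2 * C)
      (by positivity) hD ?_
    filter_upwards [hbN.eventually_gt_atTop 0] with N hN k hk
    exact (kernelWeight_ne_zero hW hN hk).trans (by linarith)

end TVARCH

/- The norm of a matrix is the largest absolute value of its entries. -/
attribute [local instance] Matrix.normedAddCommGroup
-- Proof of the main theorem
open TVARCH in
theorem lemma1 {S : Type*} [MeasurableSpace S] (μ : Measure S) [IsProbabilityMeasure μ]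
    (Z : ℤ → S → ℝ) (hZ : IsInnovation μ Z)
    (p : ℕ) (a : Fin (p + 1) → ℝ → ℝ) (ha : ParamCond a)
    (ρ₁ ρ₂ : ℝ) (hρ₁ : 0 < ρ₁) (hρ₂ : ρ₁ ≤ ρ₂)
    (ha_int : ∀ u ∈ Ioc (0 : ℝ) 1, (fun j => a j u) ∈ interior (paramSet p ρ₁ ρ₂))
    (X : ℕ → ℤ → S → ℝ) (hX : IsTVARCH μ Z a X)
    (u₀ : ℝ) (hu₀ : u₀ ∈ Ioo (0 : ℝ) 1)
    (Y : ℤ → S → ℝ) (hY : IsStationaryARCH μ Z (fun j => a j u₀) Y)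
    (t₀ : ℕ → ℕ) (ht₀ : ∀ᶠ N : ℕ in atTop, |u₀ - (t₀ N : ℝ) / N| < 1 / N)
    (W : ℝ → ℝ) (hW : IsKernel W)
    (b : ℕ → ℝ) (hb : Tendsto b atTop (𝓝 0))
    (hbN : Tendsto (fun N : ℕ => b N * N) atTop atTop) :
    (∀ α ∈ paramSet p ρ₁ ρ₂, Integrable (fun ω => quasiLik α (fun t => Y t ω) 0) μ ∧
      ContDiffAt ℝ 2 (limitLik μ Y) α) ∧
    UnifTendstoInProb μ (paramSet p ρ₁ ρ₂) (fun N ω => statLik W b t₀ Y N ω) (limitLik μ Y) ∧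
    UnifTendstoInProb μ (paramSet p ρ₁ ρ₂) (fun N ω => bias W b t₀ X Y N ω) 0 ∧
    UnifTendstoInProb μ (paramSet p ρ₁ ρ₂) (fun N ω => hessian (statLik W b t₀ Y N ω))
      (hessian (limitLik μ Y)) ∧
    UnifTendstoInProb μ (paramSet p ρ₁ ρ₂) (fun N ω => hessian (bias W b t₀ X Y N ω)) 0 ∧
    UnifTendstoInProb μ (paramSet p ρ₁ ρ₂) (fun N ω => localLik W b t₀ X N ω) (limitLik μ Y) ∧
    UnifTendstoInProb μ (paramSet p ρ₁ ρ₂) (fun N ω => hessian (localLik W b t₀ X N ω))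
      (hessian (limitLik μ Y)) := by
  have hsub := paramSet_subset_box p (ρ₂ := ρ₂) hρ₁
  have hpos : ∀ α ∈ paramSet p ρ₁ ρ₂, ∀ i, 0 < α i := fun α hα i =>
    hρ₁.trans_le (hsub hα i).1
  obtain ⟨ν, L, hreg⟩ := ha.exists_regularParam fun u hu i =>
    (hpos _ (interior_subset (ha_int u hu)) i).le
  -- The limit theorems are applied on a compact box containing the parameter set; the results are
  -- then restricted to that set.
  have hS := hX.localSetting hZ hreg hu₀ hY ht₀ hW hb hbN (isCompact_box p ρ₁ (max ρ₂ 1))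
  have hR : (0 : ℝ) ≤ max ρ₂ 1 := le_max_of_le_right zero_le_one
  have htl := tameFamily_lagLik (p := p) hρ₁ hR
  have hth := fun i j => tameFamily_lagHess (p := p) hρ₁ hR i j
  have hv0 : ∀ ω, 0 ≤ (lagSq (fun t => Y t ω) 0 : Fin (p + 1) → ℝ) := fun ω => lagSq_nonneg _ _
  have hvi := hS.integrable 0
  have elim : (limitLik μ Y : Param p → ℝ) =
      fun α => ∫ ω, lagLik α (lagSq (fun t => Y t ω) 0) ∂μ := by
    funext α; simp only [limitLik, quasiLik_eq]
  have hstat : UnifTendstoInMean μ (paramSet p ρ₁ ρ₂) (fun N ω => statLik W b t₀ Y N ω)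
      (limitLik μ Y) :=
    ((hS.stationary _ htl).mono hsub).congr
      (fun N ω α _ => (kernelLik_eq W (b N) N (t₀ N) _ α).symm)
      (fun α _ => (congrFun elim α).symm)
  have hbias : UnifTendstoInMean μ (paramSet p ρ₁ ρ₂) (fun N ω => bias W b t₀ X Y N ω) 0 :=
    ((hS.difference _ htl).mono hsub).congr
      (fun N ω α _ => by
        rw [bias, localLik, statLik, kernelLik_eq, kernelLik_eq, ← Finset.sum_sub_distrib]
        exact Finset.sum_congr rfl fun k _ => by ring)
      (fun α _ => rfl)
  have hstatH : UnifTendstoInMean μ (paramSet p ρ₁ ρ₂)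
      (fun N ω => hessian (statLik W b t₀ Y N ω)) (hessian (limitLik μ Y)) :=
    unifTendstoInMean_matrix fun i j => ((hS.stationary _ (hth i j)).mono hsub).congr
      (fun N ω α hα => (hessian_kernelLik W (b N) N (t₀ N) _ (hpos α hα) i j).symm)
      (fun α hα => by rw [elim, hessian_integral_lagLik hvi hv0 (hpos α hα)])
  have hbiasH : UnifTendstoInMean μ (paramSet p ρ₁ ρ₂)
      (fun N ω => hessian (bias W b t₀ X Y N ω)) 0 :=
    unifTendstoInMean_matrix fun i j => ((hS.difference _ (hth i j)).mono hsub).congr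
      (fun N ω α hα => (hessian_kernelLik_sub W (b N) N (t₀ N) _ _ (hpos α hα) i j).symm)
      (fun α _ => rfl)
  have hloc : UnifTendstoInMean μ (paramSet p ρ₁ ρ₂) (fun N ω => localLik W b t₀ X N ω)
      (limitLik μ Y) :=
    (hstat.add hbias).congr (fun N ω α _ => by rw [bias]; ring) (fun α _ => by simp)
  have hlocH : UnifTendstoInMean μ (paramSet p ρ₁ ρ₂)
      (fun N ω => hessian (localLik W b t₀ X N ω)) (hessian (limitLik μ Y)) := by
    -- Additivity of the Hessian is read off from the three explicit formulas as weighted sums.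
    refine (hstatH.add hbiasH).congr (fun N ω α hα => ?_) (fun α _ => by simp)
    ext i j
    have h1 : hessian (bias W b t₀ X Y N ω) α i j = _ :=
      hessian_kernelLik_sub W (b N) N (t₀ N) _ _ (hpos α hα) i j
    have h2 : hessian (statLik W b t₀ Y N ω) α i j = _ :=
      hessian_kernelLik W (b N) N (t₀ N) _ (hpos α hα) i j
    have h3 : hessian (localLik W b t₀ X N ω) α i j = _ :=
      hessian_kernelLik W (b N) N (t₀ N) _ (hpos α hα) i j
    rw [Matrix.add_apply, h1, h2, h3, ← Finset.sum_add_distrib]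
    exact Finset.sum_congr rfl fun k _ => by ring
  refine ⟨fun α hα => ⟨?_, ?_⟩, hstat.unifTendstoInProb, hbias.unifTendstoInProb,
    hstatH.unifTendstoInProb, hbiasH.unifTendstoInProb, hloc.unifTendstoInProb,
    hlocH.unifTendstoInProb⟩
  · simp only [quasiLik_eq]
    exact integrable_lagLik hvi hv0 (hpos α hα)
  · rw [elim]
    exact contDiffAt_integral_lagLik hvi hv0 (hpos α hα)
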